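/- **Setting.** Fix constants $\gamma>1$, $b_0>0$, $0<r_1<r_2$, $\theta_0\in(0,\frac{\pi}{2})$, $\rho_0,U_0,P_0>0$, $E_0\in\mathbb R$, and put $\mathcal R=r_2-r_1$, $\hat r=r_2-r$, $J_0=r_2\rho_0U_0$, $S_0=\ln(P_0/\rho_0^\gamma)$. Let $(\bar\rho,\bar U,\bar P,\bar E)$ be a smooth solution on $[0,\mathcal R]$ of $$(\hat r\bar\rho\bar U)'=0,\quad (\hat r\bar\rho\bar U^2)'+\hat r\bar P'=-\hat r\bar\rho\bar E,\quad \Big(\hat r\bar\rho\bar U\Big(\tfrac{\bar U^2}{2}+\tfrac{\gamma\bar P}{(\gamma-1)\bar\rho}\Big)\Big)'=-\hat r\bar\rho\bar U\bar E,\quad (\hat r\bar E)'=-\hat r(\bar\rho-b_0),$$ with $(\bar\rho,\bar U,\bar P,\bar E)(0)=(\rho_0,U_0,P_0,-E_0)$, $\bar\rho>0$, and supersonic: $\bar c^2:=\gamma\bar P/\bar\rho<\bar U^2$ on $[0,\mathcal R]$. These constants and this solution (which they determine) are the *background data*. Let $$\bar\Phi(r)=-\int_0^r\bar E\,dt+\frac{U_0^2}{2}+\frac{\gamma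 e^{S_0}}{\gamma-1}\Big(\frac{J_0}{r_2U_0}\Big)^{\gamma-1}.$$ For $0<R<\mathcal R$ let $\Omega_R=\{(r,\theta):0<r<R,\ |\theta|<\theta_0\}$, with entrance $\Gamma_{en}=\{r=0\}$, exit $\Gamma_{ex}=\{r=R\}$ and walls $\Gamma_w=\{\theta=\pm\theta_0\}$; Sobolev and Lebesgue norms on $\Omega_R$ are taken with respect to $dr\,d\theta$. For $\delta_\mu,\delta_\nu>0$ let $\mathcal I_{\delta_\mu,R}$ be the set of pairs $(\mathcal S^*,\mathcal K^*)\in[H^4(\Omega_R)]^2$ with $\|\mathcal S^*\|_{H^4}+\|\mathcal K^*\|_{H^4}<\delta_\mu$ and $\partial_\theta^k\mathcal S^*=\partial_\theta^k\mathcal K^*=0$ on $\Gamma_w$ for $k=1,3$, and let $\mathcal I_{\delta_\nu,R}$ be the set of triples $(\mathcal U^*,\mathcal V^*,\check\Phi^*)\in[H^3(\Omega_R)]^2\times H^4(\Omega_R)$ with $\|\mathcal U^*\|_{H^3}+\|\mathcal V^*\|_{H^3}+\|\check\Phi^*\|_{H^4}<\delta_\nu$ and $\partial_\theta\mathcal U^*=\partial_\theta^{k-1}\mathcal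 V^*=\partial_\theta^k\check\Phi^*=0$ on $\Gamma_w$ for $k=1,3$ (all in the sense of traces). Given such elements put $U=\bar U+\mathcal U^*$, $V=\mathcal V^*$, $c^2=(\gamma-1)\big(\mathcal K^*+\bar\Phi+\check\Phi^*-\tfrac12(U^2+V^2)\big)$, $$a_{11}=\frac{c^2-U^2}{\bar c^2},\quad a_{22}=\frac{c^2-V^2}{\hat r^2\bar c^2},\quad a_{12}=-\frac{UV}{\hat r\bar c^2},\quad a_2=\frac{a_{12}}{\hat r},$$ $$\bar a_1=\frac{(\gamma-1)\bar U^2-\bar c^2}{\hat r\bar c^2}-\frac{(\gamma+1)\bar U\bar U'+\bar E}{\bar c^2},\quad \bar b_1=-\frac{(\gamma-1)\bar U}{\hat r\bar c^2}+\frac{(\gamma-1)\bar U'}{\bar c^2},\quad \bar b_2=\frac{\bar U}{\bar c^2},\quad \bar c_1=\frac{\bar\rho\bar U}{\bar c^2},\quad \bar c_2=-\frac{\bar\rho}{\bar c^2},$$ and consider for $(\varphi,\Psi)$ the boundary value problem $$\begin{cases} a_{11}\varphi_{rr}+a_{22}\varphi_{\theta\theta}+2a_{12}\varphi_{r\theta}+\bar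 a_1\varphi_r+a_2\varphi_\theta+\bar b_1\Psi+\bar b_2\Psi_r=F_1 &\text{in }\Omega_R,\\ \Psi_{rr}+\frac1{\hat r^2}\Psi_{\theta\theta}-\frac1{\hat r}\Psi_r+\bar c_1\varphi_r+\bar c_2\Psi=F_2&\text{in }\Omega_R,\\ (\varphi_r,\varphi,\Psi_r)=(g(\theta),0,0)\ \text{on }\Gamma_{en},\qquad \Psi=0\ \text{on }\Gamma_{ex},\qquad \varphi_\theta=\Psi_\theta=0\ \text{on }\Gamma_w.\end{cases}\tag{$*$}$$ **Proposition 3.1.** For every $\epsilon_0\in(0,\frac1{10}\mathcal R)$ there are constants $\bar R\in(0,\mathcal R-\epsilon_0]$, $\delta_0>0$ and $C>0$, depending only on the background data and $\epsilon_0$, such that the following holds for every $R\in(0,\bar R)$, all $\delta_\mu,\delta_\nu$ with $\max\{\delta_\mu,\delta_\nu\}\le\delta_0\sqrt R$, all $(\mathcal S^*,\mathcal K^*)\in\mathcal I_{\delta_\mu,R}$ and $(\mathcal U^*,\mathcal V^*,\check\Phi^*)\in\mathcal I_{\delta_\nu,R}$, and all functions $F_1,F_2$ on $\Omega_R$ and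 $g$ on $[-\theta_0,\theta_0]$: every solution $(\varphi,\Psi)\in[C^2(\overline{\Omega_R})]^2$ of $(*)$ satisfies $$\|\varphi\|_{H^1(\Omega_R)}+\|\Psi\|_{H^1(\Omega_R)}\le C\big(\|F_1\|_{L^2(\Omega_R)}+\|F_2\|_{L^2(\Omega_R)}+\|g\|_{L^2([-\theta_0,\theta_0])}\big).$$ -/

import Mathlib

open Set MeasureTheory
open scoped ContDiff ENNReal

noncomputable section

namespace EulerPoisson

/-! ## Sobolev norms in the variables `(r, θ)` -/

/-- `∂_r` of a function on the whole plane. -/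
def dr (f : ℝ × ℝ → ℝ) : ℝ × ℝ → ℝ := fun p => deriv (fun s => f (s, p.2)) p.1

/-- `∂_θ` of a function on the whole plane. -/
def dθ (f : ℝ × ℝ → ℝ) : ℝ × ℝ → ℝ := fun p => deriv (fun t => f (p.1, t)) p.2

/-- `g` is the weak derivative `∂_r^i ∂_θ^j f` on the open set `Ω`. -/
def HasWeakPartial (Ω : Set (ℝ × ℝ)) (i j : ℕ) (f g : ℝ × ℝ → ℝ) : Prop :=
  LocallyIntegrableOn f Ω ∧ LocallyIntegrableOn g Ω ∧
    ∀ η : ℝ × ℝ → ℝ, ContDiff ℝ ∞ η → HasCompactSupport η → tsupport η ⊆ Ω →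
      ∫ p in Ω, f p * (dr^[i] (dθ^[j] η)) p = (-1) ^ (i + j) * ∫ p in Ω, g p * η p

/-- The multi-indices `(i, j)` of order at most `k`. -/
def multiIndices (k : ℕ) : Finset (ℕ × ℕ) :=
  (Finset.range (k + 1) ×ˢ Finset.range (k + 1)).filter (fun a => a.1 + a.2 ≤ k)

/-- `G` is a family of weak derivatives of `f` up to order `k`, all of them in `L²(Ω)`. -/
def IsSobolevFamily (k : ℕ) (Ω : Set (ℝ × ℝ)) (f : ℝ × ℝ → ℝ) (G : ℕ × ℕ → ℝ × ℝ → ℝ) : Prop :=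
  ∀ a ∈ multiIndices k, HasWeakPartial Ω a.1 a.2 f (G a) ∧ MemLp (G a) 2 (volume.restrict Ω)

/-- The norm `‖f‖_{H^k(Ω)} = (∑_{|a| ≤ k} ‖∂^a f‖²_{L²(Ω)})^{1/2}`, which is `∞` exactly when `f` is
not in `H^k(Ω)`. Weak derivatives are unique almost everywhere, so the infimum runs over a single
value, or over nothing (and is then `∞`). -/
def sobolevNorm (k : ℕ) (Ω : Set (ℝ × ℝ)) (f : ℝ × ℝ → ℝ) : ℝ≥0∞ :=
  ⨅ (G : ℕ × ℕ → ℝ × ℝ → ℝ) (_ : IsSobolevFamily k Ω f G),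
    (∑ a ∈ multiIndices k, eLpNorm (G a) 2 (volume.restrict Ω) ^ 2) ^ (1 / 2 : ℝ)

/-! ## The domain -/

/-- `Ω_R = (0, R) × (-θ₀, θ₀)`. -/
def domain (R θ₀ : ℝ) : Set (ℝ × ℝ) := Ioo 0 R ×ˢ Ioo (-θ₀) θ₀

/-- The closure of `Ω_R`. -/
def closedDomain (R θ₀ : ℝ) : Set (ℝ × ℝ) := Icc 0 R ×ˢ Icc (-θ₀) θ₀

/-- `∂_θ^m f = 0` on the walls `θ = ±θ₀` in the sense of traces. Writing `f₀ = ∂_θ^m f` and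
`f₁ = ∂_θ^{m+1} f`, the formula `∫ (f₀ ∂_θ η + f₁ η) = ∫_{θ=θ₀} f₀ η dr - ∫_{θ=-θ₀} f₀ η dr` holds
for the test functions `η` that vanish near `r = 0` and `r = R` (but not necessarily on the walls),
and the trace of `f₀` vanishes exactly when the right-hand side is `0` for all of them. -/
def WallTraceZero (R θ₀ : ℝ) (m : ℕ) (f : ℝ × ℝ → ℝ) : Prop :=
  ∃ f₀ f₁ : ℝ × ℝ → ℝ,
    HasWeakPartial (domain R θ₀) 0 m f f₀ ∧ MemLp f₀ 2 (volume.restrict (domain R θ₀)) ∧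
    HasWeakPartial (domain R θ₀) 0 (m + 1) f f₁ ∧ MemLp f₁ 2 (volume.restrict (domain R θ₀)) ∧
    ∀ η : ℝ × ℝ → ℝ, ContDiff ℝ ∞ η → HasCompactSupport η → tsupport η ⊆ Ioo 0 R ×ˢ univ →
      ∫ p in domain R θ₀, f₀ p * dθ η p = - ∫ p in domain R θ₀, f₁ p * η p

/-- The iteration set for `(𝒮*, 𝒦*)`. -/
def IterSetMu (R θ₀ δ : ℝ) (μ₁ μ₂ : ℝ × ℝ → ℝ) : Prop :=
  sobolevNorm 4 (domain R θ₀) μ₁ + sobolevNorm 4 (domain R θ₀) μ₂ < ENNReal.ofReal δ ∧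
  WallTraceZero R θ₀ 1 μ₁ ∧ WallTraceZero R θ₀ 3 μ₁ ∧
  WallTraceZero R θ₀ 1 μ₂ ∧ WallTraceZero R θ₀ 3 μ₂

/-- The iteration set for `(𝒰*, 𝒱*, Φ̌*)`. -/
def IterSetNu (R θ₀ δ : ℝ) (ν₁ ν₂ ν₃ : ℝ × ℝ → ℝ) : Prop :=
  sobolevNorm 3 (domain R θ₀) ν₁ + sobolevNorm 3 (domain R θ₀) ν₂
    + sobolevNorm 4 (domain R θ₀) ν₃ < ENNReal.ofReal δ ∧
  WallTraceZero R θ₀ 1 ν₁ ∧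
  WallTraceZero R θ₀ 0 ν₂ ∧ WallTraceZero R θ₀ 2 ν₂ ∧
  WallTraceZero R θ₀ 1 ν₃ ∧ WallTraceZero R θ₀ 3 ν₃

/-! ## The radially symmetric supersonic background flow -/

/-- The constants of the convergent nozzle and of the flow at its entrance. -/
structure NozzleData where
  (γ b₀ r₁ r₂ θ₀ ρ₀ U₀ P₀ E₀ : ℝ)
  one_lt_γ : 1 < γ
  b₀_pos : 0 < b₀
  r₁_pos : 0 < r₁
  r₁_lt_r₂ : r₁ < r₂
  θ₀_mem : θ₀ ∈ Ioo 0 (Real.pi / 2)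
  ρ₀_pos : 0 < ρ₀
  U₀_pos : 0 < U₀
  P₀_pos : 0 < P₀

namespace NozzleData

variable (D : NozzleData)

/-- The length `r₂ - r₁` of the nozzle. -/
def len : ℝ := D.r₂ - D.r₁

/-- `r̂ = r₂ - r`, the distance to the origin. -/
def rhat (r : ℝ) : ℝ := D.r₂ - r

/-- The mass flux `J₀`. -/
def J₀ : ℝ := D.r₂ * D.ρ₀ * D.U₀

/-- The entropy `S₀`. -/
def S₀ : ℝ := Real.log (D.P₀ / D.ρ₀ ^ D.γ)

/-- The derivative on the closed interval `[0, r₂ - r₁]` (one-sided at the end points). -/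
def diff (f : ℝ → ℝ) (r : ℝ) : ℝ := derivWithin f (Icc 0 D.len) r

/-- The squared sound speed `c²(K, U, V, Φ)` given by the Bernoulli law. -/
def soundSq (K U V Φ : ℝ) : ℝ := (D.γ - 1) * (K + Φ - (U ^ 2 + V ^ 2) / 2)

/-- The coefficient `A₁₁`. -/
def A₁₁ (K U V Φ : ℝ) : ℝ := D.soundSq K U V Φ - U ^ 2

/-- The coefficient `A₂₂` at the radius `r`. -/
def A₂₂ (r K U V Φ : ℝ) : ℝ := (D.soundSq K U V Φ - V ^ 2) / D.rhat r

/-- The coefficient `A₁₂` at the radius `r`. -/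
def A₁₂ (r U V : ℝ) : ℝ := -(U * V) / D.rhat r

end NozzleData

/-- A smooth supersonic radially symmetric solution of the Euler-Poisson system on the whole
nozzle `0 ≤ r ≤ r₂ - r₁`, with the entrance data in `D`. -/
structure BackgroundFlow (D : NozzleData) where
  (ρ U P E : ℝ → ℝ)
  smooth_ρ : ContDiffOn ℝ ∞ ρ (Icc 0 D.len)
  smooth_U : ContDiffOn ℝ ∞ U (Icc 0 D.len)
  smooth_P : ContDiffOn ℝ ∞ P (Icc 0 D.len)
  smooth_E : ContDiffOn ℝ ∞ E (Icc 0 D.len)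
  mass : ∀ r ∈ Icc 0 D.len, D.diff (fun s => D.rhat s * ρ s * U s) r = 0
  momentum : ∀ r ∈ Icc 0 D.len,
    D.diff (fun s => D.rhat s * ρ s * U s ^ 2) r + D.rhat r * D.diff P r
      = -(D.rhat r * ρ r * E r)
  energy : ∀ r ∈ Icc 0 D.len,
    D.diff (fun s => D.rhat s * ρ s * U s
        * (U s ^ 2 / 2 + D.γ * P s / ((D.γ - 1) * ρ s))) r
      = -(D.rhat r * ρ r * U r * E r)
  poisson : ∀ r ∈ Icc 0 D.len,
    D.diff (fun s => D.rhat s * E s) r = -(D.rhat r * (ρ r - D.b₀))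
  init : ρ 0 = D.ρ₀ ∧ U 0 = D.U₀ ∧ P 0 = D.P₀ ∧ E 0 = -D.E₀
  ρ_pos : ∀ r ∈ Icc 0 D.len, 0 < ρ r
  supersonic : ∀ r ∈ Icc 0 D.len, D.γ * P r / ρ r < U r ^ 2

namespace BackgroundFlow

variable {D : NozzleData} (B : BackgroundFlow D)

/-- The squared sound speed `c̄² = γ P̄ / ρ̄`. -/
def cSq (r : ℝ) : ℝ := D.γ * B.P r / B.ρ r

/-- The electric potential `Φ̄`. -/
def Φ (r : ℝ) : ℝ :=
  -(∫ t in (0 : ℝ)..r, B.E t)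
    + (D.U₀ ^ 2 / 2
      + D.γ * Real.exp D.S₀ / (D.γ - 1) * (D.J₀ / (D.r₂ * D.U₀)) ^ (D.γ - 1))

/-- The coefficient `ā₁`. -/
def a₁ (r : ℝ) : ℝ :=
  ((D.γ - 1) * B.U r ^ 2 - B.cSq r) / (D.rhat r * B.cSq r)
    - ((D.γ + 1) * B.U r * D.diff B.U r + B.E r) / B.cSq r

/-- The coefficient `b̄₁`. -/
def b₁ (r : ℝ) : ℝ :=
  -((D.γ - 1) * B.U r) / (D.rhat r * B.cSq r) + (D.γ - 1) * D.diff B.U r / B.cSq r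

/-- The coefficient `b̄₂`. -/
def b₂ (r : ℝ) : ℝ := B.U r / B.cSq r

/-- The coefficient `c̄₁`. -/
def c₁ (r : ℝ) : ℝ := B.ρ r * B.U r / B.cSq r

/-- The coefficient `c̄₂`. -/
def c₂ (r : ℝ) : ℝ := -B.ρ r / B.cSq r

section Coefficients

variable (Ks Us Vs Φs : ℝ × ℝ → ℝ)

/-- The coefficient `a₁₁` at the iterate `(Ks, Us, Vs, Φs)`. -/
def a₁₁ (p : ℝ × ℝ) : ℝ :=
  D.A₁₁ (Ks p) (B.U p.1 + Us p) (Vs p) (B.Φ p.1 + Φs p) / B.cSq p.1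

/-- The coefficient `a₂₂` at the iterate `(Ks, Us, Vs, Φs)`. -/
def a₂₂ (p : ℝ × ℝ) : ℝ :=
  D.A₂₂ p.1 (Ks p) (B.U p.1 + Us p) (Vs p) (B.Φ p.1 + Φs p) / B.cSq p.1 / D.rhat p.1

/-- The coefficient `a₁₂` at the iterate `(Us, Vs)`. -/
def a₁₂ (p : ℝ × ℝ) : ℝ := D.A₁₂ p.1 (B.U p.1 + Us p) (Vs p) / B.cSq p.1

/-- The coefficient `a₂ = a₁₂ / r̂` at the iterate `(Us, Vs)`. -/
def a₂ (p : ℝ × ℝ) : ℝ := B.a₁₂ Us Vs p / D.rhat p.1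

end Coefficients

end BackgroundFlow

/-! ## The linearized hyperbolic-elliptic problem -/

/-- `∂_r` on the closed rectangle (one-sided at `r = 0` and `r = R`). -/
def pr (R : ℝ) (f : ℝ × ℝ → ℝ) : ℝ × ℝ → ℝ :=
  fun p => derivWithin (fun s => f (s, p.2)) (Icc 0 R) p.1

/-- `∂_θ` on the closed rectangle (one-sided at `θ = ±θ₀`). -/
def pθ (θ₀ : ℝ) (f : ℝ × ℝ → ℝ) : ℝ × ℝ → ℝ :=
  fun p => derivWithin (fun t => f (p.1, t)) (Icc (-θ₀) θ₀) p.2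

variable {D : NozzleData}

/-- The hyperbolic operator `ℒ₁(φ, Ψ)` at the iterate `(Ks, Us, Vs, Φs)`. -/
def opL₁ (B : BackgroundFlow D) (R : ℝ) (Ks Us Vs Φs φ Ψ : ℝ × ℝ → ℝ) (p : ℝ × ℝ) : ℝ :=
  B.a₁₁ Ks Us Vs Φs p * pr R (pr R φ) p
    + B.a₂₂ Ks Us Vs Φs p * pθ D.θ₀ (pθ D.θ₀ φ) p
    + 2 * B.a₁₂ Us Vs p * pθ D.θ₀ (pr R φ) p
    + B.a₁ p.1 * pr R φ p + B.a₂ Us Vs p * pθ D.θ₀ φ p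
    + B.b₁ p.1 * Ψ p + B.b₂ p.1 * pr R Ψ p

/-- The elliptic operator `ℒ₂(φ, Ψ)`. -/
def opL₂ (B : BackgroundFlow D) (R : ℝ) (φ Ψ : ℝ × ℝ → ℝ) (p : ℝ × ℝ) : ℝ :=
  pr R (pr R Ψ) p + 1 / D.rhat p.1 ^ 2 * pθ D.θ₀ (pθ D.θ₀ Ψ) p - 1 / D.rhat p.1 * pr R Ψ p
    + B.c₁ p.1 * pr R φ p + B.c₂ p.1 * Ψ p

/-- `(φ, Ψ)` solves the linearized boundary value problem with right-hand sides `F₁`, `F₂` and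
entrance datum `g`. The iterates are Sobolev functions, defined almost everywhere, and so are the
equations. -/
structure SolvesLinearized (B : BackgroundFlow D) (R : ℝ) (Ks Us Vs Φs : ℝ × ℝ → ℝ)
    (F₁ F₂ : ℝ × ℝ → ℝ) (g : ℝ → ℝ) (φ Ψ : ℝ × ℝ → ℝ) : Prop where
  eq₁ : ∀ᵐ p ∂(volume.restrict (domain R D.θ₀)), opL₁ B R Ks Us Vs Φs φ Ψ p = F₁ p
  eq₂ : ∀ᵐ p ∂(volume.restrict (domain R D.θ₀)), opL₂ B R φ Ψ p = F₂ p
  entrance : ∀ θ ∈ Ioo (-D.θ₀) D.θ₀, pr R φ (0, θ) = g θ ∧ φ (0, θ) = 0 ∧ pr R Ψ (0, θ) = 0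
  exit : ∀ θ ∈ Ioo (-D.θ₀) D.θ₀, Ψ (R, θ) = 0
  walls : ∀ r ∈ Ioo 0 R, pθ D.θ₀ φ (r, D.θ₀) = 0 ∧ pθ D.θ₀ φ (r, -D.θ₀) = 0 ∧
    pθ D.θ₀ Ψ (r, D.θ₀) = 0 ∧ pθ D.θ₀ Ψ (r, -D.θ₀) = 0

end EulerPoisson

end

/-! ### Calculus on rectangles: integration by parts against Lipschitz weights, and a Sobolev
inequality. -/

noncomputable section
namespace EulerPoisson

/-! The estimate is an energy argument in which the shortness of the nozzle supplies the small
parameter. The hyperbolic equation is multiplied by `(R - r) φ_r` and integrated by parts. The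
weight vanishes at the exit, so no boundary term arises there. Differentiating it once produces the
form `-a₁₁/2 φ_r² + a₂₂/2 φ_θ²`, which is coercive because the flow is supersonic (`a₁₁ ≤ -α`, `a₂₂
≥ α`). Every other interior term keeps the factor `R - r ≤ R`. At the entrance only `g²` survives,
since `φ = 0` there forces `φ_θ = 0`. On the walls the fluxes vanish because `φ_θ = 0` and because
the trace of `𝒱*`, hence `a₁₂`, is zero. This is `hyperbolic_energy`.

The elliptic equation is tested with `Ψ`. For small `R` the Poincaré inequality absorbs the
zero-order terms and gives `½ ∫ Ψ_r² + ∫ Ψ_θ² / r̂² ≤ ∫ F₂² + ∫ φ_r²` (`elliptic_energy`). The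
coupling is therefore not small in this direction, but `Ψ` enters the hyperbolic estimate only with
a factor `R`, so the two close together (`combine_energies`).

The leading coefficients are differentiated in the integrations by parts, so they must be Lipschitz
with constants independent of `R`. The iterates are only Sobolev functions. On a rectangle of width
`R`, the embedding of `H³` into the Lipschitz functions costs a factor `R^{-1/2}`
(`exists_lipschitz_representative`, by mollification), and the assumption `δ ≤ δ₀ √R` pays for
exactly this. The coefficients are polynomials in the iterates and in smooth background quantities,
so uniform bounds follow (`exists_leadingBounds`). Strict hyperbolicity is obtained by continuity
from the entrance, which is another reason for taking `R` small. The weak wall condition on `𝒱*`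
becomes a pointwise one for its Lipschitz representative (`eq_zero_on_walls`). -/

/-- A Lipschitz function is absolutely continuous, so integration by parts holds with remainder `∫
u' G`, and `|u'| ≤ L`. As an inequality, the formula never mentions the derivative of `u`, which
exists only almost everywhere. -/
theorem integral_lipschitz_mul_deriv_sub_le {a b L : ℝ} (hab : a ≤ b) (hL : 0 ≤ L) {u G G' : ℝ → ℝ}
    (hu : LipschitzOnWith L.toNNReal u (Icc a b))
    (hG : ∀ x ∈ Icc a b, HasDerivWithinAt G (G' x) (Icc a b) x)
    (hG' : ContinuousOn G' (Icc a b)) :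
    |(∫ x in a..b, u x * G' x) - (u b * G b - u a * G a)| ≤ L * ∫ x in a..b, |G x| := by
  have hui : uIcc a b = Icc a b := uIcc_of_le hab
  have hGc : ContinuousOn G (Icc a b) := fun x hx => (hG x hx).continuousWithinAt
  obtain ⟨M, hM⟩ := isCompact_Icc.exists_bound_of_continuousOn hG'
  have hGl : LipschitzOnWith M.toNNReal G (Icc a b) := by
    apply (convex_Icc a b).lipschitzOnWith_of_nnnorm_hasDerivWithin_le hG
    intro x hx
    rw [← NNReal.coe_le_coe, coe_nnnorm]
    exact (hM x hx).trans (Real.le_coe_toNNReal M)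
  have acu : AbsolutelyContinuousOnInterval u a b :=
    LipschitzOnWith.absolutelyContinuousOnInterval (hui ▸ hu)
  have acG : AbsolutelyContinuousOnInterval G a b :=
    LipschitzOnWith.absolutelyContinuousOnInterval (hui ▸ hGl)
  have key := acu.integral_mul_deriv_eq_deriv_mul acG
  have e1 : (∫ x in a..b, u x * deriv G x) = ∫ x in a..b, u x * G' x := by
    rw [intervalIntegral.integral_of_le hab, intervalIntegral.integral_of_le hab,
      integral_Ioc_eq_integral_Ioo, integral_Ioc_eq_integral_Ioo]
    apply setIntegral_congr_fun measurableSet_Ioo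
    intro x hx
    simp only
    rw [((hG x (Ioo_subset_Icc_self hx)).hasDerivAt (Icc_mem_nhds hx.1 hx.2)).deriv]
  rw [← e1, key]
  have e2 : u b * G b - u a * G a - (∫ x in a..b, deriv u x * G x) - (u b * G b - u a * G a)
      = -(∫ x in a..b, deriv u x * G x) := by ring
  rw [e2, abs_neg, ← intervalIntegral.integral_const_mul]
  rw [intervalIntegral.integral_of_le hab, intervalIntegral.integral_of_le hab,
      integral_Ioc_eq_integral_Ioo, integral_Ioc_eq_integral_Ioo]
  rw [← Real.norm_eq_abs]
  apply norm_integral_le_of_norm_le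
  · apply IntegrableOn.mono_set _ Ioo_subset_Icc_self
    exact (hGc.abs.const_smul L).integrableOn_Icc
  · refine (ae_restrict_mem measurableSet_Ioo).mono fun x hx => ?_
    rw [norm_mul, Real.norm_eq_abs (G x)]
    gcongr
    have := norm_deriv_le_of_lipschitzOn (Icc_mem_nhds hx.1 hx.2) hu
    rwa [Real.coe_toNNReal L hL] at this

/-- A closed rectangle. -/
def rect (a b c d : ℝ) : Set (ℝ × ℝ) := Icc a b ×ˢ Icc c d

theorem isCompact_rect (a b c d : ℝ) : IsCompact (rect a b c d) := isCompact_Icc.prod isCompact_Icc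

theorem ContinuousOn.integrableOn_rect {a b c d : ℝ} {f : ℝ × ℝ → ℝ}
    (hf : ContinuousOn f (rect a b c d)) : IntegrableOn f (rect a b c d) :=
  hf.integrableOn_compact (isCompact_rect a b c d)

theorem continuousOn_slice_left {a b c d : ℝ} {f : ℝ × ℝ → ℝ} (hf : ContinuousOn f (rect a b c d))
    {t : ℝ} (ht : t ∈ Icc c d) : ContinuousOn (fun s => f (s, t)) (Icc a b) :=
  hf.comp (by fun_prop) fun _ hs => ⟨hs, ht⟩

theorem continuousOn_slice_right {a b c d : ℝ} {f : ℝ × ℝ → ℝ} (hf : ContinuousOn f (rect a b c d))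
    {s : ℝ} (hs : s ∈ Icc a b) : ContinuousOn (fun t => f (s, t)) (Icc c d) :=
  hf.comp (by fun_prop) fun _ ht => ⟨hs, ht⟩

theorem integral_rect {a b c d : ℝ} (hab : a ≤ b) (hcd : c ≤ d) {f : ℝ × ℝ → ℝ}
    (hf : ContinuousOn f (rect a b c d)) :
    ∫ p in rect a b c d, f p = ∫ s in a..b, ∫ t in c..d, f (s, t) := by
  rw [rect, Measure.volume_eq_prod, setIntegral_prod _ (ContinuousOn.integrableOn_rect hf),
    intervalIntegral.integral_of_le hab, integral_Icc_eq_integral_Ioc]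
  simp only [intervalIntegral.integral_of_le hcd, integral_Icc_eq_integral_Ioc]

theorem integral_rect_swap {a b c d : ℝ} (hab : a ≤ b) (hcd : c ≤ d) {f : ℝ × ℝ → ℝ}
    (hf : ContinuousOn f (rect a b c d)) :
    ∫ p in rect a b c d, f p = ∫ t in c..d, ∫ s in a..b, f (s, t) := by
  have h2 : ContinuousOn (fun p : ℝ × ℝ => f p.swap) (rect c d a b) :=
    hf.comp continuous_swap.continuousOn fun p hp => ⟨hp.2, hp.1⟩
  have h3 := integral_rect hcd hab h2
  simp only [Prod.swap_prod_mk] at h3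
  rw [← h3, rect, rect, Measure.volume_eq_prod, ← setIntegral_prod_swap]

theorem intervalIntegrable_integral_slice {a b c d : ℝ} (hab : a ≤ b) (hcd : c ≤ d) {f : ℝ × ℝ → ℝ}
    (hf : ContinuousOn f (rect a b c d)) :
    IntervalIntegrable (fun s => ∫ t in c..d, f (s, t)) volume a b := by
  have := (ContinuousOn.integrableOn_rect hf)
  rw [IntegrableOn, rect, Measure.volume_eq_prod, ← Measure.prod_restrict] at this
  rw [intervalIntegrable_iff_integrableOn_Icc_of_le hab]
  simp only [intervalIntegral.integral_of_le hcd, ← integral_Icc_eq_integral_Ioc]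
  exact this.integral_prod_left

theorem intervalIntegrable_integral_slice_swap {a b c d : ℝ} (hab : a ≤ b) (hcd : c ≤ d)
    {f : ℝ × ℝ → ℝ} (hf : ContinuousOn f (rect a b c d)) :
    IntervalIntegrable (fun t => ∫ s in a..b, f (s, t)) volume c d :=
  intervalIntegrable_integral_slice (f := fun p => f p.swap) hcd hab
    (hf.comp continuous_swap.continuousOn fun _ hp => ⟨hp.2, hp.1⟩)

theorem lipschitzOnWith_slice_right {a b c d : ℝ} {f : ℝ × ℝ → ℝ} {K : NNReal}
    (hf : LipschitzOnWith K f (rect a b c d)) {s : ℝ} (hs : s ∈ Icc a b) :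
    LipschitzOnWith K (fun t => f (s, t)) (Icc c d) := by
  apply LipschitzOnWith.of_dist_le_mul
  intro t ht t' ht'
  have := hf.dist_le_mul (s, t) ⟨hs, ht⟩ (s, t') ⟨hs, ht'⟩
  simpa [Prod.dist_eq] using this

theorem lipschitzOnWith_slice_left {a b c d : ℝ} {f : ℝ × ℝ → ℝ} {K : NNReal}
    (hf : LipschitzOnWith K f (rect a b c d)) {t : ℝ} (ht : t ∈ Icc c d) :
    LipschitzOnWith K (fun s => f (s, t)) (Icc a b) := by
  apply LipschitzOnWith.of_dist_le_mul
  intro s hs s' hs'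
  have := hf.dist_le_mul (s, t) ⟨hs, ht⟩ (s', t) ⟨hs', ht⟩
  simpa [Prod.dist_eq] using this

/-- Integration by parts in the second variable against a Lipschitz weight. -/
theorem abs_integral_lipschitz_mul_deriv_snd_sub_le {a b c d L : ℝ} (hab : a ≤ b) (hcd : c ≤ d)
    (hL : 0 ≤ L) {u G G' : ℝ × ℝ → ℝ} (hu : LipschitzOnWith L.toNNReal u (rect a b c d))
    (hG : ∀ p ∈ rect a b c d,
      HasDerivWithinAt (fun t => G (p.1, t)) (G' p) (Icc c d) p.2)
    (hGc : ContinuousOn G (rect a b c d)) (hG' : ContinuousOn G' (rect a b c d)) :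
    |(∫ p in rect a b c d, u p * G' p)
        - ∫ s in a..b, (u (s, d) * G (s, d) - u (s, c) * G (s, c))|
      ≤ L * ∫ p in rect a b c d, |G p| := by
  have hc1 : ContinuousOn (fun p => u p * G' p) (rect a b c d) := hu.continuousOn.mul hG'
  have hbd : ContinuousOn (fun s => u (s, d) * G (s, d) - u (s, c) * G (s, c)) (Icc a b) :=
    ((continuousOn_slice_left hu.continuousOn (right_mem_Icc.2 hcd)).mul
      (continuousOn_slice_left hGc (right_mem_Icc.2 hcd))).sub
    ((continuousOn_slice_left hu.continuousOn (left_mem_Icc.2 hcd)).mul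
      (continuousOn_slice_left hGc (left_mem_Icc.2 hcd)))
  rw [integral_rect hab hcd hc1, integral_rect hab hcd hGc.abs,
    ← intervalIntegral.integral_sub (intervalIntegrable_integral_slice hab hcd hc1)
      (hbd.intervalIntegrable_of_Icc hab), ← intervalIntegral.integral_const_mul,
      ← Real.norm_eq_abs]
  apply intervalIntegral.norm_integral_le_of_norm_le hab
  · refine Filter.Eventually.of_forall fun s hs => ?_
    have hs' : s ∈ Icc a b := Ioc_subset_Icc_self hs
    exact integral_lipschitz_mul_deriv_sub_le (G := fun t => G (s, t)) (G' := fun t => G' (s, t))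
      hcd hL (lipschitzOnWith_slice_right hu hs') (fun t ht => hG (s, t) ⟨hs', ht⟩)
      (continuousOn_slice_right hG' hs')
  · exact (intervalIntegrable_integral_slice hab hcd hGc.abs).const_mul L

/-- Integration by parts in the first variable against a Lipschitz weight. -/
theorem abs_integral_lipschitz_mul_deriv_fst_sub_le {a b c d L : ℝ} (hab : a ≤ b) (hcd : c ≤ d)
    (hL : 0 ≤ L) {u G G' : ℝ × ℝ → ℝ} (hu : LipschitzOnWith L.toNNReal u (rect a b c d))
    (hG : ∀ p ∈ rect a b c d,
      HasDerivWithinAt (fun s => G (s, p.2)) (G' p) (Icc a b) p.1)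
    (hGc : ContinuousOn G (rect a b c d)) (hG' : ContinuousOn G' (rect a b c d)) :
    |(∫ p in rect a b c d, u p * G' p)
        - ∫ t in c..d, (u (b, t) * G (b, t) - u (a, t) * G (a, t))|
      ≤ L * ∫ p in rect a b c d, |G p| := by
  have hc1 : ContinuousOn (fun p => u p * G' p) (rect a b c d) := hu.continuousOn.mul hG'
  have hbd : ContinuousOn (fun t => u (b, t) * G (b, t) - u (a, t) * G (a, t)) (Icc c d) :=
    ((continuousOn_slice_right hu.continuousOn (right_mem_Icc.2 hab)).mul
      (continuousOn_slice_right hGc (right_mem_Icc.2 hab))).sub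
    ((continuousOn_slice_right hu.continuousOn (left_mem_Icc.2 hab)).mul
      (continuousOn_slice_right hGc (left_mem_Icc.2 hab)))
  rw [integral_rect_swap hab hcd hc1, integral_rect_swap hab hcd hGc.abs,
    ← intervalIntegral.integral_sub (intervalIntegrable_integral_slice_swap hab hcd hc1)
      (hbd.intervalIntegrable_of_Icc hcd), ← intervalIntegral.integral_const_mul,
      ← Real.norm_eq_abs]
  apply intervalIntegral.norm_integral_le_of_norm_le hcd
  · refine Filter.Eventually.of_forall fun t ht => ?_
    have ht' : t ∈ Icc c d := Ioc_subset_Icc_self ht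
    exact integral_lipschitz_mul_deriv_sub_le (G := fun s => G (s, t)) (G' := fun s => G' (s, t))
      hab hL (lipschitzOnWith_slice_left hu ht') (fun s hs => hG (s, t) ⟨hs, ht'⟩)
      (continuousOn_slice_left hG' ht')
  · exact (intervalIntegrable_integral_slice_swap hab hcd hGc.abs).const_mul L

/-- The one-dimensional Sobolev inequality on an interval. -/
theorem sq_le_integral_sq_add {a b : ℝ} (hab : a < b) {u u' : ℝ → ℝ}
    (hu : ∀ x ∈ Icc a b, HasDerivWithinAt u (u' x) (Icc a b) x)
    (hu' : ContinuousOn u' (Icc a b)) {x : ℝ} (hx : x ∈ Icc a b) :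
    u x ^ 2 ≤ 2 / (b - a) * (∫ s in a..b, u s ^ 2) + (b - a) * ∫ s in a..b, u' s ^ 2 := by
  have hw : 0 < b - a := sub_pos.2 hab
  have huc : ContinuousOn u (Icc a b) := fun x hx => (hu x hx).continuousWithinAt
  set J : ℝ := ∫ s in a..b, (u s ^ 2 / (b - a) + (b - a) * u' s ^ 2) with hJ
  have hJc : ContinuousOn (fun s => u s ^ 2 / (b - a) + (b - a) * u' s ^ 2) (Icc a b) :=
    ((huc.pow 2).div_const _).add ((hu'.pow 2).const_smul (b - a))
  have hJi := hJc.intervalIntegrable_of_Icc (μ := volume) hab.le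
  have hui : IntervalIntegrable (fun s => u s ^ 2) volume a b :=
    (huc.pow 2).intervalIntegrable_of_Icc (μ := volume) hab.le
  have hui' : IntervalIntegrable (fun s => u' s ^ 2) volume a b :=
    (hu'.pow 2).intervalIntegrable_of_Icc (μ := volume) hab.le
  have main : ∀ y ∈ Icc a b, ∀ z ∈ Icc a b, y ≤ z → |u z ^ 2 - u y ^ 2| ≤ J := by
    intro y hy z hz hyz
    have hsub : Icc y z ⊆ Icc a b := Icc_subset_Icc hy.1 hz.2
    have hFTC : ∫ s in y..z, 2 * u s * u' s = u z ^ 2 - u y ^ 2 := by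
      apply intervalIntegral.integral_eq_sub_of_hasDerivAt_of_le (f := fun s => u s ^ 2) hyz
        ((huc.mono hsub).pow 2)
      · intro s hs
        have hs' : s ∈ Ioo a b := ⟨hy.1.trans_lt hs.1, hs.2.trans_le hz.2⟩
        have := ((hu s (Ioo_subset_Icc_self hs')).hasDerivAt (Icc_mem_nhds hs'.1 hs'.2)).pow 2
        convert! this using 1
        simp
      · exact ContinuousOn.intervalIntegrable_of_Icc hyz
          ((((huc.mono hsub).const_smul (2 : ℝ)).mul (hu'.mono hsub)))
    -- Young's inequality weighted by the length of the interval: `2 |u u'| ≤ u² / (b - a) + (b - a)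
    -- u'²`.
    rw [← hFTC, ← Real.norm_eq_abs]
    calc ‖∫ s in y..z, 2 * u s * u' s‖
        ≤ ∫ s in y..z, (u s ^ 2 / (b - a) + (b - a) * u' s ^ 2) := by
          apply intervalIntegral.norm_integral_le_of_norm_le hyz
          · refine Filter.Eventually.of_forall fun s _ => ?_
            rw [Real.norm_eq_abs, abs_le]
            have h1 : 0 ≤ (u s + (b - a) * u' s) ^ 2 / (b - a) := by positivity
            have h2 : 0 ≤ (u s - (b - a) * u' s) ^ 2 / (b - a) := by positivity
            have e1 : (u s + (b - a) * u' s) ^ 2 / (b - a)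
              = u s ^ 2 / (b - a) + (b - a) * u' s ^ 2 + 2 * u s * u' s := by
                field_simp; ring
            have e2 : (u s - (b - a) * u' s) ^ 2 / (b - a)
              = u s ^ 2 / (b - a) + (b - a) * u' s ^ 2 - 2 * u s * u' s := by
                field_simp; ring
            constructor <;> linarith
          · exact (hJc.mono hsub).intervalIntegrable_of_Icc hyz
      _ ≤ J := by
          apply intervalIntegral.integral_mono_interval hy.1 hyz hz.2 _ hJi
          refine Filter.Eventually.of_forall fun s => ?_
          simp only [Pi.zero_apply]
          positivity
  have main2 : ∀ y ∈ Icc a b, u x ^ 2 ≤ u y ^ 2 + J := by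
    intro y hy
    rcases le_total x y with h | h
    · have := (abs_le.1 (main x hx y hy h)).1; linarith
    · have := (abs_le.1 (main y hy x hx h)).2; linarith
  -- The comparison of `u x ^ 2` with `u y ^ 2` is averaged over all `y` in the interval.
  have avg : (b - a) * u x ^ 2 ≤ (∫ s in a..b, u s ^ 2) + (b - a) * J := by
    have := intervalIntegral.integral_mono_on (μ := volume) hab.le
      (f := fun _ => u x ^ 2) (g := fun y => u y ^ 2 + J) (by simp) (hui.add (by simp)) main2
    rw [intervalIntegral.integral_add hui (by simp)] at this
    simpa using this
  have hJe : J = (∫ s in a..b, u s ^ 2) / (b - a) + (b - a) * ∫ s in a..b, u' s ^ 2 := by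
    rw [hJ, intervalIntegral.integral_add (hui.div_const _) (hui'.const_mul _)]
    simp
  rw [hJe] at avg
  have : u x ^ 2 ≤ ((∫ s in a..b, u s ^ 2) + (b - a) *
      ((∫ s in a..b, u s ^ 2) / (b - a) + (b - a) * ∫ s in a..b, u' s ^ 2)) / (b - a) := by
    rw [le_div_iff₀ hw]; linarith
  refine this.trans (le_of_eq ?_)
  field_simp
  ring

/-- The anisotropic Sobolev inequality on a rectangle, for classical derivatives. -/
theorem sq_le_of_integral_sq_le {a b c d N : ℝ} (hab : a < b) (hcd : c < d)
    {f fr fθ frθ : ℝ × ℝ → ℝ}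
    (hf : ContinuousOn f (rect a b c d)) (hfr : ContinuousOn fr (rect a b c d))
    (hfθ : ContinuousOn fθ (rect a b c d)) (hfrθ : ContinuousOn frθ (rect a b c d))
    (d1 : ∀ p ∈ rect a b c d, HasDerivWithinAt (fun s => f (s, p.2)) (fr p) (Icc a b) p.1)
    (d2 : ∀ p ∈ rect a b c d, HasDerivWithinAt (fun t => f (p.1, t)) (fθ p) (Icc c d) p.2)
    (d3 : ∀ p ∈ rect a b c d, HasDerivWithinAt (fun s => fθ (s, p.2)) (frθ p) (Icc a b) p.1)
    (n0 : ∫ p in rect a b c d, f p ^ 2 ≤ N) (n1 : ∫ p in rect a b c d, fr p ^ 2 ≤ N)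
    (n2 : ∫ p in rect a b c d, fθ p ^ 2 ≤ N) (n3 : ∫ p in rect a b c d, frθ p ^ 2 ≤ N)
    {p : ℝ × ℝ} (hp : p ∈ rect a b c d) :
    f p ^ 2 ≤ (2 / (b - a) + (b - a)) * (2 / (d - c) + (d - c)) * N := by
  have hw : 0 < b - a := sub_pos.2 hab
  have hh : 0 < d - c := sub_pos.2 hcd
  -- The one-dimensional inequality in `r` at fixed `θ`, integrated over `θ`. It is applied to `f`
  -- and to `fθ`, after which the inequality in `θ` finishes. The only second derivative used is the
  -- mixed one, so first derivatives of `H³` functions are covered.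
  have step : ∀ (g gr : ℝ × ℝ → ℝ), ContinuousOn g (rect a b c d) → ContinuousOn gr (rect a b c d) →
      (∀ p ∈ rect a b c d, HasDerivWithinAt (fun s => g (s, p.2)) (gr p) (Icc a b) p.1) →
      (∫ p in rect a b c d, g p ^ 2 ≤ N) → (∫ p in rect a b c d, gr p ^ 2 ≤ N) →
      ∫ t in c..d, g (p.1, t) ^ 2 ≤ (2 / (b - a) + (b - a)) * N := by
    intro g gr hg hgr hd h0 h1
    have c0 : ContinuousOn (fun q => g q ^ 2) (rect a b c d) := hg.pow 2
    have c1 : ContinuousOn (fun q => gr q ^ 2) (rect a b c d) := hgr.pow 2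
    have i0 := intervalIntegrable_integral_slice_swap hab.le hcd.le c0
    have i1 := intervalIntegrable_integral_slice_swap hab.le hcd.le c1
    have := intervalIntegral.integral_mono_on (μ := volume) hcd.le
      (f := fun t => g (p.1, t) ^ 2)
      (g := fun t => 2 / (b - a) * (∫ s in a..b, g (s, t) ^ 2)
        + (b - a) * ∫ s in a..b, gr (s, t) ^ 2)
      ((continuousOn_slice_right c0 hp.1).intervalIntegrable_of_Icc hcd.le)
      ((i0.const_mul _).add (i1.const_mul _))
      (fun t ht => sq_le_integral_sq_add hab (u := fun s => g (s, t)) (u' := fun s => gr (s, t))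
        (fun s hs => hd (s, t) ⟨hs, ht⟩) (continuousOn_slice_left hgr ht) hp.1)
    rw [intervalIntegral.integral_add (i0.const_mul _) (i1.const_mul _),
      intervalIntegral.integral_const_mul, intervalIntegral.integral_const_mul,
      ← integral_rect_swap hab.le hcd.le c0,
      ← integral_rect_swap hab.le hcd.le c1] at this
    refine this.trans ?_
    rw [add_mul]
    gcongr
  have A := step f fr hf hfr d1 n0 n1
  have B := step fθ frθ hfθ hfrθ d3 n2 n3
  have := sq_le_integral_sq_add hcd (u := fun t => f (p.1, t)) (u' := fun t => fθ (p.1, t))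
        (fun t ht => d2 (p.1, t) ⟨hp.1, ht⟩) (continuousOn_slice_right hfθ hp.1) hp.2
  refine this.trans ?_
  calc _ ≤ 2 / (d - c) * ((2 / (b - a) + (b - a)) * N) + (d - c) * ((2 / (b - a) + (b - a)) * N) := by
        gcongr
    _ = _ := by ring

end EulerPoisson
end

/-! ### Weak derivatives and their approximation by mollification. -/

noncomputable section
namespace EulerPoisson

/-! ### Partial derivatives of smooth functions -/

theorem dr_eq_fderiv {η : ℝ × ℝ → ℝ} {p : ℝ × ℝ} (h : DifferentiableAt ℝ η p) :
    dr η p = fderiv ℝ η p (1, 0) := by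
  have h1 : HasDerivAt (fun s : ℝ => (s, p.2)) ((1 : ℝ), (0 : ℝ)) p.1 :=
    (hasDerivAt_id p.1).prodMk (hasDerivAt_const p.1 p.2)
  exact (h.hasFDerivAt.comp_hasDerivAt (x := p.1) (f := fun s : ℝ => (s, p.2)) h1).deriv

theorem dθ_eq_fderiv {η : ℝ × ℝ → ℝ} {p : ℝ × ℝ} (h : DifferentiableAt ℝ η p) :
    dθ η p = fderiv ℝ η p (0, 1) := by
  have h1 : HasDerivAt (fun t : ℝ => (p.1, t)) ((0 : ℝ), (1 : ℝ)) p.2 :=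
    (hasDerivAt_const p.2 p.1).prodMk (hasDerivAt_id p.2)
  exact (h.hasFDerivAt.comp_hasDerivAt (x := p.2) (f := fun t : ℝ => (p.1, t)) h1).deriv

theorem dr_eq {η : ℝ × ℝ → ℝ} (h : ContDiff ℝ ∞ η) : dr η = fun p => fderiv ℝ η p (1, 0) :=
  funext fun _ => dr_eq_fderiv (h.differentiable (by simp) _)

theorem dθ_eq {η : ℝ × ℝ → ℝ} (h : ContDiff ℝ ∞ η) : dθ η = fun p => fderiv ℝ η p (0, 1) :=
  funext fun _ => dθ_eq_fderiv (h.differentiable (by simp) _)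

theorem contDiff_dr {η : ℝ × ℝ → ℝ} (h : ContDiff ℝ ∞ η) : ContDiff ℝ ∞ (dr η) := by
  rw [dr_eq h]
  exact (h.fderiv_right (m := ∞) (by simp)).clm_apply contDiff_const

theorem contDiff_dθ {η : ℝ × ℝ → ℝ} (h : ContDiff ℝ ∞ η) : ContDiff ℝ ∞ (dθ η) := by
  rw [dθ_eq h]
  exact (h.fderiv_right (m := ∞) (by simp)).clm_apply contDiff_const

theorem contDiff_dθ_iterate {η : ℝ × ℝ → ℝ} (h : ContDiff ℝ ∞ η) (j : ℕ) :
    ContDiff ℝ ∞ (dθ^[j] η) := by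
  induction j with
  | zero => simpa using h
  | succ j ih => rw [Function.iterate_succ_apply']; exact contDiff_dθ ih

theorem tsupport_dr_subset {η : ℝ × ℝ → ℝ} (h : ContDiff ℝ ∞ η) : tsupport (dr η) ⊆ tsupport η := by
  rw [dr_eq h]
  exact tsupport_fderiv_apply_subset ℝ _

theorem tsupport_dθ_subset {η : ℝ × ℝ → ℝ} (h : ContDiff ℝ ∞ η) : tsupport (dθ η) ⊆ tsupport η := by
  rw [dθ_eq h]
  exact tsupport_fderiv_apply_subset ℝ _

theorem dr_dθ_comm {η : ℝ × ℝ → ℝ} (h : ContDiff ℝ ∞ η) : dθ (dr η) = dr (dθ η) := by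
  rw [dr_eq (contDiff_dθ h), dθ_eq (contDiff_dr h), dr_eq h, dθ_eq h]
  ext p
  have hd : DifferentiableAt ℝ (fderiv ℝ η) p :=
    (h.fderiv_right (m := ∞) (by simp)).differentiable (by simp) p
  rw [fderiv_clm_apply hd (differentiableAt_const _), fderiv_clm_apply hd (differentiableAt_const _)]
  simp only [fderiv_fun_const, Pi.zero_apply, ContinuousLinearMap.comp_zero, zero_add,
    ContinuousLinearMap.flip_apply]
  exact (h.contDiffAt.isSymmSndFDerivAt
    (by rw [minSmoothness_of_isRCLikeNormedField]; exact WithTop.coe_le_coe.2 le_top)).eq (0, 1) (1, 0)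

theorem dθ_iterate_dr_comm {η : ℝ × ℝ → ℝ} (h : ContDiff ℝ ∞ η) (j : ℕ) :
    dθ^[j] (dr η) = dr (dθ^[j] η) := by
  induction j with
  | zero => rfl
  | succ j ih =>
    rw [Function.iterate_succ_apply', ih, Function.iterate_succ_apply',
      dr_dθ_comm (contDiff_dθ_iterate h j)]

/-! ### Families of weak derivatives -/

/-- Testing the order-`i` identity with `∂_r η` gives the identity of order `i + 1`. A family of
weak derivatives of one function is thus a chain of first-order relations, the form that
mollification can use. -/
theorem HasWeakPartial.succ_fst {Ω : Set (ℝ × ℝ)} {i j : ℕ} {f g g' : ℝ × ℝ → ℝ}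
    (h : HasWeakPartial Ω i j f g) (h' : HasWeakPartial Ω (i + 1) j f g') :
    HasWeakPartial Ω 1 0 g g' := by
  refine ⟨h.2.1, h'.2.1, fun η hη hc hs => ?_⟩
  have e1 := h.2.2 (dr η) (contDiff_dr hη)
    (hc.of_isClosed_subset (isClosed_tsupport _) (tsupport_dr_subset hη))
    ((tsupport_dr_subset hη).trans hs)
  have e2 := h'.2.2 η hη hc hs
  rw [dθ_iterate_dr_comm hη, ← Function.iterate_succ_apply, e2] at e1
  simp only [Function.iterate_one, Function.iterate_zero, id_eq]
  have h3 : ((-1 : ℝ) ^ (i + j)) * (-1) ^ (i + j) = 1 := by rw [← mul_pow]; simp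
  calc ∫ p in Ω, g p * dr η p = ((-1 : ℝ) ^ (i + j) * (-1) ^ (i + j)) * ∫ p in Ω, g p * dr η p := by
        rw [h3, one_mul]
    _ = (-1) ^ (i + j) * ((-1) ^ (i + 1 + j) * ∫ p in Ω, g' p * η p) := by rw [mul_assoc, ← e1]
    _ = ((-1 : ℝ) ^ (i + j) * (-1) ^ (i + j)) * (-1) * ∫ p in Ω, g' p * η p := by ring
    _ = _ := by rw [h3]; ring

theorem HasWeakPartial.succ_snd {Ω : Set (ℝ × ℝ)} {i j : ℕ} {f g g' : ℝ × ℝ → ℝ}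
    (h : HasWeakPartial Ω i j f g) (h' : HasWeakPartial Ω i (j + 1) f g') :
    HasWeakPartial Ω 0 1 g g' := by
  refine ⟨h.2.1, h'.2.1, fun η hη hc hs => ?_⟩
  have e1 := h.2.2 (dθ η) (contDiff_dθ hη)
    (hc.of_isClosed_subset (isClosed_tsupport _) (tsupport_dθ_subset hη))
    ((tsupport_dθ_subset hη).trans hs)
  have e2 := h'.2.2 η hη hc hs
  rw [← Function.iterate_succ_apply, e2] at e1
  simp only [Function.iterate_one, Function.iterate_zero, id_eq]
  have h3 : ((-1 : ℝ) ^ (i + j)) * (-1) ^ (i + j) = 1 := by rw [← mul_pow]; simp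
  calc ∫ p in Ω, g p * dθ η p = ((-1 : ℝ) ^ (i + j) * (-1) ^ (i + j)) * ∫ p in Ω, g p * dθ η p := by
        rw [h3, one_mul]
    _ = (-1) ^ (i + j) * ((-1) ^ (i + (j + 1)) * ∫ p in Ω, g' p * η p) := by rw [mul_assoc, ← e1]
    _ = ((-1 : ℝ) ^ (i + j) * (-1) ^ (i + j)) * (-1) * ∫ p in Ω, g' p * η p := by ring
    _ = _ := by rw [h3]; ring

/-- The fundamental lemma of the calculus of variations, applied to `f - g`. -/
theorem HasWeakPartial.ae_eq {Ω : Set (ℝ × ℝ)} (hΩ : IsOpen Ω) {f g : ℝ × ℝ → ℝ}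
    (h : HasWeakPartial Ω 0 0 f g) : ∀ᵐ p, p ∈ Ω → f p = g p := by
  have hl : LocallyIntegrableOn (fun p => f p - g p) Ω := h.1.sub h.2.1
  have := hΩ.ae_eq_zero_of_integral_contDiff_smul_eq_zero hl ?_
  · filter_upwards [this] with p hp hpΩ using sub_eq_zero.1 (hp hpΩ)
  intro η hη hc hs
  have e := h.2.2 η hη hc hs
  simp only [Function.iterate_zero, id_eq, add_zero, pow_zero, one_mul] at e
  have hi : ∀ u : ℝ × ℝ → ℝ, LocallyIntegrableOn u Ω → IntegrableOn (fun p => u p * η p) Ω := by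
    intro u hu
    have h1 : IntegrableOn (fun p => u p * η p) (tsupport η) :=
      (hu.integrableOn_compact_subset hs hc).mul_continuousOn hη.continuous.continuousOn hc
    have h2 : IntegrableOn (fun p => u p * η p) univ := by
      refine h1.of_forall_sdiff_eq_zero MeasurableSet.univ fun p hp => ?_
      rw [image_eq_zero_of_notMem_tsupport hp.2, mul_zero]
    exact h2.mono_set (subset_univ _)
  have hset : ∫ p, η p • (f p - g p) = ∫ p in Ω, η p • (f p - g p) := by
    symm
    apply setIntegral_eq_integral_of_forall_compl_eq_zero
    intro p hp
    rw [image_eq_zero_of_notMem_tsupport (fun h => hp (hs h)), zero_smul]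
  rw [hset]
  calc ∫ p in Ω, η p • (f p - g p) = ∫ p in Ω, (f p * η p - g p * η p) := by
        congr 1; ext p; simp only [smul_eq_mul]; ring
    _ = 0 := by rw [integral_sub (hi f h.1) (hi g h.2.1), e, sub_self]

/-! ### Mollification -/

/-- The mollification of `F` with the kernel `φ`. -/
def mollify (φ : ContDiffBump (0 : ℝ × ℝ)) (F : ℝ × ℝ → ℝ) (x : ℝ × ℝ) : ℝ :=
  ∫ y, F y * φ.normed volume (x - y)

theorem mollify_eq_convolution_left (φ : ContDiffBump (0 : ℝ × ℝ)) (F : ℝ × ℝ → ℝ) :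
    mollify φ F = convolution (φ.normed volume) F (ContinuousLinearMap.lsmul ℝ ℝ) volume := by
  ext x
  rw [mollify, convolution_eq_swap]
  congr 1; ext y
  simp [mul_comm]

theorem mollify_eq_convolution_right (φ : ContDiffBump (0 : ℝ × ℝ)) (F : ℝ × ℝ → ℝ) :
    mollify φ F = convolution F (φ.normed volume) (ContinuousLinearMap.lsmul ℝ ℝ) volume := by
  ext x
  rw [mollify, convolution_def]
  simp

theorem contDiff_normed (φ : ContDiffBump (0 : ℝ × ℝ)) : ContDiff ℝ ∞ (φ.normed volume) :=
  φ.contDiff_normed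

theorem hasFDerivAt_mollify (φ : ContDiffBump (0 : ℝ × ℝ)) {F : ℝ × ℝ → ℝ} (hF : Integrable F)
    (x v : ℝ × ℝ) : HasFDerivAt (mollify φ F) (fderiv ℝ (mollify φ F) x) x ∧
      fderiv ℝ (mollify φ F) x v = ∫ y, F y * fderiv ℝ (φ.normed volume) (x - y) v := by
  have h := HasCompactSupport.hasFDerivAt_convolution_right
    (ContinuousLinearMap.lsmul ℝ ℝ) (φ.hasCompactSupport_normed (μ := volume))
    hF.locallyIntegrable ((contDiff_normed φ).of_le (by simp)) x
  rw [← mollify_eq_convolution_right] at h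
  refine ⟨h.differentiableAt.hasFDerivAt, ?_⟩
  rw [h.fderiv, convolution_precompR_apply _ hF.locallyIntegrable
    (φ.hasCompactSupport_normed.fderiv ℝ) ((contDiff_normed φ).continuous_fderiv (by simp)),
    convolution_def]
  simp

theorem continuous_mollify (φ : ContDiffBump (0 : ℝ × ℝ)) {F : ℝ × ℝ → ℝ} (hF : Integrable F) :
    Continuous (mollify φ F) :=
  continuous_iff_continuousAt.2 fun x => (hasFDerivAt_mollify φ hF x 0).1.continuousAt

theorem tsupport_normed_sub (φ : ContDiffBump (0 : ℝ × ℝ)) (x : ℝ × ℝ) :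
    tsupport (fun y => φ.normed volume (x - y)) ⊆ Metric.closedBall x φ.rOut := by
  apply closure_minimal _ Metric.isClosed_closedBall
  intro y hy
  have : x - y ∈ Function.support (φ.normed volume) := hy
  rw [φ.support_normed_eq] at this
  rw [Metric.mem_closedBall, dist_comm, dist_eq_norm]
  simpa using (mem_ball_zero_iff.1 this).le

theorem contDiff_normed_sub (φ : ContDiffBump (0 : ℝ × ℝ)) (x : ℝ × ℝ) :
    ContDiff ℝ ∞ (fun y => φ.normed volume (x - y)) :=
  (contDiff_normed φ).comp (contDiff_const.sub contDiff_id)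

theorem fderiv_normed_sub (φ : ContDiffBump (0 : ℝ × ℝ)) (x y v : ℝ × ℝ) :
    fderiv ℝ (fun y => φ.normed volume (x - y)) y v = - fderiv ℝ (φ.normed volume) (x - y) v := by
  have h1 : HasFDerivAt (φ.normed volume) (fderiv ℝ (φ.normed volume) (x - y)) (x - y) :=
    ((contDiff_normed φ).differentiable (by simp) _).hasFDerivAt
  have h2 : HasFDerivAt (fun y => x - y) (-ContinuousLinearMap.id ℝ (ℝ × ℝ)) y :=
    (hasFDerivAt_id y).const_sub x
  have h3 := (h1.comp y h2).fderiv
  simp only [Function.comp_def] at h3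
  rw [h3]
  simp

theorem integral_indicator_mul {Ω : Set (ℝ × ℝ)} (hΩ : MeasurableSet Ω) (f g : ℝ × ℝ → ℝ) :
    ∫ y, Ω.indicator f y * g y = ∫ y in Ω, f y * g y := by
  rw [← integral_indicator hΩ]
  congr 1; ext y
  by_cases h : y ∈ Ω <;> simp [h]

/-- The derivative falls on the kernel, and the translated kernel is an admissible test function as
soon as its supporting ball lies inside `Ω`. The extension by zero outside `Ω` is then harmless. -/
theorem hasDerivAt_mollify_fst {Ω : Set (ℝ × ℝ)} (hΩ : MeasurableSet Ω) {f g : ℝ × ℝ → ℝ}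
    (h : HasWeakPartial Ω 1 0 f g) (hf : IntegrableOn f Ω) (φ : ContDiffBump (0 : ℝ × ℝ))
    {x : ℝ × ℝ} (hx : Metric.closedBall x φ.rOut ⊆ Ω) :
    HasDerivAt (fun s => mollify φ (Ω.indicator f) (s, x.2)) (mollify φ (Ω.indicator g) x) x.1 := by
  have hF : Integrable (Ω.indicator f) := (integrable_indicator_iff hΩ).2 hf
  obtain ⟨h1, h2⟩ := hasFDerivAt_mollify φ hF x (1, 0)
  have h3 : HasDerivAt (fun s : ℝ => (s, x.2)) ((1 : ℝ), (0 : ℝ)) x.1 :=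
    (hasDerivAt_id x.1).prodMk (hasDerivAt_const x.1 x.2)
  have h4 := h1.comp_hasDerivAt (x := x.1) (f := fun s : ℝ => (s, x.2)) h3
  refine h4.congr_deriv ?_
  have hη := contDiff_normed_sub φ x
  have e := h.2.2 _ hη ((isCompact_closedBall x φ.rOut).of_isClosed_subset (isClosed_tsupport _)
    (tsupport_normed_sub φ x)) ((tsupport_normed_sub φ x).trans hx)
  simp only [Function.iterate_one, Function.iterate_zero, id_eq, dr_eq hη, fderiv_normed_sub,
    mul_neg, integral_neg, add_zero, pow_one, neg_mul, one_mul, neg_inj] at e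
  rw [h2, integral_indicator_mul hΩ, e, mollify, integral_indicator_mul hΩ]

theorem hasDerivAt_mollify_snd {Ω : Set (ℝ × ℝ)} (hΩ : MeasurableSet Ω) {f g : ℝ × ℝ → ℝ}
    (h : HasWeakPartial Ω 0 1 f g) (hf : IntegrableOn f Ω) (φ : ContDiffBump (0 : ℝ × ℝ))
    {x : ℝ × ℝ} (hx : Metric.closedBall x φ.rOut ⊆ Ω) :
    HasDerivAt (fun t => mollify φ (Ω.indicator f) (x.1, t)) (mollify φ (Ω.indicator g) x) x.2 := by
  have hF : Integrable (Ω.indicator f) := (integrable_indicator_iff hΩ).2 hf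
  obtain ⟨h1, h2⟩ := hasFDerivAt_mollify φ hF x (0, 1)
  have h3 : HasDerivAt (fun t : ℝ => (x.1, t)) ((0 : ℝ), (1 : ℝ)) x.2 :=
    (hasDerivAt_const x.2 x.1).prodMk (hasDerivAt_id x.2)
  have h4 := h1.comp_hasDerivAt (x := x.2) (f := fun t : ℝ => (x.1, t)) h3
  refine h4.congr_deriv ?_
  have hη := contDiff_normed_sub φ x
  have e := h.2.2 _ hη ((isCompact_closedBall x φ.rOut).of_isClosed_subset (isClosed_tsupport _)
    (tsupport_normed_sub φ x)) ((tsupport_normed_sub φ x).trans hx)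
  simp only [Function.iterate_one, Function.iterate_zero, id_eq, dθ_eq hη, fderiv_normed_sub,
    mul_neg, integral_neg, zero_add, pow_one, neg_mul, one_mul, neg_inj] at e
  rw [h2, integral_indicator_mul hΩ, e, mollify, integral_indicator_mul hΩ]

theorem integrable_mul_normed_sub (φ : ContDiffBump (0 : ℝ × ℝ)) {F : ℝ × ℝ → ℝ}
    (hF : Integrable F) (x : ℝ × ℝ) : Integrable (fun y => F y * φ.normed volume (x - y)) := by
  have hc : Continuous (fun y => φ.normed volume (x - y)) := (contDiff_normed_sub φ x).continuous
  obtain ⟨M, hM⟩ := hc.bounded_above_of_compact_support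
    ((isCompact_closedBall x φ.rOut).of_isClosed_subset (isClosed_tsupport _)
      (tsupport_normed_sub φ x))
  exact hF.mul_bdd (c := M) hc.aestronglyMeasurable (Filter.Eventually.of_forall hM)

theorem integral_normed_sub (φ : ContDiffBump (0 : ℝ × ℝ)) (x : ℝ × ℝ) :
    ∫ y, φ.normed volume (x - y) = 1 := by
  rw [integral_sub_left_eq_self (φ.normed volume) volume x, φ.integral_normed]

/-- Jensen's inequality for the probability density `φ.normed`, obtained from the nonnegativity of
the variance `∫ (F - m)² φ`. -/
theorem mollify_sq_le (φ : ContDiffBump (0 : ℝ × ℝ)) {F : ℝ × ℝ → ℝ} (hF : Integrable F)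
    (hF2 : Integrable (fun y => F y ^ 2)) (x : ℝ × ℝ) :
    mollify φ F x ^ 2 ≤ mollify φ (fun y => F y ^ 2) x := by
  set m := mollify φ F x with hm
  have i1 := integrable_mul_normed_sub φ hF x
  have i2 := integrable_mul_normed_sub φ hF2 x
  have i0 : Integrable (fun y => φ.normed volume (x - y)) :=
    (φ.integrable_normed).comp_sub_left x
  have h : 0 ≤ ∫ y, (F y - m) ^ 2 * φ.normed volume (x - y) :=
    integral_nonneg fun y => mul_nonneg (sq_nonneg _) (φ.nonneg_normed _)
  have e : ∫ y, (F y - m) ^ 2 * φ.normed volume (x - y)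
      = mollify φ (fun y => F y ^ 2) x - 2 * m * m + m ^ 2 * 1 := by
    have e0 : mollify φ (fun y => F y ^ 2) x - 2 * m * m + m ^ 2 * 1
        = (∫ y, F y ^ 2 * φ.normed volume (x - y)) - 2 * m * (∫ y, F y * φ.normed volume (x - y))
          + m ^ 2 * ∫ y, φ.normed volume (x - y) := by
      rw [integral_normed_sub φ x]; rfl
    rw [e0, ← integral_const_mul, ← integral_const_mul, ← integral_sub i2 (i1.const_mul _)]
    have i3 : Integrable (fun y => F y ^ 2 * φ.normed volume (x - y)
        - 2 * m * (F y * φ.normed volume (x - y))) := i2.sub (i1.const_mul _)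
    rw [← integral_add i3 (i0.const_mul _)]
    congr 1; ext y; ring
  rw [e] at h
  linarith

theorem integral_mollify (φ : ContDiffBump (0 : ℝ × ℝ)) {F : ℝ × ℝ → ℝ} (hF : Integrable F) :
    ∫ x, mollify φ F x = ∫ x, F x := by
  rw [mollify_eq_convolution_left, integral_convolution _ φ.integrable_normed hF, φ.integral_normed]
  simp

/-- Mollification does not increase the `L²` norm: Jensen pointwise, then the kernel has mass one.
-/
theorem setIntegral_mollify_sq_le (φ : ContDiffBump (0 : ℝ × ℝ)) {F : ℝ × ℝ → ℝ}
    (hF : Integrable F) (hF2 : Integrable (fun y => F y ^ 2)) {K : Set (ℝ × ℝ)} (hK : IsCompact K) :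
    ∫ x in K, mollify φ F x ^ 2 ≤ ∫ x, F x ^ 2 := by
  rw [← integral_mollify φ hF2]
  have hi : Integrable (mollify φ (fun y => F y ^ 2)) := by
    rw [mollify_eq_convolution_left]
    exact φ.integrable_normed.integrable_convolution _ hF2
  calc ∫ x in K, mollify φ F x ^ 2 ≤ ∫ x in K, mollify φ (fun y => F y ^ 2) x := by
        apply setIntegral_mono_on _ hi.integrableOn hK.measurableSet fun x _ => mollify_sq_le φ hF hF2 x
        exact ((continuous_mollify φ hF).pow 2).continuousOn.integrableOn_compact hK
    _ ≤ _ := by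
        apply setIntegral_le_integral hi
        refine Filter.Eventually.of_forall fun x => ?_
        exact integral_nonneg fun y => mul_nonneg (sq_nonneg _) (φ.nonneg_normed _)

end EulerPoisson
end

/-! ### The embedding of `H³` of the thin rectangle into the Lipschitz functions. -/

noncomputable section
namespace EulerPoisson

theorem eLpNorm_two_eq {α : Type*} [MeasurableSpace α] {μ : Measure α} {g : α → ℝ}
    (hg : MemLp g 2 μ) : eLpNorm g 2 μ = ENNReal.ofReal (Real.sqrt (∫ x, g x ^ 2 ∂μ)) := by
  rw [hg.eLpNorm_eq_integral_rpow_norm (by simp) (by simp), Real.sqrt_eq_rpow]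
  simp

theorem integral_sq_le_of_eLpNorm_le {α : Type*} [MeasurableSpace α] {μ : Measure α} {g : α → ℝ}
    (hg : MemLp g 2 μ) {N : ℝ} (hN : 0 ≤ N) (h : eLpNorm g 2 μ ≤ ENNReal.ofReal N) :
    ∫ x, g x ^ 2 ∂μ ≤ N ^ 2 := by
  rw [eLpNorm_two_eq hg, ENNReal.ofReal_le_ofReal_iff hN, Real.sqrt_le_left hN] at h
  exact h

theorem isOpen_domain (R θ₀ : ℝ) : IsOpen (domain R θ₀) := isOpen_Ioo.prod isOpen_Ioo

theorem isFiniteMeasure_restrict_domain (R θ₀ : ℝ) :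
    IsFiniteMeasure (volume.restrict (domain R θ₀)) := by
  refine ⟨?_⟩
  rw [Measure.restrict_apply_univ]
  exact (Metric.isBounded_Ioo 0 R).prod (Metric.isBounded_Ioo (-θ₀) θ₀) |>.measure_lt_top

/-- A function in `L²(Ω)` extended by zero, with its square, is integrable. -/
theorem integrable_indicator_of_memLp {R θ₀ : ℝ} {g : ℝ × ℝ → ℝ}
    (hg : MemLp g 2 (volume.restrict (domain R θ₀))) :
    Integrable ((domain R θ₀).indicator g) ∧
      Integrable (fun y => (domain R θ₀).indicator g y ^ 2) := by
  have := isFiniteMeasure_restrict_domain R θ₀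
  have hm : MeasurableSet (domain R θ₀) := (isOpen_domain R θ₀).measurableSet
  refine ⟨(integrable_indicator_iff hm).2 (hg.integrable (by norm_num)), ?_⟩
  have : (fun y => (domain R θ₀).indicator g y ^ 2) = (domain R θ₀).indicator (fun y => g y ^ 2) := by
    ext y; by_cases h : y ∈ domain R θ₀ <;> simp [h]
  rw [this, integrable_indicator_iff hm]
  exact hg.integrable_sq

theorem integral_indicator_sq {R θ₀ : ℝ} (g : ℝ × ℝ → ℝ) :
    ∫ y, (domain R θ₀).indicator g y ^ 2 = ∫ y in domain R θ₀, g y ^ 2 := by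
  have hm : MeasurableSet (domain R θ₀) := (isOpen_domain R θ₀).measurableSet
  rw [← integral_indicator hm]
  congr 1; ext y; by_cases h : y ∈ domain R θ₀ <;> simp [h]

/-- The classical Sobolev inequality is applied to the mollification on an inner rectangle. Its
constants involve only the size of that rectangle and the `L²` norms of the weak derivatives, so the
bound does not depend on the kernel. -/
theorem mollify_sq_le_of_weakPartial {R θ₀ a b c d N : ℝ} (hab : a < b) (hcd : c < d)
    {f fr fθ frθ : ℝ × ℝ → ℝ} (φ : ContDiffBump (0 : ℝ × ℝ))
    (hφ : ∀ x ∈ rect a b c d, Metric.closedBall x φ.rOut ⊆ domain R θ₀)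
    (hf : MemLp f 2 (volume.restrict (domain R θ₀)))
    (hfr : MemLp fr 2 (volume.restrict (domain R θ₀)))
    (hfθ : MemLp fθ 2 (volume.restrict (domain R θ₀)))
    (hfrθ : MemLp frθ 2 (volume.restrict (domain R θ₀)))
    (d1 : HasWeakPartial (domain R θ₀) 1 0 f fr) (d2 : HasWeakPartial (domain R θ₀) 0 1 f fθ)
    (d3 : HasWeakPartial (domain R θ₀) 1 0 fθ frθ)
    (n0 : ∫ p in domain R θ₀, f p ^ 2 ≤ N) (n1 : ∫ p in domain R θ₀, fr p ^ 2 ≤ N)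
    (n2 : ∫ p in domain R θ₀, fθ p ^ 2 ≤ N) (n3 : ∫ p in domain R θ₀, frθ p ^ 2 ≤ N)
    {p : ℝ × ℝ} (hp : p ∈ rect a b c d) :
    mollify φ ((domain R θ₀).indicator f) p ^ 2
      ≤ (2 / (b - a) + (b - a)) * (2 / (d - c) + (d - c)) * N := by
  have := isFiniteMeasure_restrict_domain R θ₀
  have hm : MeasurableSet (domain R θ₀) := (isOpen_domain R θ₀).measurableSet
  have cont : ∀ {g : ℝ × ℝ → ℝ}, MemLp g 2 (volume.restrict (domain R θ₀)) →
      ContinuousOn (mollify φ ((domain R θ₀).indicator g)) (rect a b c d) := fun hg =>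
    (continuous_mollify φ (integrable_indicator_of_memLp hg).1).continuousOn
  have bound : ∀ {g : ℝ × ℝ → ℝ}, MemLp g 2 (volume.restrict (domain R θ₀)) →
      (∫ p in domain R θ₀, g p ^ 2 ≤ N) →
      ∫ p in rect a b c d, mollify φ ((domain R θ₀).indicator g) p ^ 2 ≤ N := fun hg hN =>
    (setIntegral_mollify_sq_le φ (integrable_indicator_of_memLp hg).1
      (integrable_indicator_of_memLp hg).2 (isCompact_rect a b c d)).trans
      ((integral_indicator_sq _).trans_le hN)
  exact sq_le_of_integral_sq_le hab hcd (cont hf) (cont hfr) (cont hfθ) (cont hfrθ)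
    (fun x hx => (hasDerivAt_mollify_fst hm d1 (hf.integrable (by norm_num)) φ
      (hφ x hx)).hasDerivWithinAt)
    (fun x hx => (hasDerivAt_mollify_snd hm d2 (hf.integrable (by norm_num)) φ
      (hφ x hx)).hasDerivWithinAt)
    (fun x hx => (hasDerivAt_mollify_fst hm d3 (hfθ.integrable (by norm_num)) φ
      (hφ x hx)).hasDerivWithinAt)
    (bound hf n0) (bound hfr n1) (bound hfθ n2) (bound hfrθ n3) hp

/-- The two points are joined by a path parallel to the axes. Each leg is at most the sup-distance,
whence the factor 2. -/
theorem abs_sub_le_of_partial_bound {a b c d M : ℝ} {h hr hθ : ℝ × ℝ → ℝ}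
    (d1 : ∀ p ∈ rect a b c d, HasDerivAt (fun s => h (s, p.2)) (hr p) p.1)
    (d2 : ∀ p ∈ rect a b c d, HasDerivAt (fun t => h (p.1, t)) (hθ p) p.2)
    (b1 : ∀ p ∈ rect a b c d, |hr p| ≤ M) (b2 : ∀ p ∈ rect a b c d, |hθ p| ≤ M)
    {x y : ℝ × ℝ} (hx : x ∈ rect a b c d) (hy : y ∈ rect a b c d) :
    |h x - h y| ≤ 2 * M * dist x y := by
  have hM : 0 ≤ M := (abs_nonneg _).trans (b1 x hx)
  have e1 := (convex_Icc a b).norm_image_sub_le_of_norm_hasDerivWithin_le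
    (f := fun s => h (s, x.2)) (f' := fun s => hr (s, x.2)) (C := M)
    (fun s hs => (d1 (s, x.2) ⟨hs, hx.2⟩).hasDerivWithinAt) (fun s hs => b1 (s, x.2) ⟨hs, hx.2⟩)
    hy.1 hx.1
  have e2 := (convex_Icc c d).norm_image_sub_le_of_norm_hasDerivWithin_le
    (f := fun t => h (y.1, t)) (f' := fun t => hθ (y.1, t)) (C := M)
    (fun t ht => (d2 (y.1, t) ⟨hy.1, ht⟩).hasDerivWithinAt) (fun t ht => b2 (y.1, t) ⟨hy.1, ht⟩)
    hy.2 hx.2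
  have f1 : ‖x.1 - y.1‖ ≤ dist x y := by
    rw [← dist_eq_norm, Prod.dist_eq]; exact le_max_left _ _
  have f2 : ‖x.2 - y.2‖ ≤ dist x y := by
    rw [← dist_eq_norm, Prod.dist_eq]; exact le_max_right _ _
  simp only [Real.norm_eq_abs, Prod.mk.eta] at e1 e2 f1 f2
  calc |h x - h y| ≤ |h x - h (y.1, x.2)| + |h (y.1, x.2) - h y| := abs_sub_le _ _ _
    _ ≤ M * dist x y + M * dist x y := by
        gcongr
        · exact e1.trans (by gcongr)
        · exact e2.trans (by gcongr)
    _ = _ := by ring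

theorem mem_multiIndices {k i j : ℕ} (h : i + j ≤ k) : (i, j) ∈ multiIndices k := by
  simp only [multiIndices, Finset.mem_filter, Finset.mem_product, Finset.mem_range]
  omega

/-- The constant of the embedding of `H³(Ω_R)` into the Lipschitz functions, up to `R^{-1/2}`. -/
def embConst (ℓ θ₀ : ℝ) : ℝ := Real.sqrt ((4 + ℓ ^ 2) * (2 / θ₀ + 2 * θ₀))

/-- The bounded ratio of outer to inner radius is what makes the convolutions converge at almost
every point, by Lebesgue differentiation. -/
theorem exists_bump_seq : ∃ φ : ℕ → ContDiffBump (0 : ℝ × ℝ),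
    Filter.Tendsto (fun n => (φ n).rOut) Filter.atTop (nhds 0) ∧
      ∀ n, (φ n).rOut ≤ 2 * (φ n).rIn := by
  refine ⟨fun n => ⟨1 / ((n : ℝ) + 1) / 2, 1 / ((n : ℝ) + 1), by positivity, ?_⟩, ?_, ?_⟩
  · have : 0 < 1 / ((n : ℝ) + 1) := by positivity
    linarith
  · exact tendsto_one_div_add_atTop_nhds_zero_nat
  · intro n; simp only; linarith

/-- The bounds on `ε` keep the inner rectangle at least `R / 2` wide and `θ₀` high, so that the
Sobolev constant stays under control as `ε` shrinks. -/
theorem exists_inner_rect {R θ₀ : ℝ} {x y : ℝ × ℝ}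
    (hx : x ∈ domain R θ₀) (hy : y ∈ domain R θ₀) :
    ∃ ε, 0 < ε ∧ ε ≤ R / 4 ∧ ε ≤ θ₀ / 2 ∧ x ∈ rect ε (R - ε) (-θ₀ + ε) (θ₀ - ε) ∧
      y ∈ rect ε (R - ε) (-θ₀ + ε) (θ₀ - ε) := by
  obtain ⟨⟨a1, a2⟩, a3, a4⟩ := hx
  obtain ⟨⟨b1, b2⟩, b3, b4⟩ := hy
  have : ∃ ε, 0 < ε ∧ ∀ z ∈ ([R / 4, θ₀ / 2, x.1, R - x.1, x.2 + θ₀, θ₀ - x.2, y.1, R - y.1,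
      y.2 + θ₀, θ₀ - y.2] : List ℝ), ε ≤ z := by
    have : ∀ l : List ℝ, (∀ z ∈ l, 0 < z) → ∃ ε, 0 < ε ∧ ∀ z ∈ l, ε ≤ z := by
      intro l
      induction l with
      | nil => exact fun _ => ⟨1, one_pos, by simp⟩
      | cons z l ih =>
        intro h
        obtain ⟨ε, h0, h1⟩ := ih fun w hw => h w (List.mem_cons_of_mem _ hw)
        refine ⟨min ε z, lt_min h0 (h z (by simp)), fun w hw => ?_⟩
        rcases List.mem_cons.1 hw with rfl | hw
        · exact min_le_right _ _
        · exact (min_le_left _ _).trans (h1 w hw)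
    apply this
    simp only [List.mem_cons, List.not_mem_nil, or_false, forall_eq_or_imp, forall_eq]
    refine ⟨?_, ?_, ?_, ?_, ?_, ?_, ?_, ?_, ?_, ?_⟩ <;> linarith
  obtain ⟨ε, h0, h1⟩ := this
  simp only [List.mem_cons, List.not_mem_nil, or_false, forall_eq_or_imp, forall_eq] at h1
  obtain ⟨c0, c1, c2, c3, c4, c5, c6, c7, c8, c9⟩ := h1
  refine ⟨ε, h0, c0, c1, ⟨⟨?_, ?_⟩, ?_, ?_⟩, ⟨?_, ?_⟩, ?_, ?_⟩ <;> linarith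

theorem closedBall_subset_domain {R θ₀ ε δ : ℝ} (hδ : δ < ε) {x : ℝ × ℝ}
    (hx : x ∈ rect ε (R - ε) (-θ₀ + ε) (θ₀ - ε)) : Metric.closedBall x δ ⊆ domain R θ₀ := by
  obtain ⟨⟨a1, a2⟩, a3, a4⟩ := hx
  intro y hy
  rw [Metric.mem_closedBall, Prod.dist_eq, max_le_iff, Real.dist_eq, Real.dist_eq, abs_le,
    abs_le] at hy
  obtain ⟨⟨b1, b2⟩, b3, b4⟩ := hy
  refine ⟨⟨?_, ?_⟩, ?_, ?_⟩ <;> linarith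

/-- Functions of class `H³` on the thin rectangle have Lipschitz representatives, with constants
of order `R^{-1/2}`. -/
theorem exists_lipschitz_representative {ℓ θ₀ R N : ℝ} (hθ : 0 < θ₀) (hR : 0 < R) (hRℓ : R ≤ ℓ)
    (hN : 0 ≤ N) {k : ℕ} (hk : 3 ≤ k) {f : ℝ × ℝ → ℝ} {G : ℕ × ℕ → ℝ × ℝ → ℝ}
    (hG : IsSobolevFamily k (domain R θ₀) f G)
    (hGN : ∀ a ∈ multiIndices k,
      eLpNorm (G a) 2 (volume.restrict (domain R θ₀)) ≤ ENNReal.ofReal N) :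
    ∃ F : ℝ × ℝ → ℝ, LipschitzWith (2 * (embConst ℓ θ₀ * N / Real.sqrt R)).toNNReal F ∧
      (∀ p, |F p| ≤ 2 * (embConst ℓ θ₀ * N / Real.sqrt R)) ∧
      ∀ᵐ p, p ∈ domain R θ₀ → f p = F p := by
  set M := embConst ℓ θ₀ * N / Real.sqrt R with hM
  have hM0 : 0 ≤ M := by rw [hM, embConst]; positivity
  have := isFiniteMeasure_restrict_domain R θ₀
  have hm : MeasurableSet (domain R θ₀) := (isOpen_domain R θ₀).measurableSet
  obtain ⟨φ, hφ0, hφK⟩ := exists_bump_seq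
  set H : ℕ → ℕ × ℕ → ℝ × ℝ → ℝ := fun n a => mollify (φ n) ((domain R θ₀).indicator (G a)) with hH
  have L2 : ∀ i j, i + j ≤ 3 → MemLp (G (i, j)) 2 (volume.restrict (domain R θ₀)) := fun i j hij =>
    (hG _ (mem_multiIndices (hij.trans hk))).2
  have nb : ∀ i j, i + j ≤ 3 → ∫ p in domain R θ₀, G (i, j) p ^ 2 ≤ N ^ 2 := fun i j hij =>
    integral_sq_le_of_eLpNorm_le (L2 i j hij) hN (hGN _ (mem_multiIndices (hij.trans hk)))
  have w1 : ∀ i j, i + 1 + j ≤ 3 → HasWeakPartial (domain R θ₀) 1 0 (G (i, j)) (G (i + 1, j)) :=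
    fun i j hij => (hG _ (mem_multiIndices (i := i) (j := j) (by omega))).1.succ_fst
      (hG _ (mem_multiIndices (i := i + 1) (j := j) (by omega))).1
  have w2 : ∀ i j, i + j + 1 ≤ 3 → HasWeakPartial (domain R θ₀) 0 1 (G (i, j)) (G (i, j + 1)) :=
    fun i j hij => (hG _ (mem_multiIndices (i := i) (j := j) (by omega))).1.succ_snd
      (hG _ (mem_multiIndices (i := i) (j := j + 1) (by omega))).1
  -- The index ranges over orders 0 and 1: the anisotropic inequality uses one further derivative in
  -- each variable, up to total order 3.
  have sup : ∀ ε, ε ≤ R / 4 → ε ≤ θ₀ / 2 → ∀ n, (φ n).rOut < ε → ∀ i j, i + j ≤ 1 →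
      ∀ p ∈ rect ε (R - ε) (-θ₀ + ε) (θ₀ - ε), |H n (i, j) p| ≤ M := by
    intro ε e1 e2 n hn i j hij p hp
    have e0 : 0 < ε := (φ n).rOut_pos.trans hn
    have := mollify_sq_le_of_weakPartial (a := ε) (b := R - ε) (c := -θ₀ + ε) (d := θ₀ - ε)
      (by linarith) (by linarith) (φ n)
      (fun x hx => closedBall_subset_domain hn hx) (L2 i j (by omega)) (L2 (i + 1) j (by omega))
      (L2 i (j + 1) (by omega)) (L2 (i + 1) (j + 1) (by omega)) (w1 i j (by omega))
      (w2 i j (by omega)) (w1 i (j + 1) (by omega)) (nb i j (by omega)) (nb (i + 1) j (by omega))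
      (nb i (j + 1) (by omega)) (nb (i + 1) (j + 1) (by omega)) hp
    apply abs_le_of_sq_le_sq _ hM0
    refine this.trans ?_
    -- The inner width is at least `R / 2`, giving `2 / width ≤ 4 / R`, and `width ≤ R ≤ ℓ² / R`.
    -- Together these are `(4 + ℓ²) / R`, the source of the loss `R^{-1/2}`.
    have hM2 : M ^ 2 = ((4 + ℓ ^ 2) / R) * (2 / θ₀ + 2 * θ₀) * N ^ 2 := by
      rw [hM, div_pow, mul_pow, embConst, Real.sq_sqrt (by positivity), Real.sq_sqrt hR.le]
      ring
    rw [hM2]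
    have hw : R / 2 ≤ R - ε - ε := by linarith
    have hh : θ₀ ≤ θ₀ - ε - (-θ₀ + ε) := by linarith
    have hw0 : 0 < R - ε - ε := by linarith
    have hh0 : 0 < θ₀ - ε - (-θ₀ + ε) := by linarith
    have q1 : 2 / (R - ε - ε) + (R - ε - ε) ≤ (4 + ℓ ^ 2) / R := by
      have : 2 / (R - ε - ε) ≤ 2 / (R / 2) := by gcongr
      have h3 : R ≤ ℓ ^ 2 / R := by
        rw [le_div_iff₀ hR, ← sq]; gcongr
      have h4 : 2 / (R / 2) = 4 / R := by field_simp; norm_num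
      rw [add_div]
      linarith
    have q2 : 2 / (θ₀ - ε - (-θ₀ + ε)) + (θ₀ - ε - (-θ₀ + ε)) ≤ 2 / θ₀ + 2 * θ₀ := by
      have : 2 / (θ₀ - ε - (-θ₀ + ε)) ≤ 2 / θ₀ := by gcongr
      linarith
    gcongr
  have conv : ∀ᵐ x, Filter.Tendsto (fun n => H n (0, 0) x) Filter.atTop
      (nhds ((domain R θ₀).indicator (G (0, 0)) x)) := by
    have := ContDiffBump.ae_convolution_tendsto_right_of_locallyIntegrable (μ := volume)
      (g := (domain R θ₀).indicator (G (0, 0))) hφ0 (K := 2) (Filter.Eventually.of_forall hφK)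
      (integrable_indicator_of_memLp (L2 0 0 (by omega))).1.locallyIntegrable
    simpa only [hH, mollify_eq_convolution_left] using this
  have hae := (hG _ (mem_multiIndices (i := 0) (j := 0) (by omega))).1.ae_eq (isOpen_domain R θ₀)
  -- The points where the mollifications converge to `f`. This set has full measure in the domain,
  -- and on it `f` inherits their uniform bounds.
  set S : Set (ℝ × ℝ) := {x | x ∈ domain R θ₀ ∧ Filter.Tendsto (fun n => H n (0, 0) x)
    Filter.atTop (nhds (f x))} with hS
  have hSae : ∀ᵐ x, x ∈ domain R θ₀ → x ∈ S := by
    filter_upwards [conv, hae] with x h1 h2 hx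
    refine ⟨hx, ?_⟩
    rw [h2 hx]
    rwa [indicator_of_mem hx] at h1
  have hlip : LipschitzOnWith (2 * M).toNNReal f S := by
    apply LipschitzOnWith.of_dist_le_mul
    rintro x ⟨hx, tx⟩ y ⟨hy, ty⟩
    rw [Real.coe_toNNReal _ (by positivity), Real.dist_eq]
    obtain ⟨ε, e0, e1, e2, xr, yr⟩ := exists_inner_rect hx hy
    refine le_of_tendsto (tx.sub ty).abs ?_
    filter_upwards [hφ0.eventually (gt_mem_nhds e0)] with n hn
    exact abs_sub_le_of_partial_bound (hr := H n (1, 0)) (hθ := H n (0, 1))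
      (fun p hp => hasDerivAt_mollify_fst hm (w1 0 0 (by omega))
        ((L2 0 0 (by omega)).integrable (by norm_num)) _ (closedBall_subset_domain hn hp))
      (fun p hp => hasDerivAt_mollify_snd hm (w2 0 0 (by omega))
        ((L2 0 0 (by omega)).integrable (by norm_num)) _ (closedBall_subset_domain hn hp))
      (sup ε e1 e2 n hn 1 0 (by omega)) (sup ε e1 e2 n hn 0 1 (by omega)) xr yr
  have hbd : ∀ x ∈ S, |f x| ≤ M := by
    rintro x ⟨hx, tx⟩
    obtain ⟨ε, e0, e1, e2, xr, -⟩ := exists_inner_rect hx hx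
    refine le_of_tendsto tx.abs ?_
    filter_upwards [hφ0.eventually (gt_mem_nhds e0)] with n hn
    exact sup ε e1 e2 n hn 0 0 (by omega) x xr
  -- A Lipschitz extension to the plane, then truncated at `±2M`. Truncation preserves the Lipschitz
  -- constant and changes nothing on `S`, where `|f| ≤ M`.
  obtain ⟨F, hF, hFf⟩ := hlip.extend_real
  refine ⟨fun x => max (-(2 * M)) (min (F x) (2 * M)), (hF.min_const _).const_max _, fun p => ?_, ?_⟩
  · rw [abs_le]
    exact ⟨le_max_left _ _, max_le (by linarith) (min_le_right _ _)⟩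
  · filter_upwards [hSae] with x hx hxd
    have hxS := hx hxd
    have hb := abs_le.1 (hbd x hxS)
    rw [← hFf hxS, min_eq_left (by linarith), max_eq_right (by linarith)]

/-- A strict bound on the infimum yields an actual family of weak derivatives, each of whose `L²`
norms is at most the whole sum. -/
theorem exists_lipschitz_of_sobolevNorm_lt {ℓ θ₀ R δ : ℝ} (hθ : 0 < θ₀) (hR : 0 < R) (hRℓ : R ≤ ℓ)
    {k : ℕ} (hk : 3 ≤ k) {f : ℝ × ℝ → ℝ} (hf : sobolevNorm k (domain R θ₀) f < ENNReal.ofReal δ) :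
    ∃ F : ℝ × ℝ → ℝ, LipschitzWith (2 * (embConst ℓ θ₀ * δ / Real.sqrt R)).toNNReal F ∧
      (∀ p, |F p| ≤ 2 * (embConst ℓ θ₀ * δ / Real.sqrt R)) ∧
      ∀ᵐ p, p ∈ domain R θ₀ → f p = F p := by
  have hδ : 0 < δ := ENNReal.ofReal_pos.1 (bot_le.trans_lt hf)
  simp only [sobolevNorm, iInf_lt_iff] at hf
  obtain ⟨G, hG, hlt⟩ := hf
  refine exists_lipschitz_representative hθ hR hRℓ hδ.le hk hG fun a ha => ?_
  refine le_trans ?_ hlt.le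
  rw [one_div, ENNReal.le_rpow_inv_iff (by norm_num)]
  have := Finset.single_le_sum (s := multiIndices k)
    (f := fun a => eLpNorm (G a) 2 (volume.restrict (domain R θ₀)) ^ 2) (fun _ _ => zero_le) ha
  simpa using this

end EulerPoisson
end

/-! ### Wall traces and classical functions on the closed rectangle. -/

noncomputable section
namespace EulerPoisson

theorem closedDomain_eq_rect (R θ₀ : ℝ) : closedDomain R θ₀ = rect 0 R (-θ₀) θ₀ := rfl

theorem domain_subset_closedDomain (R θ₀ : ℝ) : domain R θ₀ ⊆ closedDomain R θ₀ :=
  prod_mono Ioo_subset_Icc_self Ioo_subset_Icc_self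

theorem restrict_domain_eq (R θ₀ : ℝ) :
    (volume : Measure (ℝ × ℝ)).restrict (domain R θ₀) = volume.restrict (closedDomain R θ₀) := by
  apply Measure.restrict_congr_set
  rw [domain, closedDomain, Measure.volume_eq_prod]
  exact Measure.set_prod_ae_eq Ioo_ae_eq_Icc Ioo_ae_eq_Icc

theorem setIntegral_domain_eq (R θ₀ : ℝ) (f : ℝ × ℝ → ℝ) :
    ∫ p in domain R θ₀, f p = ∫ p in rect 0 R (-θ₀) θ₀, f p := by
  rw [restrict_domain_eq, closedDomain_eq_rect]

/-! ### Traces on the walls -/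

/-- The bumps concentrate at a height outside the open interval, so they tend to zero at every point
of the domain, and dominated convergence applies. -/
theorem tendsto_integral_mul_bump {R θ₀ c : ℝ} (hc : c ∉ Ioo (-θ₀) θ₀) {w : ℝ × ℝ → ℝ}
    (hw : IntegrableOn w (domain R θ₀)) {β : ℕ → ContDiffBump c}
    (hβ : Filter.Tendsto (fun n => (β n).rOut) Filter.atTop (nhds 0)) :
    Filter.Tendsto (fun n => ∫ p in domain R θ₀, w p * β n p.2) Filter.atTop (nhds 0) := by
  have h0 : (0 : ℝ) = ∫ p in domain R θ₀, (0 : ℝ) := by simp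
  rw [h0]
  apply tendsto_integral_of_dominated_convergence (fun p => |w p|)
  · intro n
    exact hw.1.mul ((β n).continuous.comp continuous_snd).aestronglyMeasurable
  · exact hw.abs
  · intro n
    refine Filter.Eventually.of_forall fun p => ?_
    rw [norm_mul, Real.norm_eq_abs, Real.norm_eq_abs, abs_of_nonneg (β n).nonneg]
    exact mul_le_of_le_one_right (abs_nonneg _) (β n).le_one
  · refine (ae_restrict_mem (isOpen_domain R θ₀).measurableSet).mono fun p hp => ?_
    have hpc : 0 < dist p.2 c := dist_pos.2 fun h => hc (h ▸ hp.2)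
    refine tendsto_const_nhds.congr' ?_
    filter_upwards [hβ.eventually (gt_mem_nhds hpc)] with n hn
    rw [(β n).zero_of_le_dist hn.le, mul_zero]

/-- The trace identity is tested with `α(r) β_n(θ)`, where `β_n` shrinks to the wall `c`.
Integration by parts against the Lipschitz function `F` isolates the wall integral, and both
interior contributions vanish in the limit. Here `c'` is the opposite wall, and `σ` is the
orientation sign. -/
theorem integral_wall_eq_zero {R θ₀ c c' σ : ℝ} (hR : 0 < R) (hθ : 0 < θ₀)
    (hc : c = θ₀ ∧ c' = -θ₀ ∧ σ = 1 ∨ c = -θ₀ ∧ c' = θ₀ ∧ σ = -1)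
    {f F : ℝ × ℝ → ℝ} {K : NNReal} (hF : LipschitzWith K F)
    (hfF : ∀ᵐ p, p ∈ domain R θ₀ → f p = F p) (h : WallTraceZero R θ₀ 0 f)
    {α : ℝ → ℝ} (hα : ContDiff ℝ ∞ α) (hαc : HasCompactSupport α) (hαs : tsupport α ⊆ Ioo 0 R) :
    ∫ s in (0 : ℝ)..R, F (s, c) * α s = 0 := by
  have := isFiniteMeasure_restrict_domain R θ₀
  have hm : MeasurableSet (domain R θ₀) := (isOpen_domain R θ₀).measurableSet
  obtain ⟨f₀, f₁, h0, -, -, hf₁, hη⟩ := h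
  have hf₁i : IntegrableOn f₁ (domain R θ₀) := hf₁.integrable (by norm_num)
  obtain ⟨A, hA⟩ := hαc.exists_bound_of_continuous hα.continuous
  have hβpos : ∀ n : ℕ, 0 < θ₀ / ((n : ℝ) + 1) := fun n => by positivity
  let β : ℕ → ContDiffBump c := fun n =>
    ⟨θ₀ / ((n : ℝ) + 1) / 2, θ₀ / ((n : ℝ) + 1), half_pos (hβpos n), half_lt_self (hβpos n)⟩
  have hβ : Filter.Tendsto (fun n => (β n).rOut) Filter.atTop (nhds 0) := by
    have := (tendsto_one_div_add_atTop_nhds_zero_nat (𝕜 := ℝ)).const_mul θ₀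
    simpa [β, mul_one_div] using! this
  have hcn : c ∉ Ioo (-θ₀) θ₀ := by
    rcases hc with ⟨rfl, -⟩ | ⟨rfl, -⟩ <;> simp
  have hβ' : ∀ n, β n c' = 0 := by
    intro n
    apply (β n).zero_of_le_dist
    have h1 : (β n).rOut ≤ θ₀ := div_le_self hθ.le (by simp)
    have h2 : dist c' c = 2 * θ₀ := by
      rw [Real.dist_eq]
      rcases hc with ⟨rfl, rfl, -⟩ | ⟨rfl, rfl, -⟩
      · rw [show -c - c = -(2 * c) by ring, abs_neg, abs_of_pos (by linarith)]
      · rw [show c' - -c' = 2 * c' by ring, abs_of_pos (by linarith)]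
    linarith
  have hβ1 : ∀ n, β n c = 1 := fun n =>
    (β n).one_of_mem_closedBall (Metric.mem_closedBall_self (β n).rIn_pos.le)
  set w₁ : ℝ × ℝ → ℝ := fun p => f₁ p * α p.1 with hw₁
  set w₂ : ℝ × ℝ → ℝ := fun p => |α p.1| with hw₂
  have hαm : Continuous fun p : ℝ × ℝ => α p.1 := hα.continuous.comp continuous_fst
  have i₁ : IntegrableOn w₁ (domain R θ₀) :=
    hf₁i.mul_bdd (c := A) hαm.aestronglyMeasurable (Filter.Eventually.of_forall fun p => hA p.1)
  have i₂ : IntegrableOn w₂ (domain R θ₀) :=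
    (ContinuousOn.integrableOn_rect (a := 0) (b := R) (c := -θ₀) (d := θ₀)
      hαm.abs.continuousOn).mono_set (domain_subset_closedDomain R θ₀)
  set B := ∫ s in (0 : ℝ)..R, F (s, c) * α s with hB
  have key : ∀ n, |σ * B + ∫ p in domain R θ₀, w₁ p * β n p.2|
      ≤ K * ∫ p in domain R θ₀, w₂ p * β n p.2 := by
    intro n
    have hβc : ContDiff ℝ ∞ (β n) := (β n).contDiff
    set η : ℝ × ℝ → ℝ := fun p => α p.1 * β n p.2 with hηdef
    have hηc : ContDiff ℝ ∞ η := (hα.comp contDiff_fst).mul (hβc.comp contDiff_snd)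
    have hηsupp : tsupport η ⊆ tsupport α ×ˢ tsupport (β n) := by
      apply closure_minimal _ ((isClosed_tsupport _).prod (isClosed_tsupport _))
      intro p hp
      exact ⟨subset_tsupport _ (left_ne_zero_of_mul hp), subset_tsupport _ (right_ne_zero_of_mul hp)⟩
    have hηcs : HasCompactSupport η :=
      (IsCompact.prod hαc (β n).hasCompactSupport).of_isClosed_subset (isClosed_tsupport _) hηsupp
    have e := hη η hηc hηcs (hηsupp.trans (prod_mono hαs (subset_univ _)))
    have hG : ∀ p : ℝ × ℝ, HasDerivAt (fun t => η (p.1, t)) (dθ η p) p.2 := by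
      intro p
      have : DifferentiableAt ℝ (fun t => η (p.1, t)) p.2 :=
        (hηc.comp (contDiff_const.prodMk contDiff_id)).differentiable (by simp) _
      exact this.hasDerivAt
    have ibp := abs_integral_lipschitz_mul_deriv_snd_sub_le (a := 0) (b := R) (c := -θ₀) (d := θ₀)
      (L := K) (u := F) (G := η) (G' := dθ η) hR.le (by linarith) K.2
      (by rw [Real.toNNReal_coe]; exact hF.lipschitzOnWith)
      (fun p _ => (hG p).hasDerivWithinAt) hηc.continuous.continuousOn
      (contDiff_dθ hηc).continuous.continuousOn
    rw [← setIntegral_domain_eq, ← setIntegral_domain_eq] at ibp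
    have e1 : ∫ p in domain R θ₀, F p * dθ η p = -∫ p in domain R θ₀, w₁ p * β n p.2 := by
      calc ∫ p in domain R θ₀, F p * dθ η p = ∫ p in domain R θ₀, f₀ p * dθ η p := by
            apply setIntegral_congr_ae hm
            filter_upwards [hfF, h0.ae_eq (isOpen_domain R θ₀)] with p h1 h2 hp
            rw [← h1 hp, h2 hp]
        _ = _ := e
        _ = _ := by congr 2; ext p; simp only [hηdef, hw₁]; ring
    have e2 : ∫ s in (0 : ℝ)..R, (F (s, θ₀) * η (s, θ₀) - F (s, -θ₀) * η (s, -θ₀)) = σ * B := by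
      rw [hB, ← intervalIntegral.integral_const_mul]
      apply intervalIntegral.integral_congr
      intro s _
      rcases hc with ⟨rfl, rfl, rfl⟩ | ⟨rfl, rfl, rfl⟩
      · simp only [hηdef, hβ1, hβ']; ring
      · simp only [hηdef, hβ1, hβ']; ring
    have e3 : ∫ p in domain R θ₀, |η p| = ∫ p in domain R θ₀, w₂ p * β n p.2 := by
      congr 1; ext p
      simp only [hηdef, hw₂, abs_mul, abs_of_nonneg (β n).nonneg]
    rw [e1, e2, e3] at ibp
    rw [← abs_neg]
    convert ibp using 2
    ring
  have lim : |σ * B + 0| ≤ K * 0 :=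
    le_of_tendsto_of_tendsto' ((tendsto_const_nhds.add (tendsto_integral_mul_bump hcn i₁ hβ)).abs)
      ((tendsto_integral_mul_bump hcn i₂ hβ).const_mul _) key
  have hσB : σ * B = 0 := abs_nonpos_iff.1 (by simpa only [add_zero, mul_zero] using lim)
  rcases hc with ⟨-, -, rfl⟩ | ⟨-, -, rfl⟩ <;> simpa using hσB

/-- The preceding integrals vanish for all test functions `α`, so `F` vanishes on the open wall.
Continuity adds the two corners, which the weak condition does not see. -/
theorem eq_zero_on_walls {R θ₀ : ℝ} (hR : 0 < R) (hθ : 0 < θ₀)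
    {f F : ℝ × ℝ → ℝ} {K : NNReal} (hF : LipschitzWith K F)
    (hfF : ∀ᵐ p, p ∈ domain R θ₀ → f p = F p) (h : WallTraceZero R θ₀ 0 f) {r : ℝ}
    (hr : r ∈ Icc 0 R) : F (r, θ₀) = 0 ∧ F (r, -θ₀) = 0 := by
  have main : ∀ c c' σ : ℝ, (c = θ₀ ∧ c' = -θ₀ ∧ σ = 1 ∨ c = -θ₀ ∧ c' = θ₀ ∧ σ = -1) →
      F (r, c) = 0 := by
    intro c c' σ hc
    have hFc : Continuous fun s => F (s, c) := hF.continuous.comp (by fun_prop)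
    have := isOpen_Ioo.ae_eq_zero_of_integral_contDiff_smul_eq_zero (U := Ioo 0 R) (μ := volume)
      (hFc.locallyIntegrable.locallyIntegrableOn _) (fun α hα hαc hαs => by
        rw [← integral_wall_eq_zero hR hθ hc hF hfF h hα hαc hαs,
          intervalIntegral.integral_of_le hR.le, integral_Ioc_eq_integral_Ioo,
          setIntegral_eq_integral_of_forall_compl_eq_zero]
        · congr 1; ext s; simp [mul_comm]
        · intro s hs
          rw [image_eq_zero_of_notMem_tsupport fun h => hs (hαs h), mul_zero])
    have h2 : EqOn (fun s => F (s, c)) (fun _ => 0) (Ioo 0 R) := by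
      apply Measure.eqOn_open_of_ae_eq (μ := volume) _ isOpen_Ioo hFc.continuousOn
        continuousOn_const
      exact (ae_restrict_iff' measurableSet_Ioo).2 this
    have h3 := h2.closure hFc continuous_const
    rw [closure_Ioo hR.ne] at h3
    exact h3 hr
  exact ⟨main _ _ 1 (Or.inl ⟨rfl, rfl, rfl⟩), main _ _ (-1) (Or.inr ⟨rfl, rfl, rfl⟩)⟩

/-! ### Functions of class `C²` on the closed rectangle -/

/-- The continuity and differentiation rules for the partial derivatives of a `C²` function. -/
structure IsC2 (R θ₀ : ℝ) (f : ℝ × ℝ → ℝ) : Prop where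
  cont : ContinuousOn f (rect 0 R (-θ₀) θ₀)
  cont_r : ContinuousOn (pr R f) (rect 0 R (-θ₀) θ₀)
  cont_θ : ContinuousOn (pθ θ₀ f) (rect 0 R (-θ₀) θ₀)
  cont_rr : ContinuousOn (pr R (pr R f)) (rect 0 R (-θ₀) θ₀)
  cont_rθ : ContinuousOn (pθ θ₀ (pr R f)) (rect 0 R (-θ₀) θ₀)
  cont_θθ : ContinuousOn (pθ θ₀ (pθ θ₀ f)) (rect 0 R (-θ₀) θ₀)
  deriv_r : ∀ p ∈ rect 0 R (-θ₀) θ₀,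
    HasDerivWithinAt (fun s => f (s, p.2)) (pr R f p) (Icc 0 R) p.1
  deriv_θ : ∀ p ∈ rect 0 R (-θ₀) θ₀,
    HasDerivWithinAt (fun t => f (p.1, t)) (pθ θ₀ f p) (Icc (-θ₀) θ₀) p.2
  deriv_rr : ∀ p ∈ rect 0 R (-θ₀) θ₀,
    HasDerivWithinAt (fun s => pr R f (s, p.2)) (pr R (pr R f) p) (Icc 0 R) p.1
  deriv_rθ : ∀ p ∈ rect 0 R (-θ₀) θ₀,
    HasDerivWithinAt (fun t => pr R f (p.1, t)) (pθ θ₀ (pr R f) p) (Icc (-θ₀) θ₀) p.2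
  deriv_θr : ∀ p ∈ rect 0 R (-θ₀) θ₀,
    HasDerivWithinAt (fun s => pθ θ₀ f (s, p.2)) (pθ θ₀ (pr R f) p) (Icc 0 R) p.1
  deriv_θθ : ∀ p ∈ rect 0 R (-θ₀) θ₀,
    HasDerivWithinAt (fun t => pθ θ₀ f (p.1, t)) (pθ θ₀ (pθ θ₀ f) p) (Icc (-θ₀) θ₀) p.2

theorem hasDerivWithinAt_slice_fst {a b c d : ℝ} {f : ℝ × ℝ → ℝ} {f' : ℝ × ℝ →L[ℝ] ℝ} {p : ℝ × ℝ}
    (h : HasFDerivWithinAt f f' (rect a b c d) p) (hp : p ∈ rect a b c d) :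
    HasDerivWithinAt (fun s => f (s, p.2)) (f' (1, 0)) (Icc a b) p.1 := by
  have h1 : HasDerivWithinAt (fun s : ℝ => (s, p.2)) ((1 : ℝ), (0 : ℝ)) (Icc a b) p.1 :=
    ((hasDerivAt_id p.1).prodMk (hasDerivAt_const p.1 p.2)).hasDerivWithinAt
  exact HasFDerivWithinAt.comp_hasDerivWithinAt p.1 (l := f) (f := fun s : ℝ => (s, p.2)) h h1
    fun s hs => ⟨hs, hp.2⟩

theorem hasDerivWithinAt_slice_snd {a b c d : ℝ} {f : ℝ × ℝ → ℝ} {f' : ℝ × ℝ →L[ℝ] ℝ} {p : ℝ × ℝ}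
    (h : HasFDerivWithinAt f f' (rect a b c d) p) (hp : p ∈ rect a b c d) :
    HasDerivWithinAt (fun t => f (p.1, t)) (f' (0, 1)) (Icc c d) p.2 := by
  have h1 : HasDerivWithinAt (fun t : ℝ => (p.1, t)) ((0 : ℝ), (1 : ℝ)) (Icc c d) p.2 :=
    ((hasDerivAt_const p.2 p.1).prodMk (hasDerivAt_id p.2)).hasDerivWithinAt
  exact HasFDerivWithinAt.comp_hasDerivWithinAt p.2 (l := f) (f := fun t : ℝ => (p.1, t)) h h1
    fun t ht => ⟨hp.1, ht⟩

/-- One-sided partial derivatives are the derivative within the rectangle applied to the basis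
vectors. The mixed ones agree up to the boundary, because the rectangle is the closure of its
interior. A single mixed derivative therefore serves in both orders. -/
theorem isC2_of_contDiffOn {R θ₀ : ℝ} (hR : 0 < R) (hθ : 0 < θ₀) {f : ℝ × ℝ → ℝ}
    (hf : ContDiffOn ℝ 2 f (closedDomain R θ₀)) : IsC2 R θ₀ f := by
  rw [closedDomain_eq_rect] at hf
  set Q := rect 0 R (-θ₀) θ₀ with hQ
  have hθ' : -θ₀ < θ₀ := by linarith
  have u1 : UniqueDiffOn ℝ (Icc 0 R) := uniqueDiffOn_Icc hR
  have u2 : UniqueDiffOn ℝ (Icc (-θ₀) θ₀) := uniqueDiffOn_Icc hθ'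
  have uQ : UniqueDiffOn ℝ Q := u1.prod u2
  have pr_eq : ∀ {g : ℝ × ℝ → ℝ}, DifferentiableOn ℝ g Q → ∀ p ∈ Q,
      pr R g p = fderivWithin ℝ g Q p (1, 0) := fun hg p hp =>
    (hasDerivWithinAt_slice_fst (hg p hp).hasFDerivWithinAt hp).derivWithin (u1 _ hp.1)
  have pθ_eq : ∀ {g : ℝ × ℝ → ℝ}, DifferentiableOn ℝ g Q → ∀ p ∈ Q,
      pθ θ₀ g p = fderivWithin ℝ g Q p (0, 1) := fun hg p hp =>
    (hasDerivWithinAt_slice_snd (hg p hp).hasFDerivWithinAt hp).derivWithin (u2 _ hp.2)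
  have dr' : ∀ {g : ℝ × ℝ → ℝ}, DifferentiableOn ℝ g Q → ∀ p ∈ Q,
      HasDerivWithinAt (fun s => g (s, p.2)) (pr R g p) (Icc 0 R) p.1 := fun hg p hp => by
    rw [pr_eq hg p hp]; exact hasDerivWithinAt_slice_fst (hg p hp).hasFDerivWithinAt hp
  have dθ' : ∀ {g : ℝ × ℝ → ℝ}, DifferentiableOn ℝ g Q → ∀ p ∈ Q,
      HasDerivWithinAt (fun t => g (p.1, t)) (pθ θ₀ g p) (Icc (-θ₀) θ₀) p.2 := fun hg p hp => by
    rw [pθ_eq hg p hp]; exact hasDerivWithinAt_slice_snd (hg p hp).hasFDerivWithinAt hp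
  have c1 : ∀ {g : ℝ × ℝ → ℝ} {n : ℕ∞ω}, ContDiffOn ℝ (n + 1) g Q → ContDiffOn ℝ n (pr R g) Q :=
    fun {g n} hg => ((hg.fderivWithin uQ le_rfl).clm_apply
      (contDiffOn_const (c := ((1 : ℝ), (0 : ℝ))))).congr
      (pr_eq (hg.differentiableOn (by simp)))
  have c2 : ∀ {g : ℝ × ℝ → ℝ} {n : ℕ∞ω}, ContDiffOn ℝ (n + 1) g Q → ContDiffOn ℝ n (pθ θ₀ g) Q :=
    fun {g n} hg => ((hg.fderivWithin uQ le_rfl).clm_apply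
      (contDiffOn_const (c := ((0 : ℝ), (1 : ℝ))))).congr
      (pθ_eq (hg.differentiableOn (by simp)))
  have f2 : ContDiffOn ℝ (1 + 1) f Q := by rw [one_add_one_eq_two]; exact hf
  have fr1 : ContDiffOn ℝ (0 + 1) (pr R f) Q := by rw [zero_add]; exact c1 f2
  have fθ1 : ContDiffOn ℝ (0 + 1) (pθ θ₀ f) Q := by rw [zero_add]; exact c2 f2
  have df := f2.differentiableOn (by simp)
  have dfr := fr1.differentiableOn (by simp)
  have dfθ := fθ1.differentiableOn (by simp)
  have hint : closure (interior Q) = Q := by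
    rw [hQ, rect, interior_prod_eq, interior_Icc, interior_Icc, closure_prod_eq,
      closure_Ioo hR.ne, closure_Ioo hθ'.ne]
  have symm : ∀ p ∈ Q, pr R (pθ θ₀ f) p = pθ θ₀ (pr R f) p := by
    intro p hp
    have hs := (hf p hp).isSymmSndFDerivWithinAt (by simp) uQ (by rw [hint]; exact hp) hp
    have hd : DifferentiableWithinAt ℝ (fderivWithin ℝ f Q) Q p :=
      (f2.fderivWithin uQ le_rfl).differentiableOn (by simp) p hp
    rw [pr_eq dfθ p hp, pθ_eq dfr p hp, fderivWithin_congr (pθ_eq df) (pθ_eq df p hp),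
      fderivWithin_congr (pr_eq df) (pr_eq df p hp),
      fderivWithin_clm_apply (uQ p hp) hd (differentiableWithinAt_const _),
      fderivWithin_clm_apply (uQ p hp) hd (differentiableWithinAt_const _)]
    simp only [fderivWithin_fun_const, Pi.zero_apply, ContinuousLinearMap.comp_zero, zero_add,
      ContinuousLinearMap.flip_apply]
    exact hs.eq _ _
  exact {
    cont := hf.continuousOn
    cont_r := fr1.continuousOn
    cont_θ := fθ1.continuousOn
    cont_rr := (c1 fr1).continuousOn
    cont_rθ := (c2 fr1).continuousOn
    cont_θθ := (c2 fθ1).continuousOn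
    deriv_r := dr' df
    deriv_θ := dθ' df
    deriv_rr := dr' dfr
    deriv_rθ := dθ' dfr
    deriv_θr := fun p hp => by rw [← symm p hp]; exact dr' dfθ p hp
    deriv_θθ := dθ' dfθ }

end EulerPoisson
end

/-! ### The energy estimates for the elliptic and the hyperbolic equation. -/

noncomputable section
namespace EulerPoisson

theorem intervalIntegral_eq_zero_of_Ioo {c d : ℝ} (hcd : c ≤ d) {f : ℝ → ℝ}
    (hf : ∀ t ∈ Ioo c d, f t = 0) : ∫ t in c..d, f t = 0 := by
  rw [intervalIntegral.integral_of_le hcd, integral_Ioc_eq_integral_Ioo]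
  exact setIntegral_eq_zero_of_forall_eq_zero hf

theorem integral_rect_mono {a b c d : ℝ} {f g : ℝ × ℝ → ℝ} (hf : ContinuousOn f (rect a b c d))
    (hg : ContinuousOn g (rect a b c d)) (h : ∀ p ∈ rect a b c d, f p ≤ g p) :
    ∫ p in rect a b c d, f p ≤ ∫ p in rect a b c d, g p :=
  setIntegral_mono_on (ContinuousOn.integrableOn_rect hf) (ContinuousOn.integrableOn_rect hg)
    (isCompact_rect a b c d).measurableSet h

theorem integral_rect_nonneg {a b c d : ℝ} {f : ℝ × ℝ → ℝ} (h : ∀ p, 0 ≤ f p) :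
    0 ≤ ∫ p in rect a b c d, f p := integral_nonneg h

theorem integral_rect_add {a b c d : ℝ} {f g : ℝ × ℝ → ℝ} (hf : ContinuousOn f (rect a b c d))
    (hg : ContinuousOn g (rect a b c d)) :
    ∫ p in rect a b c d, (f p + g p) = (∫ p in rect a b c d, f p) + ∫ p in rect a b c d, g p :=
  integral_add (ContinuousOn.integrableOn_rect hf) (ContinuousOn.integrableOn_rect hg)

theorem integral_rect_sub {a b c d : ℝ} {f g : ℝ × ℝ → ℝ} (hf : ContinuousOn f (rect a b c d))
    (hg : ContinuousOn g (rect a b c d)) :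
    ∫ p in rect a b c d, (f p - g p) = (∫ p in rect a b c d, f p) - ∫ p in rect a b c d, g p :=
  integral_sub (ContinuousOn.integrableOn_rect hf) (ContinuousOn.integrableOn_rect hg)

/-- The divergence theorem in the first variable, for functions with vanishing flux. -/
theorem integral_deriv_fst_eq_zero {a b c d : ℝ} (hab : a ≤ b) (hcd : c ≤ d) {G G' : ℝ × ℝ → ℝ}
    (hG : ∀ p ∈ rect a b c d, HasDerivWithinAt (fun s => G (s, p.2)) (G' p) (Icc a b) p.1)
    (hGc : ContinuousOn G (rect a b c d)) (hG' : ContinuousOn G' (rect a b c d))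
    (hb : ∀ t ∈ Ioo c d, G (b, t) - G (a, t) = 0) : ∫ p in rect a b c d, G' p = 0 := by
  -- The weight is the constant 1, with Lipschitz constant 0, so the remainder disappears.
  have h := abs_integral_lipschitz_mul_deriv_fst_sub_le hab hcd le_rfl (u := fun _ => 1)
    (by simp) hG hGc hG'
  simp only [one_mul] at h
  rw [intervalIntegral_eq_zero_of_Ioo hcd hb] at h
  simpa using h

/-- The divergence theorem in the second variable, for functions with vanishing flux. -/
theorem integral_deriv_snd_eq_zero {a b c d : ℝ} (hab : a ≤ b) (hcd : c ≤ d) {G G' : ℝ × ℝ → ℝ}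
    (hG : ∀ p ∈ rect a b c d, HasDerivWithinAt (fun t => G (p.1, t)) (G' p) (Icc c d) p.2)
    (hGc : ContinuousOn G (rect a b c d)) (hG' : ContinuousOn G' (rect a b c d))
    (hb : ∀ s ∈ Ioo a b, G (s, d) - G (s, c) = 0) : ∫ p in rect a b c d, G' p = 0 := by
  have h := abs_integral_lipschitz_mul_deriv_snd_sub_le hab hcd le_rfl (u := fun _ => 1)
    (by simp) hG hGc hG'
  simp only [one_mul] at h
  rw [intervalIntegral_eq_zero_of_Ioo hab hb] at h
  simpa using h

/-- The Poincaré inequality on a rectangle of width `R`, for functions that vanish on the side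
opposite to `r = c`. -/
theorem integral_sq_le_sq_mul_integral_deriv_sq {R c d e : ℝ} (hR : 0 ≤ R) (hde : d ≤ e)
    (hc : ∀ s ∈ Icc 0 R, |s - c| ≤ R) {f fr : ℝ × ℝ → ℝ}
    (hf : ∀ p ∈ rect 0 R d e, HasDerivWithinAt (fun s => f (s, p.2)) (fr p) (Icc 0 R) p.1)
    (hfc : ContinuousOn f (rect 0 R d e)) (hfr : ContinuousOn fr (rect 0 R d e))
    (hb : ∀ t ∈ Ioo d e, f (R, t) ^ 2 * (R - c) - f (0, t) ^ 2 * (0 - c) = 0) :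
    ∫ p in rect 0 R d e, f p ^ 2 ≤ 4 * R ^ 2 * ∫ p in rect 0 R d e, fr p ^ 2 := by
  have c1 : ContinuousOn (fun p => 2 * f p * fr p * (p.1 - c)) (rect 0 R d e) := by fun_prop
  have c2 : ContinuousOn (fun p => f p ^ 2) (rect 0 R d e) := by fun_prop
  -- The flux of `f² (r - c)` vanishes on both sides, so `∫ f² = -∫ 2 f f_r (r - c)`. Young's
  -- inequality then absorbs half of `∫ f²`.
  have h0 : ∫ p in rect 0 R d e, (2 * f p * fr p * (p.1 - c) + f p ^ 2) = 0 := by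
    apply integral_deriv_fst_eq_zero hR hde (G := fun p => f p ^ 2 * (p.1 - c))
    · intro p hp
      have h1 := ((hf p hp).pow 2).mul (((hasDerivAt_id p.1).sub_const c).hasDerivWithinAt)
      refine h1.congr_deriv ?_
      simp
    · fun_prop
    · exact c1.add c2
    · exact hb
  rw [integral_rect_add c1 c2] at h0
  have h1 : -∫ p in rect 0 R d e, 2 * f p * fr p * (p.1 - c)
      ≤ ∫ p in rect 0 R d e, (1 / 2 * f p ^ 2 + 2 * R ^ 2 * fr p ^ 2) := by
    rw [← integral_neg]
    apply integral_rect_mono c1.neg (by fun_prop)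
    intro p hp
    have hw := hc p.1 hp.1
    simp only [Pi.neg_apply]
    have hw2 : (p.1 - c) ^ 2 ≤ R ^ 2 := sq_le_sq' (by linarith [(abs_le.1 hw).1]) (abs_le.1 hw).2
    nlinarith [sq_nonneg (f p + 2 * (fr p * (p.1 - c))), mul_le_mul_of_nonneg_left hw2
      (sq_nonneg (fr p))]
  rw [integral_rect_add (by fun_prop) (by fun_prop), integral_const_mul, integral_const_mul] at h1
  linarith

variable {R θ₀ : ℝ} {φ Ψ : ℝ × ℝ → ℝ}

/-- The energy estimate for the elliptic equation. -/
theorem elliptic_energy (hR : 0 < R) (hθ : 0 < θ₀) (hφ : IsC2 R θ₀ φ) (hΨ : IsC2 R θ₀ Ψ)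
    {M : ℝ} (hM : 1 ≤ M) (hRM : 48 * M ^ 2 * R ^ 2 ≤ 1) {e : ℝ → ℝ} {k c₁ c₂ f : ℝ × ℝ → ℝ}
    (he : ContinuousOn e (Icc 0 R)) (hf : ContinuousOn f (rect 0 R (-θ₀) θ₀))
    (bk : ∀ p ∈ rect 0 R (-θ₀) θ₀, |k p| ≤ M) (b₁ : ∀ p ∈ rect 0 R (-θ₀) θ₀, |c₁ p| ≤ M)
    (b₂ : ∀ p ∈ rect 0 R (-θ₀) θ₀, |c₂ p| ≤ M)
    (eqn : ∀ p ∈ rect 0 R (-θ₀) θ₀, pr R (pr R Ψ) p + e p.1 * pθ θ₀ (pθ θ₀ Ψ) p + k p * pr R Ψ p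
      + c₁ p * pr R φ p + c₂ p * Ψ p = f p)
    (hin : ∀ t ∈ Ioo (-θ₀) θ₀, pr R Ψ (0, t) = 0) (hex : ∀ t ∈ Ioo (-θ₀) θ₀, Ψ (R, t) = 0)
    (hw : ∀ s ∈ Ioo 0 R, pθ θ₀ Ψ (s, θ₀) = 0 ∧ pθ θ₀ Ψ (s, -θ₀) = 0) :
    (∫ p in rect 0 R (-θ₀) θ₀, Ψ p ^ 2)
        ≤ 4 * R ^ 2 * ∫ p in rect 0 R (-θ₀) θ₀, pr R Ψ p ^ 2 ∧
    1 / 2 * (∫ p in rect 0 R (-θ₀) θ₀, pr R Ψ p ^ 2)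
        + (∫ p in rect 0 R (-θ₀) θ₀, e p.1 * pθ θ₀ Ψ p ^ 2)
      ≤ (∫ p in rect 0 R (-θ₀) θ₀, f p ^ 2) + ∫ p in rect 0 R (-θ₀) θ₀, pr R φ p ^ 2 := by
  have hθ' : -θ₀ ≤ θ₀ := by linarith
  have k0 := hΨ.cont
  have k1 := hΨ.cont_r
  have k2 := hΨ.cont_θ
  have k3 := hΨ.cont_rr
  have k4 := hΨ.cont_θθ
  have k5 := hφ.cont_r
  have ke : ContinuousOn (fun p : ℝ × ℝ => e p.1) (rect 0 R (-θ₀) θ₀) :=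
    he.comp continuousOn_fst fun p hp => hp.1
  have poin := integral_sq_le_sq_mul_integral_deriv_sq (c := 0) hR.le hθ'
    (fun s hs => by rw [sub_zero, abs_of_nonneg hs.1]; exact hs.2) hΨ.deriv_r k0 k1
    (fun t ht => by rw [hex t ht]; ring)
  refine ⟨poin, ?_⟩
  have i1 : ∫ p in rect 0 R (-θ₀) θ₀, (pr R Ψ p ^ 2 + Ψ p * pr R (pr R Ψ) p) = 0 := by
    apply integral_deriv_fst_eq_zero hR.le hθ' (G := fun p => Ψ p * pr R Ψ p) _ (by fun_prop)
      (by fun_prop)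
    · intro t ht
      simp only [hin t ht, hex t ht]; ring
    · intro p hp
      refine ((hΨ.deriv_r p hp).mul (hΨ.deriv_rr p hp)).congr_deriv ?_
      ring
  have i2 : ∫ p in rect 0 R (-θ₀) θ₀,
      (e p.1 * pθ θ₀ Ψ p ^ 2 + e p.1 * (Ψ p * pθ θ₀ (pθ θ₀ Ψ) p)) = 0 := by
    apply integral_deriv_snd_eq_zero hR.le hθ' (G := fun p => e p.1 * (Ψ p * pθ θ₀ Ψ p)) _
      (ke.mul (k0.mul k2)) ((ke.mul (k2.pow 2)).add (ke.mul (k0.mul k4)))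
    · intro s hs
      simp only [(hw s hs).1, (hw s hs).2]; ring
    · intro p hp
      refine (((hΨ.deriv_θ p hp).mul (hΨ.deriv_θθ p hp)).const_mul (e p.1)).congr_deriv ?_
      simp only [Prod.mk.eta, Pi.add_apply, Pi.mul_apply, Pi.pow_apply]; ring
  have cA : ContinuousOn (fun p => pr R Ψ p ^ 2) (rect 0 R (-θ₀) θ₀) := by fun_prop
  have cB : ContinuousOn (fun p => Ψ p * pr R (pr R Ψ) p) (rect 0 R (-θ₀) θ₀) := by fun_prop
  have cC : ContinuousOn (fun p => e p.1 * pθ θ₀ Ψ p ^ 2) (rect 0 R (-θ₀) θ₀) :=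
    ke.mul (k2.pow 2)
  have cD : ContinuousOn (fun p => e p.1 * (Ψ p * pθ θ₀ (pθ θ₀ Ψ) p)) (rect 0 R (-θ₀) θ₀) :=
    ke.mul (k0.mul k4)
  rw [integral_rect_add cA cB] at i1
  rw [integral_rect_add cC cD] at i2
  have i3 : -∫ p in rect 0 R (-θ₀) θ₀, (Ψ p * pr R (pr R Ψ) p + e p.1 * (Ψ p * pθ θ₀ (pθ θ₀ Ψ) p))
      ≤ ∫ p in rect 0 R (-θ₀) θ₀, (1 / 4 * pr R Ψ p ^ 2 + f p ^ 2 + pr R φ p ^ 2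
        + 3 * M ^ 2 * Ψ p ^ 2) := by
    rw [← integral_neg]
    apply integral_rect_mono (cB.add cD).neg (by fun_prop)
    intro p hp
    -- The second-order terms are eliminated through the equation, and Young's inequality is applied
    -- to each product. The resulting coefficient of `Ψ²` is at most `1/4 + M² + M²/4 + M² ≤ 3 M²`.
    have e1 : -(Ψ p * pr R (pr R Ψ) p + e p.1 * (Ψ p * pθ θ₀ (pθ θ₀ Ψ) p))
        = -(Ψ p * f p) + k p * Ψ p * pr R Ψ p + c₁ p * Ψ p * pr R φ p + c₂ p * Ψ p ^ 2 := by
      rw [← eqn p hp]; ring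
    simp only [Pi.neg_apply, Pi.add_apply]
    rw [e1]
    have hk2 : k p ^ 2 ≤ M ^ 2 := sq_le_sq' (by linarith [(abs_le.1 (bk p hp)).1])
      (abs_le.1 (bk p hp)).2
    have h12 : c₁ p ^ 2 ≤ M ^ 2 := sq_le_sq' (by linarith [(abs_le.1 (b₁ p hp)).1])
      (abs_le.1 (b₁ p hp)).2
    have h22 : c₂ p ≤ M ^ 2 := (abs_le.1 (b₂ p hp)).2.trans (by nlinarith)
    have hM1 : 1 ≤ M ^ 2 := by nlinarith
    have q := sq_nonneg (Ψ p)
    nlinarith [sq_nonneg (Ψ p / 2 + f p), sq_nonneg (k p * Ψ p - pr R Ψ p / 2),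
      sq_nonneg (c₁ p * Ψ p / 2 - pr R φ p), mul_le_mul_of_nonneg_right hk2 q,
      mul_le_mul_of_nonneg_right h12 q, mul_le_mul_of_nonneg_right h22 q,
      mul_le_mul_of_nonneg_right hM1 q]
  rw [integral_rect_add cB cD, integral_rect_add (by fun_prop) (by fun_prop),
    integral_rect_add (by fun_prop) (by fun_prop), integral_rect_add (by fun_prop) (by fun_prop),
    integral_const_mul, integral_const_mul] at i3
  have hX : 0 ≤ ∫ p in rect 0 R (-θ₀) θ₀, pr R Ψ p ^ 2 := integral_rect_nonneg fun p => sq_nonneg _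
  -- Poincaré's inequality turns this into `12 M² R² ∫ Ψ_r²`. The condition `48 M² R² ≤ 1` is chosen
  -- to make that a quarter of `∫ Ψ_r²`.
  have i4 : 3 * M ^ 2 * ∫ p in rect 0 R (-θ₀) θ₀, Ψ p ^ 2
      ≤ 1 / 4 * ∫ p in rect 0 R (-θ₀) θ₀, pr R Ψ p ^ 2 := by
    calc _ ≤ 3 * M ^ 2 * (4 * R ^ 2 * ∫ p in rect 0 R (-θ₀) θ₀, pr R Ψ p ^ 2) := by gcongr
      _ = 1 / 4 * ((48 * M ^ 2 * R ^ 2) * ∫ p in rect 0 R (-θ₀) θ₀, pr R Ψ p ^ 2) := by ring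
      _ ≤ 1 / 4 * (1 * ∫ p in rect 0 R (-θ₀) θ₀, pr R Ψ p ^ 2) := by gcongr
      _ = _ := by ring
  linarith

/-- Here `w` is the weight `R - r`, and `x, y, z, u` stand for `φ_r, φ_θ, Ψ, Ψ_r`. The factor `R`
from the weight is what makes these terms small. -/
theorem lower_order_le {R M w x y z u f a₁ a₂ b₁ b₂ : ℝ} (w0 : 0 ≤ w) (w1 : w ≤ R) (hM : 1 ≤ M)
    (m₁ : |a₁| ≤ M) (m₂ : |a₂| ≤ M) (n₁ : |b₁| ≤ M) (n₂ : |b₂| ≤ M) :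
    -(w * x * (f - a₁ * x - a₂ * y - b₁ * z - b₂ * u))
      ≤ R * M * (3 * x ^ 2 + y ^ 2 + z ^ 2 + u ^ 2 + f ^ 2) := by
  have young : ∀ a v : ℝ, |a| ≤ M → a * x * v ≤ M * (x ^ 2 / 2 + v ^ 2 / 2) := by
    intro a v ha
    calc a * x * v ≤ |a * x * v| := le_abs_self _
      _ = |a| * |x * v| := by rw [mul_assoc, abs_mul]
      _ ≤ M * (x ^ 2 / 2 + v ^ 2 / 2) := by
        gcongr
        rw [abs_le]
        constructor <;> nlinarith [sq_nonneg (x + v), sq_nonneg (x - v)]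
  have y0 := young (-1) f (by simpa using hM)
  have y1 := young a₁ x m₁
  have y2 := young a₂ y m₂
  have y3 := young b₁ z n₁
  have y4 := young b₂ u n₂
  have hsum : 0 ≤ M * (y ^ 2 / 2 + z ^ 2 / 2 + u ^ 2 / 2 + f ^ 2 / 2) := by positivity
  calc _ = w * (-1 * x * f + a₁ * x * x + a₂ * x * y + b₁ * x * z + b₂ * x * u) := by ring
    _ ≤ w * (M * (3 * x ^ 2 + y ^ 2 + z ^ 2 + u ^ 2 + f ^ 2)) := by
        gcongr
        linarith
    _ ≤ R * (M * (3 * x ^ 2 + y ^ 2 + z ^ 2 + u ^ 2 + f ^ 2)) := by gcongr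
    _ = _ := by ring

set_option maxHeartbeats 800000 in
/-- The energy estimate for the hyperbolic equation, with the multiplier `(R - r) ∂_r φ`. -/
theorem hyperbolic_energy (hR : 0 < R) (hθ : 0 < θ₀) (hφ : IsC2 R θ₀ φ) (hΨ : IsC2 R θ₀ Ψ)
    {L M : ℝ} (hL : 0 ≤ L) (hM : 0 ≤ M) {a₁₁ a₂₂ a₁₂ a₁ a₂ b₁ b₂ f : ℝ × ℝ → ℝ}
    (l₁₁ : LipschitzOnWith L.toNNReal a₁₁ (rect 0 R (-θ₀) θ₀))
    (l₂₂ : LipschitzOnWith L.toNNReal a₂₂ (rect 0 R (-θ₀) θ₀))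
    (l₁₂ : LipschitzOnWith L.toNNReal a₁₂ (rect 0 R (-θ₀) θ₀))
    (hf : ContinuousOn f (rect 0 R (-θ₀) θ₀))
    (m₁₁ : ∀ p ∈ rect 0 R (-θ₀) θ₀, |a₁₁ p| ≤ M)
    (m₁ : ∀ p ∈ rect 0 R (-θ₀) θ₀, |a₁ p| ≤ M) (m₂ : ∀ p ∈ rect 0 R (-θ₀) θ₀, |a₂ p| ≤ M)
    (n₁ : ∀ p ∈ rect 0 R (-θ₀) θ₀, |b₁ p| ≤ M) (n₂ : ∀ p ∈ rect 0 R (-θ₀) θ₀, |b₂ p| ≤ M)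
    (n₃ : 1 ≤ M)
    (eqn : ∀ p ∈ rect 0 R (-θ₀) θ₀, a₁₁ p * pr R (pr R φ) p + a₂₂ p * pθ θ₀ (pθ θ₀ φ) p
      + 2 * a₁₂ p * pθ θ₀ (pr R φ) p + a₁ p * pr R φ p + a₂ p * pθ θ₀ φ p + b₁ p * Ψ p
      + b₂ p * pr R Ψ p = f p)
    (a₁₂w : ∀ s ∈ Ioo 0 R, a₁₂ (s, θ₀) = 0 ∧ a₁₂ (s, -θ₀) = 0)
    (hin : ∀ t ∈ Ioo (-θ₀) θ₀, pθ θ₀ φ (0, t) = 0)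
    (hw : ∀ s ∈ Ioo 0 R, pθ θ₀ φ (s, θ₀) = 0 ∧ pθ θ₀ φ (s, -θ₀) = 0) :
    ∫ p in rect 0 R (-θ₀) θ₀, (-a₁₁ p / 2 * pr R φ p ^ 2 + a₂₂ p / 2 * pθ θ₀ φ p ^ 2)
      ≤ R * M * (∫ t in (-θ₀)..θ₀, pr R φ (0, t) ^ 2)
        + R * (2 * L + 3 * M) * ((∫ p in rect 0 R (-θ₀) θ₀, pr R φ p ^ 2)
          + (∫ p in rect 0 R (-θ₀) θ₀, pθ θ₀ φ p ^ 2) + (∫ p in rect 0 R (-θ₀) θ₀, Ψ p ^ 2)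
          + (∫ p in rect 0 R (-θ₀) θ₀, pr R Ψ p ^ 2) + ∫ p in rect 0 R (-θ₀) θ₀, f p ^ 2) := by
  have hθ' : -θ₀ ≤ θ₀ := by linarith
  set Q := rect 0 R (-θ₀) θ₀ with hQ
  have k0 : ContinuousOn (pr R φ) Q := hφ.cont_r
  have k1 : ContinuousOn (pθ θ₀ φ) Q := hφ.cont_θ
  have k2 : ContinuousOn (pr R (pr R φ)) Q := hφ.cont_rr
  have k3 : ContinuousOn (pθ θ₀ (pr R φ)) Q := hφ.cont_rθ
  have k4 : ContinuousOn (pθ θ₀ (pθ θ₀ φ)) Q := hφ.cont_θθ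
  have k5 : ContinuousOn Ψ Q := hΨ.cont
  have k6 : ContinuousOn (pr R Ψ) Q := hΨ.cont_r
  have c11 := l₁₁.continuousOn
  have c22 := l₂₂.continuousOn
  have c12 := l₁₂.continuousOn
  have hdw : ∀ p : ℝ × ℝ, HasDerivWithinAt (fun s : ℝ => R - s) (-1) (Icc 0 R) p.1 := fun p =>
    ((hasDerivAt_id p.1).const_sub R).hasDerivWithinAt
  -- With `w = R - r`, the products `w φ_r φ_rr`, `w φ_r φ_θθ` and `2 w φ_r φ_rθ` are derivatives up
  -- to correction: `T1` treats the first, `T2` and `T3` the second, and `T4` the third. `T3` is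
  -- needed because moving a `θ`-derivative from `φ_θθ` leaves `w φ_θ φ_rθ`, itself an
  -- `r`-derivative up to a term without `w`.
  have T1 := abs_integral_lipschitz_mul_deriv_fst_sub_le (a := 0) (b := R) (c := -θ₀) (d := θ₀)
    hR.le hθ' hL (u := a₁₁) (G := fun p => (R - p.1) * (pr R φ p ^ 2 / 2))
    (G' := fun p => -(pr R φ p ^ 2 / 2) + (R - p.1) * (pr R φ p * pr R (pr R φ) p)) l₁₁
    (fun p hp => by
      refine ((hdw p).mul (((hφ.deriv_rr p hp).pow 2).div_const 2)).congr_deriv ?_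
      simp only [Pi.pow_apply, Prod.mk.eta, Nat.cast_ofNat, Nat.add_one_sub_one, pow_one]
      ring) (by fun_prop) (by fun_prop)
  have T2 := abs_integral_lipschitz_mul_deriv_snd_sub_le (a := 0) (b := R) (c := -θ₀) (d := θ₀)
    hR.le hθ' hL (u := a₂₂) (G := fun p => (R - p.1) * (pr R φ p * pθ θ₀ φ p))
    (G' := fun p => (R - p.1) * (pθ θ₀ (pr R φ) p * pθ θ₀ φ p + pr R φ p * pθ θ₀ (pθ θ₀ φ) p)) l₂₂
    (fun p hp => ((hφ.deriv_rθ p hp).mul (hφ.deriv_θθ p hp)).const_mul (R - p.1))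
    (by fun_prop) (by fun_prop)
  have T3 := abs_integral_lipschitz_mul_deriv_fst_sub_le (a := 0) (b := R) (c := -θ₀) (d := θ₀)
    hR.le hθ' hL (u := a₂₂) (G := fun p => (R - p.1) * (pθ θ₀ φ p ^ 2 / 2))
    (G' := fun p => -(pθ θ₀ φ p ^ 2 / 2) + (R - p.1) * (pθ θ₀ φ p * pθ θ₀ (pr R φ) p)) l₂₂
    (fun p hp => by
      refine ((hdw p).mul (((hφ.deriv_θr p hp).pow 2).div_const 2)).congr_deriv ?_
      simp only [Pi.pow_apply, Prod.mk.eta, Nat.cast_ofNat, Nat.add_one_sub_one, pow_one]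
      ring) (by fun_prop) (by fun_prop)
  have T4 := abs_integral_lipschitz_mul_deriv_snd_sub_le (a := 0) (b := R) (c := -θ₀) (d := θ₀)
    hR.le hθ' hL (u := a₁₂) (G := fun p => (R - p.1) * pr R φ p ^ 2)
    (G' := fun p => (R - p.1) * (2 * pr R φ p * pθ θ₀ (pr R φ) p)) l₁₂
    (fun p hp => by
      refine (((hφ.deriv_rθ p hp).pow 2).const_mul (R - p.1)).congr_deriv ?_
      simp)
    (by fun_prop) (by fun_prop)
  rw [← hQ] at T1 T2 T3 T4
  -- The fluxes vanish for three reasons: `φ_θ = 0` on the walls for `T2`; the weight at the exit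
  -- and `φ_θ = 0` at the entrance for `T3`; `a₁₂ = 0` on the walls for `T4`.
  rw [intervalIntegral_eq_zero_of_Ioo hR.le (fun s hs => by
    simp only [(hw s hs).1, (hw s hs).2]; ring), sub_zero] at T2
  rw [intervalIntegral_eq_zero_of_Ioo hθ' (fun t ht => by
    simp only [hin t ht]; ring), sub_zero] at T3
  rw [intervalIntegral_eq_zero_of_Ioo hR.le (fun s hs => by
    simp only [(a₁₂w s hs).1, (a₁₂w s hs).2]; ring), sub_zero] at T4
  have hwb : ∀ p ∈ Q, 0 ≤ R - p.1 ∧ R - p.1 ≤ R := fun p hp =>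
    ⟨by linarith [hp.1.2], by linarith [hp.1.1]⟩
  set P := ∫ p in Q, pr R φ p ^ 2 with hP
  set T := ∫ p in Q, pθ θ₀ φ p ^ 2 with hT
  have g1 : ∫ p in Q, |(R - p.1) * (pr R φ p ^ 2 / 2)| ≤ R / 2 * P := by
    rw [hP, ← integral_const_mul]
    refine integral_rect_mono (ContinuousOn.abs (by fun_prop)) (by fun_prop) fun p hp => ?_
    obtain ⟨w0, w1⟩ := hwb p hp
    rw [abs_of_nonneg (by positivity)]
    nlinarith [mul_le_mul_of_nonneg_right w1 (sq_nonneg (pr R φ p))]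
  have g2 : ∫ p in Q, |(R - p.1) * (pr R φ p * pθ θ₀ φ p)| ≤ R / 2 * P + R / 2 * T := by
    rw [hP, hT, ← integral_const_mul, ← integral_const_mul,
      ← integral_rect_add (by fun_prop) (by fun_prop)]
    refine integral_rect_mono (ContinuousOn.abs (by fun_prop)) (by fun_prop) fun p hp => ?_
    obtain ⟨w0, w1⟩ := hwb p hp
    rw [abs_mul, abs_of_nonneg w0, ← mul_add]
    have h1 : |pr R φ p * pθ θ₀ φ p| ≤ (pr R φ p ^ 2 + pθ θ₀ φ p ^ 2) / 2 := by
      rw [abs_le]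
      constructor <;> nlinarith [sq_nonneg (pr R φ p + pθ θ₀ φ p),
        sq_nonneg (pr R φ p - pθ θ₀ φ p)]
    calc _ ≤ R * ((pr R φ p ^ 2 + pθ θ₀ φ p ^ 2) / 2) := by gcongr
      _ = _ := by ring
  have g3 : ∫ p in Q, |(R - p.1) * (pθ θ₀ φ p ^ 2 / 2)| ≤ R / 2 * T := by
    rw [hT, ← integral_const_mul]
    refine integral_rect_mono (ContinuousOn.abs (by fun_prop)) (by fun_prop) fun p hp => ?_
    obtain ⟨w0, w1⟩ := hwb p hp
    rw [abs_of_nonneg (by positivity)]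
    nlinarith [mul_le_mul_of_nonneg_right w1 (sq_nonneg (pθ θ₀ φ p))]
  have g4 : ∫ p in Q, |(R - p.1) * pr R φ p ^ 2| ≤ R * P := by
    rw [hP, ← integral_const_mul]
    refine integral_rect_mono (ContinuousOn.abs (by fun_prop)) (by fun_prop) fun p hp => ?_
    obtain ⟨w0, w1⟩ := hwb p hp
    rw [abs_of_nonneg (by positivity)]
    gcongr
  have k0s : ContinuousOn (fun t => pr R φ (0, t)) (Icc (-θ₀) θ₀) :=
    continuousOn_slice_right k0 (left_mem_Icc.2 hR.le)
  have c11s : ContinuousOn (fun t => a₁₁ (0, t)) (Icc (-θ₀) θ₀) :=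
    continuousOn_slice_right c11 (left_mem_Icc.2 hR.le)
  -- The only surviving boundary term: the exit part is killed by the weight, and the entrance part
  -- is controlled by the datum.
  have bd : ∫ t in (-θ₀)..θ₀, (a₁₁ (R, t) * ((R - R) * (pr R φ (R, t) ^ 2 / 2))
        - a₁₁ (0, t) * ((R - 0) * (pr R φ (0, t) ^ 2 / 2)))
      ≤ R * M * (∫ t in (-θ₀)..θ₀, pr R φ (0, t) ^ 2) := by
    rw [← intervalIntegral.integral_const_mul]
    have e0 : ∀ t, a₁₁ (R, t) * ((R - R) * (pr R φ (R, t) ^ 2 / 2))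
        - a₁₁ (0, t) * ((R - 0) * (pr R φ (0, t) ^ 2 / 2))
        = - a₁₁ (0, t) * (R * (pr R φ (0, t) ^ 2 / 2)) := fun t => by ring
    simp only [e0]
    apply intervalIntegral.integral_mono_on hθ'
    · exact ContinuousOn.intervalIntegrable_of_Icc hθ'
        (c11s.neg.mul (((k0s.pow 2).div_const 2).const_smul R))
    · exact ContinuousOn.intervalIntegrable_of_Icc hθ' ((k0s.pow 2).const_smul (R * M))
    intro t ht
    have hm := (abs_le.1 (m₁₁ (0, t) ⟨left_mem_Icc.2 hR.le, ht⟩)).1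
    have : 0 ≤ R * (pr R φ (0, t) ^ 2 / 2) := by positivity
    calc _ ≤ M * (R * (pr R φ (0, t) ^ 2 / 2)) := by gcongr; linarith
      _ ≤ _ := by nlinarith [mul_nonneg hM this]
  set S := R * M with hS
  have lower : -∫ p in Q, (R - p.1) * pr R φ p * (f p - a₁ p * pr R φ p - a₂ p * pθ θ₀ φ p
        - b₁ p * Ψ p - b₂ p * pr R Ψ p)
      ≤ S * (3 * P + T + (∫ p in Q, Ψ p ^ 2) + (∫ p in Q, pr R Ψ p ^ 2) + ∫ p in Q, f p ^ 2) := by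
    have e0 : S * (3 * P + T + (∫ p in Q, Ψ p ^ 2) + (∫ p in Q, pr R Ψ p ^ 2) + ∫ p in Q, f p ^ 2)
        = ∫ p in Q, S * (3 * pr R φ p ^ 2 + pθ θ₀ φ p ^ 2 + Ψ p ^ 2 + pr R Ψ p ^ 2 + f p ^ 2) := by
      rw [integral_const_mul, integral_rect_add (by fun_prop) (by fun_prop),
        integral_rect_add (by fun_prop) (by fun_prop),
        integral_rect_add (by fun_prop) (by fun_prop),
        integral_rect_add (by fun_prop) (by fun_prop), integral_const_mul]
    rw [e0, ← integral_neg]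
    -- The lower-order coefficients are only assumed bounded, so the continuity of this integrand is
    -- read off from the second-order side of the equation.
    have e1 : ∀ p ∈ Q, (R - p.1) * pr R φ p * (f p - a₁ p * pr R φ p - a₂ p * pθ θ₀ φ p
        - b₁ p * Ψ p - b₂ p * pr R Ψ p) = (R - p.1) * pr R φ p *
        (a₁₁ p * pr R (pr R φ) p + a₂₂ p * pθ θ₀ (pθ θ₀ φ) p + 2 * a₁₂ p * pθ θ₀ (pr R φ) p) := by
      intro p hp; rw [← eqn p hp]; ring
    refine integral_rect_mono (ContinuousOn.congr (ContinuousOn.neg (by fun_prop))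
      fun p hp => congrArg Neg.neg (e1 p hp)) (by fun_prop) fun p hp => ?_
    obtain ⟨w0, w1⟩ := hwb p hp
    exact lower_order_le w0 w1 n₃ (m₁ p hp) (m₂ p hp) (n₁ p hp) (n₂ p hp)
  -- A pointwise identity: adding `T1 + T2 - T3 + T4` and subtracting `w φ_r` times the principal
  -- part leaves exactly the terms in which the weight was differentiated.
  have split : ∫ p in Q, (-a₁₁ p / 2 * pr R φ p ^ 2 + a₂₂ p / 2 * pθ θ₀ φ p ^ 2)
      = (∫ p in Q, a₁₁ p * (-(pr R φ p ^ 2 / 2) + (R - p.1) * (pr R φ p * pr R (pr R φ) p)))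
      + (∫ p in Q, a₂₂ p * ((R - p.1) *
          (pθ θ₀ (pr R φ) p * pθ θ₀ φ p + pr R φ p * pθ θ₀ (pθ θ₀ φ) p)))
      - (∫ p in Q, a₂₂ p * (-(pθ θ₀ φ p ^ 2 / 2) + (R - p.1) * (pθ θ₀ φ p * pθ θ₀ (pr R φ) p)))
      + (∫ p in Q, a₁₂ p * ((R - p.1) * (2 * pr R φ p * pθ θ₀ (pr R φ) p)))
      - ∫ p in Q, (R - p.1) * pr R φ p * (f p - a₁ p * pr R φ p - a₂ p * pθ θ₀ φ p
        - b₁ p * Ψ p - b₂ p * pr R Ψ p) := by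
    have e1 : ∫ p in Q, (R - p.1) * pr R φ p * (f p - a₁ p * pr R φ p - a₂ p * pθ θ₀ φ p
        - b₁ p * Ψ p - b₂ p * pr R Ψ p) = ∫ p in Q, (R - p.1) * pr R φ p *
        (a₁₁ p * pr R (pr R φ) p + a₂₂ p * pθ θ₀ (pθ θ₀ φ) p
          + 2 * a₁₂ p * pθ θ₀ (pr R φ) p) := by
      apply setIntegral_congr_fun (isCompact_rect _ _ _ _).measurableSet
      intro p hp
      simp only
      rw [← eqn p hp]; ring
    rw [e1, ← integral_rect_add (by fun_prop) (by fun_prop),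
      ← integral_rect_sub (by fun_prop) (by fun_prop),
      ← integral_rect_add (by fun_prop) (by fun_prop),
      ← integral_rect_sub (by fun_prop) (by fun_prop)]
    congr 1; ext p; ring
  rw [split]
  have t1 := (abs_le.1 T1).2
  have t2 := (abs_le.1 T2).2
  have t3 := (abs_le.1 T3).1
  have t4 := (abs_le.1 T4).2
  have s1 := mul_le_mul_of_nonneg_left g1 hL
  have s2 := mul_le_mul_of_nonneg_left g2 hL
  have s3 := mul_le_mul_of_nonneg_left g3 hL
  have s4 := mul_le_mul_of_nonneg_left g4 hL
  have hP0 : 0 ≤ P := integral_rect_nonneg fun p => sq_nonneg _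
  have hT0 : 0 ≤ T := integral_rect_nonneg fun p => sq_nonneg _
  have hZ0 : 0 ≤ ∫ p in Q, Ψ p ^ 2 := integral_rect_nonneg fun p => sq_nonneg _
  have hX0 : 0 ≤ ∫ p in Q, pr R Ψ p ^ 2 := integral_rect_nonneg fun p => sq_nonneg _
  have hF0 : 0 ≤ ∫ p in Q, f p ^ 2 := integral_rect_nonneg fun p => sq_nonneg _
  set Z := ∫ p in Q, Ψ p ^ 2
  set X := ∫ p in Q, pr R Ψ p ^ 2
  set F := ∫ p in Q, f p ^ 2
  have hS0 : 0 ≤ S := by positivity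
  have r1 : 0 ≤ R * L := by positivity
  have q1 : 0 ≤ R * L * (T + 2 * Z + 2 * X + 2 * F) := by positivity
  have q2 : 0 ≤ S * (2 * T + 2 * Z + 2 * X + 2 * F) := by positivity
  have goal_eq : R * (2 * L + 3 * M) * (P + T + Z + X + F)
      = R * L * (2 * P + T) + R * L * (T + 2 * Z + 2 * X + 2 * F) + S * (3 * P + T + Z + X + F)
        + S * (2 * T + 2 * Z + 2 * X + 2 * F) := by rw [hS]; ring
  rw [goal_eq]
  have sumL : L * (R / 2 * P) + L * (R / 2 * P + R / 2 * T) + L * (R / 2 * T) + L * (R * P)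
      = R * L * (2 * P + T) := by ring
  linarith

end EulerPoisson
end

/-! ### Closing the coupled estimate, and passing from integrals to norms. -/

noncomputable section
namespace EulerPoisson

/-- `W, P, T` are the integrals of `φ², φ_r², φ_θ²`, and `Z, X, Y` those of `Ψ², Ψ_r², Ψ_θ²`. The
elliptic estimate bounds `X` and `Z` by `P` and `F₂`, so the hyperbolic error is at most `α/20`
times `5 (P + T)` plus data. This is half of the coercive term `α/2 (P + T)` and can be absorbed.
One power of `1/α` is lost here and one in recovering `Y`. -/
theorem combine_energies {α M R N P T X Y Z W g F₁ F₂ : ℝ} (hα : 0 < α) (hα1 : α ≤ 1) (hM : 1 ≤ M)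
    (hR : 0 < R) (hR2 : R ≤ 1 / 2) (hRN : R * N * 20 ≤ α)
    (hP : 0 ≤ P) (hT : 0 ≤ T) (hX : 0 ≤ X) (hY : 0 ≤ Y) (hg : 0 ≤ g)
    (hF₁ : 0 ≤ F₁) (hF₂ : 0 ≤ F₂) (hZ : 0 ≤ Z) (hW : W ≤ 4 * R ^ 2 * P) (hZX : Z ≤ 4 * R ^ 2 * X)
    (hE : 1 / 2 * X + α * Y ≤ F₂ + P)
    (hH : α / 2 * (P + T) ≤ R * M * g + R * N * (P + T + Z + X + F₁)) :
    W + P + T + (Z + X + Y) ≤ 48 * M / α ^ 2 * (g + F₁ + F₂) := by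
  have hR4 : 4 * R ^ 2 ≤ 1 := by nlinarith
  have hW' : W ≤ P := hW.trans (by nlinarith)
  have hZ' : Z ≤ X := hZX.trans (by nlinarith)
  have hX2 : X ≤ 2 * F₂ + 2 * P := by nlinarith [mul_nonneg hα.le hY]
  set s := g + F₁ + F₂ with hs
  have hs0 : 0 ≤ s := by positivity
  have h1 : α * (P + T) ≤ 4 * M * s := by
    have a1 : R * N * (P + T + Z + X + F₁) * 20 ≤ α * (P + T + Z + X + F₁) := by
      have : 0 ≤ P + T + Z + X + F₁ := by positivity
      nlinarith [mul_le_mul_of_nonneg_right hRN this]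
    have a2 : α * (P + T + Z + X + F₁) ≤ α * (5 * (P + T) + 4 * F₂ + F₁) :=
      mul_le_mul_of_nonneg_left (by linarith) hα.le
    have a3 : R * M * g ≤ 1 / 2 * (M * g) := by
      rw [mul_assoc]; gcongr
    have a4 : α * (4 * F₂ + F₁) ≤ M * (4 * F₂ + F₁) := by gcongr; linarith
    have hMg : 0 ≤ M * g := by positivity
    have hMF : 0 ≤ M * F₁ := by positivity
    have hMF2 : 0 ≤ M * F₂ := by positivity
    have e : 4 * M * s = 4 * (M * g) + 4 * (M * F₁) + 4 * (M * F₂) := by rw [hs]; ring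
    rw [e]
    nlinarith
  have hPT : 0 ≤ P + T := by positivity
  have h2 : α ^ 2 * (2 * (P + T) + 2 * X + Y) ≤ 48 * M * s := by
    have hF2s : F₂ ≤ M * s := by nlinarith
    have b1 : α ^ 2 * (2 * (P + T) + 2 * X) ≤ α * (6 * (P + T) + 4 * F₂) := by
      have : α ^ 2 ≤ α := by nlinarith
      have q : 0 ≤ 2 * (P + T) + 2 * X := by positivity
      nlinarith [mul_le_mul_of_nonneg_right this q]
    have b2 : α ^ 2 * Y ≤ α * F₂ + α * P := by nlinarith [mul_nonneg hα.le hX]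
    have b3 : α * F₂ ≤ M * s := by nlinarith
    have b4 : α * P ≤ α * (P + T) := by gcongr; linarith
    have hMs : 0 ≤ M * s := by positivity
    nlinarith
  have h3 : 2 * (P + T) + 2 * X + Y ≤ 48 * M / α ^ 2 * s := by
    rw [div_mul_eq_mul_div, le_div_iff₀ (by positivity)]
    linarith
  linarith

variable {R θ₀ : ℝ} {φ Ψ : ℝ × ℝ → ℝ}

/-- The integral of the squares of a function and of its first derivatives. -/
def energy (R θ₀ : ℝ) (φ : ℝ × ℝ → ℝ) : ℝ :=
  (∫ p in rect 0 R (-θ₀) θ₀, φ p ^ 2) + (∫ p in rect 0 R (-θ₀) θ₀, pr R φ p ^ 2)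
    + ∫ p in rect 0 R (-θ₀) θ₀, pθ θ₀ φ p ^ 2

theorem energy_nonneg : 0 ≤ energy R θ₀ φ :=
  add_nonneg (add_nonneg (integral_rect_nonneg fun _ => sq_nonneg _)
    (integral_rect_nonneg fun _ => sq_nonneg _)) (integral_rect_nonneg fun _ => sq_nonneg _)

theorem memLp_of_continuousOn_rect {f : ℝ × ℝ → ℝ} (hf : ContinuousOn f (rect 0 R (-θ₀) θ₀)) :
    MemLp f 2 (volume.restrict (domain R θ₀)) := by
  rw [restrict_domain_eq, closedDomain_eq_rect]
  rw [memLp_two_iff_integrable_sq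
    (hf.aestronglyMeasurable (isCompact_rect _ _ _ _).measurableSet)]
  exact ContinuousOn.integrableOn_rect (hf.pow 2)

theorem eLpNorm_domain_eq {f : ℝ × ℝ → ℝ} (hf : ContinuousOn f (rect 0 R (-θ₀) θ₀)) :
    eLpNorm f 2 (volume.restrict (domain R θ₀))
      = ENNReal.ofReal (Real.sqrt (∫ p in rect 0 R (-θ₀) θ₀, f p ^ 2)) := by
  rw [eLpNorm_two_eq (memLp_of_continuousOn_rect hf), restrict_domain_eq, closedDomain_eq_rect]

theorem locallyIntegrableOn_domain {f : ℝ × ℝ → ℝ} (hf : ContinuousOn f (rect 0 R (-θ₀) θ₀)) :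
    LocallyIntegrableOn f (domain R θ₀) :=
  ((ContinuousOn.integrableOn_rect hf).mono_set
    (domain_subset_closedDomain R θ₀)).locallyIntegrableOn

theorem hasWeakPartial_pr (hR : 0 < R) (hθ : 0 < θ₀) (hφ : IsC2 R θ₀ φ) :
    HasWeakPartial (domain R θ₀) 1 0 φ (pr R φ) := by
  have k0 := hφ.cont
  have k1 := hφ.cont_r
  refine ⟨locallyIntegrableOn_domain k0, locallyIntegrableOn_domain k1, fun η hη _ hs => ?_⟩
  simp only [Function.iterate_one, Function.iterate_zero, id_eq, add_zero, pow_one, neg_mul,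
    one_mul]
  have hηr : ContinuousOn (dr η) (rect 0 R (-θ₀) θ₀) := (contDiff_dr hη).continuous.continuousOn
  have hηc : ContinuousOn η (rect 0 R (-θ₀) θ₀) := hη.continuous.continuousOn
  have h0 : ∀ p ∉ domain R θ₀, η p = 0 := fun p hp =>
    image_eq_zero_of_notMem_tsupport fun h => hp (hs h)
  have key : ∫ p in rect 0 R (-θ₀) θ₀, (pr R φ p * η p + φ p * dr η p) = 0 := by
    apply integral_deriv_fst_eq_zero hR.le (by linarith) (G := fun p => φ p * η p) _ (by fun_prop)
      (by fun_prop)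
    · intro t _
      rw [h0 (R, t) (by simp [domain]), h0 (0, t) (by simp [domain])]
      ring
    · intro p hp
      have : DifferentiableAt ℝ (fun s => η (s, p.2)) p.1 :=
        (hη.comp (contDiff_id.prodMk contDiff_const)).differentiable (by simp) _
      exact (hφ.deriv_r p hp).mul this.hasDerivAt.hasDerivWithinAt
  rw [integral_rect_add (by fun_prop) (by fun_prop)] at key
  rw [setIntegral_domain_eq, setIntegral_domain_eq]
  linarith

theorem hasWeakPartial_pθ (hR : 0 < R) (hθ : 0 < θ₀) (hφ : IsC2 R θ₀ φ) :
    HasWeakPartial (domain R θ₀) 0 1 φ (pθ θ₀ φ) := by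
  have k0 := hφ.cont
  have k1 := hφ.cont_θ
  refine ⟨locallyIntegrableOn_domain k0, locallyIntegrableOn_domain k1, fun η hη _ hs => ?_⟩
  simp only [Function.iterate_one, Function.iterate_zero, id_eq, zero_add, pow_one, neg_mul,
    one_mul]
  have hηr : ContinuousOn (dθ η) (rect 0 R (-θ₀) θ₀) := (contDiff_dθ hη).continuous.continuousOn
  have hηc : ContinuousOn η (rect 0 R (-θ₀) θ₀) := hη.continuous.continuousOn
  have h0 : ∀ p ∉ domain R θ₀, η p = 0 := fun p hp =>
    image_eq_zero_of_notMem_tsupport fun h => hp (hs h)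
  have key : ∫ p in rect 0 R (-θ₀) θ₀, (pθ θ₀ φ p * η p + φ p * dθ η p) = 0 := by
    apply integral_deriv_snd_eq_zero hR.le (by linarith) (G := fun p => φ p * η p) _ (by fun_prop)
      (by fun_prop)
    · intro s _
      rw [h0 (s, θ₀) (by simp [domain]), h0 (s, -θ₀) (by simp [domain])]
      ring
    · intro p hp
      have : DifferentiableAt ℝ (fun t => η (p.1, t)) p.2 :=
        (hη.comp (contDiff_const.prodMk contDiff_id)).differentiable (by simp) _
      exact (hφ.deriv_θ p hp).mul this.hasDerivAt.hasDerivWithinAt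
  rw [integral_rect_add (by fun_prop) (by fun_prop)] at key
  rw [setIntegral_domain_eq, setIntegral_domain_eq]
  linarith

theorem multiIndices_one : multiIndices 1 = {(0, 0), (1, 0), (0, 1)} := by decide

/-- The norm is an infimum over families of weak derivatives, so exhibiting the classical
derivatives as one such family suffices for the upper bound. -/
theorem sobolevNorm_one_le (hR : 0 < R) (hθ : 0 < θ₀) (hφ : IsC2 R θ₀ φ) :
    sobolevNorm 1 (domain R θ₀) φ ≤ ENNReal.ofReal (Real.sqrt (energy R θ₀ φ)) := by
  set G : ℕ × ℕ → ℝ × ℝ → ℝ := fun a => if a = (0, 0) then φ else if a = (1, 0) then pr R φ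
    else pθ θ₀ φ with hG
  have g0 : G (0, 0) = φ := by simp [hG]
  have g1 : G (1, 0) = pr R φ := by simp [hG]
  have g2 : G (0, 1) = pθ θ₀ φ := by simp [hG]
  have hfam : IsSobolevFamily 1 (domain R θ₀) φ G := by
    intro a ha
    rw [multiIndices_one] at ha
    simp only [Finset.mem_insert, Finset.mem_singleton] at ha
    rcases ha with rfl | rfl | rfl
    · rw [g0]
      exact ⟨⟨locallyIntegrableOn_domain hφ.cont, locallyIntegrableOn_domain hφ.cont,
        fun η _ _ _ => by simp⟩, memLp_of_continuousOn_rect hφ.cont⟩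
    · rw [g1]
      exact ⟨hasWeakPartial_pr hR hθ hφ, memLp_of_continuousOn_rect hφ.cont_r⟩
    · rw [g2]
      exact ⟨hasWeakPartial_pθ hR hθ hφ, memLp_of_continuousOn_rect hφ.cont_θ⟩
  refine (iInf₂_le G hfam).trans (le_of_eq ?_)
  have sq : ∀ {f : ℝ × ℝ → ℝ}, ContinuousOn f (rect 0 R (-θ₀) θ₀) →
      eLpNorm f 2 (volume.restrict (domain R θ₀)) ^ 2
        = ENNReal.ofReal (∫ p in rect 0 R (-θ₀) θ₀, f p ^ 2) := fun hf => by
    rw [eLpNorm_domain_eq hf, ← ENNReal.ofReal_pow (Real.sqrt_nonneg _),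
      Real.sq_sqrt (integral_rect_nonneg fun _ => sq_nonneg _)]
  rw [multiIndices_one, Finset.sum_insert (by simp), Finset.sum_insert (by simp),
    Finset.sum_singleton, g0, g1, g2, sq hφ.cont, sq hφ.cont_r, sq hφ.cont_θ,
    ← ENNReal.ofReal_add (integral_rect_nonneg fun _ => sq_nonneg _)
      (integral_rect_nonneg fun _ => sq_nonneg _),
    ← ENNReal.ofReal_add (integral_rect_nonneg fun _ => sq_nonneg _)
      (add_nonneg (integral_rect_nonneg fun _ => sq_nonneg _)
        (integral_rect_nonneg fun _ => sq_nonneg _)),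
    Real.sqrt_eq_rpow, ← ENNReal.ofReal_rpow_of_nonneg energy_nonneg (by norm_num), energy,
    add_assoc]

theorem eLpNorm_Icc_eq (hθ : 0 < θ₀) {f : ℝ → ℝ} (hf : ContinuousOn f (Icc (-θ₀) θ₀)) :
    eLpNorm f 2 (volume.restrict (Icc (-θ₀) θ₀))
      = ENNReal.ofReal (Real.sqrt (∫ t in (-θ₀)..θ₀, f t ^ 2)) := by
  have : MemLp f 2 (volume.restrict (Icc (-θ₀) θ₀)) := by
    rw [memLp_two_iff_integrable_sq (hf.aestronglyMeasurable measurableSet_Icc)]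
    exact (hf.pow 2).integrableOn_Icc
  rw [eLpNorm_two_eq this, intervalIntegral.integral_of_le (by linarith),
    integral_Icc_eq_integral_Ioc]

/-- Passes from squared quantities to norms, using `(√a + √b)² ≤ 2 (a + b)` on the left and dropping
the cross terms on the right. -/
theorem sqrt_add_sqrt_le {a b C x y z : ℝ} (ha : 0 ≤ a) (hb : 0 ≤ b) (hC : 0 ≤ C)
    (h : a + b ≤ C * (x + y + z)) (hx : 0 ≤ x) (hy : 0 ≤ y) (hz : 0 ≤ z) :
    Real.sqrt a + Real.sqrt b
      ≤ Real.sqrt (2 * C) * (Real.sqrt x + Real.sqrt y + Real.sqrt z) := by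
  apply le_of_sq_le_sq _ (by positivity)
  rw [mul_pow, Real.sq_sqrt (by positivity)]
  have ea := Real.sq_sqrt ha
  have eb := Real.sq_sqrt hb
  have ex := Real.sq_sqrt hx
  have ey := Real.sq_sqrt hy
  have ez := Real.sq_sqrt hz
  have h1 : (Real.sqrt a + Real.sqrt b) ^ 2 ≤ 2 * (a + b) := by
    nlinarith [sq_nonneg (Real.sqrt a - Real.sqrt b)]
  have h2 : x + y + z ≤ (Real.sqrt x + Real.sqrt y + Real.sqrt z) ^ 2 := by
    have q1 : 0 ≤ Real.sqrt x * Real.sqrt y := by positivity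
    have q2 : 0 ≤ Real.sqrt x * Real.sqrt z := by positivity
    have q3 : 0 ≤ Real.sqrt y * Real.sqrt z := by positivity
    nlinarith
  calc _ ≤ 2 * (C * (x + y + z)) := by linarith
    _ = 2 * C * (x + y + z) := by ring
    _ ≤ _ := by gcongr

end EulerPoisson
end

/-! ### Uniform bounds and hyperbolicity of the coefficients near the entrance. -/

noncomputable section
namespace EulerPoisson

/-- `f` is bounded by `M` and Lipschitz with constant `M` on `S`. -/
def BddLip (S : Set (ℝ × ℝ)) (M : ℝ) (f : ℝ × ℝ → ℝ) : Prop :=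
  (∀ p ∈ S, |f p| ≤ M) ∧ ∀ p ∈ S, ∀ q ∈ S, |f p - f q| ≤ M * dist p q

namespace BddLip

variable {S : Set (ℝ × ℝ)} {M N : ℝ} {f g : ℝ × ℝ → ℝ}

theorem mono (hf : BddLip S M f) (h : M ≤ N) : BddLip S N f :=
  ⟨fun p hp => (hf.1 p hp).trans h, fun p hp q hq =>
    (hf.2 p hp q hq).trans (mul_le_mul_of_nonneg_right h dist_nonneg)⟩

theorem mono_set {T : Set (ℝ × ℝ)} (hf : BddLip S M f) (h : T ⊆ S) : BddLip T M f :=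
  ⟨fun p hp => hf.1 p (h hp), fun p hp q hq => hf.2 p (h hp) q (h hq)⟩

theorem add (hf : BddLip S M f) (hg : BddLip S N g) : BddLip S (M + N) (fun p => f p + g p) := by
  refine ⟨fun p hp => (abs_add_le _ _).trans (add_le_add (hf.1 p hp) (hg.1 p hp)),
    fun p hp q hq => ?_⟩
  calc |f p + g p - (f q + g q)| = |(f p - f q) + (g p - g q)| := by ring_nf
    _ ≤ |f p - f q| + |g p - g q| := abs_add_le _ _
    _ ≤ M * dist p q + N * dist p q := add_le_add (hf.2 p hp q hq) (hg.2 p hp q hq)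
    _ = _ := by ring

theorem neg (hf : BddLip S M f) : BddLip S M (fun p => -f p) := by
  refine ⟨fun p hp => (abs_neg (f p)).trans_le (hf.1 p hp), fun p hp q hq => ?_⟩
  rw [← neg_sub', abs_neg]
  exact hf.2 p hp q hq

theorem sub (hf : BddLip S M f) (hg : BddLip S N g) : BddLip S (M + N) (fun p => f p - g p) := by
  simpa only [sub_eq_add_neg] using hf.add hg.neg

/-- The constant `2 M N` is the one for the Lipschitz seminorm. It also dominates the bound `M N` on
the values, so one number serves both purposes. -/
theorem mul (hf : BddLip S M f) (hg : BddLip S N g) : BddLip S (2 * M * N) (fun p => f p * g p) := by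
  constructor
  · intro p hp
    have hM := (abs_nonneg _).trans (hf.1 p hp)
    have hN := (abs_nonneg _).trans (hg.1 p hp)
    rw [abs_mul]
    calc |f p| * |g p| ≤ M * N := mul_le_mul (hf.1 p hp) (hg.1 p hp) (abs_nonneg _) hM
      _ ≤ 2 * M * N := by nlinarith [mul_nonneg hM hN]
  · intro p hp q hq
    have hM := (abs_nonneg _).trans (hf.1 p hp)
    calc |f p * g p - f q * g q| = |f p * (g p - g q) + (f p - f q) * g q| := by ring_nf
      _ ≤ |f p| * |g p - g q| + |f p - f q| * |g q| := by
        rw [← abs_mul, ← abs_mul]; exact abs_add_le _ _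
      _ ≤ M * (N * dist p q) + (M * dist p q) * N := by
        gcongr
        · exact hf.1 p hp
        · exact hg.2 p hp q hq
        · exact hf.2 p hp q hq
        · exact hg.1 q hq
      _ = _ := by ring

theorem const (c : ℝ) : BddLip S |c| (fun _ => c) :=
  ⟨fun _ _ => le_rfl, fun p _ q _ => by rw [sub_self, abs_zero]; positivity⟩

theorem lipschitzOnWith (hf : BddLip S M f) (hM : 0 ≤ M) : LipschitzOnWith M.toNNReal f S :=
  LipschitzOnWith.of_dist_le_mul fun p hp q hq => by
    rw [Real.coe_toNNReal M hM, Real.dist_eq]; exact hf.2 p hp q hq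

theorem congr (hf : BddLip S M f) (h : ∀ p ∈ S, g p = f p) : BddLip S M g :=
  ⟨fun p hp => by rw [h p hp]; exact hf.1 p hp, fun p hp q hq => by
    rw [h p hp, h q hq]; exact hf.2 p hp q hq⟩

end BddLip

theorem dist_fst_le (p q : ℝ × ℝ) : |p.1 - q.1| ≤ dist p q := by
  rw [← Real.dist_eq, Prod.dist_eq]; exact le_max_left _ _

/-- The half-infinite strip over `[0, b]`. -/
def strip (b : ℝ) : Set (ℝ × ℝ) := Icc 0 b ×ˢ univ

theorem rect_subset_strip {b R c d : ℝ} (h : R ≤ b) : rect 0 R c d ⊆ strip b :=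
  prod_mono (Icc_subset_Icc_right h) (subset_univ _)

theorem exists_bddLip_of_lipschitz {b L : ℝ} {f : ℝ → ℝ} (hL : 0 ≤ L)
    (hf : ∀ x ∈ Icc 0 b, ∀ y ∈ Icc 0 b, |f x - f y| ≤ L * |x - y|) :
    ∃ M, BddLip (strip b) M (fun p => f p.1) := by
  refine ⟨L + (|f 0| + L * |b|), fun p hp => ?_, fun p hp q hq => ?_⟩
  · have hb : 0 ≤ b := hp.1.1.trans hp.1.2
    have h1 := hf p.1 hp.1 0 ⟨le_rfl, hb⟩
    have h2 : |p.1 - 0| ≤ |b| := by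
      rw [sub_zero, abs_of_nonneg hp.1.1, abs_of_nonneg hb]; exact hp.1.2
    calc |f p.1| = |(f p.1 - f 0) + f 0| := by ring_nf
      _ ≤ |f p.1 - f 0| + |f 0| := abs_add_le _ _
      _ ≤ L * |b| + |f 0| := by gcongr; exact h1.trans (by gcongr)
      _ ≤ _ := by linarith
  · have h3 : 0 ≤ |f 0| + L * |b| := by positivity
    calc |f p.1 - f q.1| ≤ L * |p.1 - q.1| := hf _ hp.1 _ hq.1
      _ ≤ L * dist p q := by gcongr; exact dist_fst_le p q
      _ ≤ _ := by nlinarith [mul_nonneg h3 (dist_nonneg (x := p) (y := q))]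

theorem exists_bddLip_of_contDiffOn {b : ℝ} {f : ℝ → ℝ} (hf : ContDiffOn ℝ ∞ f (Icc 0 b)) :
    ∃ M, BddLip (strip b) M (fun p => f p.1) := by
  obtain ⟨K, hK⟩ := hf.exists_lipschitzOnWith (by simp) (convex_Icc 0 b) isCompact_Icc
  refine exists_bddLip_of_lipschitz K.2 fun x hx y hy => ?_
  simpa [Real.dist_eq] using hK.dist_le_mul x hx y hy

theorem exists_bound_of_continuousOn {b : ℝ} {f : ℝ → ℝ} (hf : ContinuousOn f (Icc 0 b)) :
    ∃ M, ∀ r ∈ Icc 0 b, |f r| ≤ M :=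
  isCompact_Icc.exists_bound_of_continuousOn hf

/-! ### The algebraic structure of the coefficients -/

/-- The point is uniformity: the sum and product rules give a constant that depends only on `γ` and
`M`, not on the functions or the set. -/
theorem exists_bddLip_soundSq (γ M : ℝ) : ∃ L, ∀ (S : Set (ℝ × ℝ)) (k u v φ : ℝ × ℝ → ℝ),
    BddLip S M k → BddLip S M u → BddLip S M v → BddLip S M φ →
    BddLip S L (fun p => (γ - 1) * (k p + φ p - (u p * u p + v p * v p) * (1 / 2))) :=
  ⟨_, fun _ _ _ _ _ hk hu hv hφ => (BddLip.const (γ - 1)).mul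
    ((hk.add hφ).sub (((hu.mul hu).add (hv.mul hv)).mul (BddLip.const (1 / 2))))⟩

variable {D : NozzleData}

namespace NozzleData

theorem len_pos (D : NozzleData) : 0 < D.len := sub_pos.2 D.r₁_lt_r₂

theorem r₂_pos (D : NozzleData) : 0 < D.r₂ := D.r₁_pos.trans D.r₁_lt_r₂

theorem rhat_pos (D : NozzleData) {r : ℝ} (hr : r ∈ Icc 0 D.len) : 0 < D.rhat r := by
  have := hr.2
  have := D.r₁_pos
  unfold rhat; unfold len at *; linarith

theorem rhat_le (D : NozzleData) {r : ℝ} (hr : r ∈ Icc 0 D.len) : D.rhat r ≤ D.r₂ := by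
  have := hr.1
  unfold rhat; linarith

end NozzleData

namespace BackgroundFlow

variable (B : BackgroundFlow D)

theorem cSq_zero : B.cSq 0 = D.γ * D.P₀ / D.ρ₀ := by rw [cSq, B.init.1, B.init.2.2.1]

theorem cSq_zero_pos : 0 < B.cSq 0 := by
  rw [cSq_zero]
  have := D.one_lt_γ
  have := D.P₀_pos
  have := D.ρ₀_pos
  positivity

/-- The additive constant in `Φ̄` is the Bernoulli constant of the entrance state, so the Bernoulli
sound speed agrees there with `γ P₀ / ρ₀`. Continuity then carries hyperbolicity to a neighbourhood.
-/
theorem soundSq_zero : D.soundSq 0 D.U₀ 0 (B.Φ 0) = B.cSq 0 := by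
  have hρ := D.ρ₀_pos
  have hU := D.U₀_pos
  have hr := D.r₂_pos
  have hP := D.P₀_pos
  have hγ : D.γ - 1 ≠ 0 := sub_ne_zero.2 D.one_lt_γ.ne'
  have e1 : D.J₀ / (D.r₂ * D.U₀) = D.ρ₀ := by
    unfold NozzleData.J₀; field_simp
  have e2 : Real.exp D.S₀ = D.P₀ / D.ρ₀ ^ D.γ := by
    unfold NozzleData.S₀; exact Real.exp_log (by positivity)
  have e3 : D.ρ₀ ^ (D.γ - 1) = D.ρ₀ ^ D.γ / D.ρ₀ := by
    rw [Real.rpow_sub hρ, Real.rpow_one]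
  have h4 : D.ρ₀ ^ D.γ ≠ 0 := (Real.rpow_pos_of_pos hρ _).ne'
  rw [cSq_zero, NozzleData.soundSq, Φ, e1, e2, e3, intervalIntegral.integral_same]
  field_simp
  ring

theorem contDiffOn_cSq : ContDiffOn ℝ ∞ B.cSq (Icc 0 D.len) :=
  (contDiffOn_const.mul B.smooth_P).div B.smooth_ρ fun r hr => (B.ρ_pos r hr).ne'

theorem contDiffOn_inv_rhat : ContDiffOn ℝ ∞ (fun r => 1 / D.rhat r) (Icc 0 D.len) :=
  contDiffOn_const.div (contDiffOn_const.sub contDiffOn_id) fun _ hr => (D.rhat_pos hr).ne'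

theorem exists_abs_Φ_sub_le : ∃ L, 0 ≤ L ∧ ∀ x ∈ Icc 0 D.len, ∀ y ∈ Icc 0 D.len,
    |B.Φ x - B.Φ y| ≤ L * |x - y| := by
  have hE := B.smooth_E.continuousOn
  obtain ⟨L, hL⟩ := isCompact_Icc.exists_bound_of_continuousOn hE
  refine ⟨L, (norm_nonneg _).trans (hL 0 ⟨le_rfl, D.len_pos.le⟩), fun x hx y hy => ?_⟩
  have hi : ∀ z ∈ Icc 0 D.len, IntervalIntegrable B.E volume 0 z := fun z hz =>
    (hE.mono (Icc_subset_Icc_right hz.2)).intervalIntegrable_of_Icc hz.1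
  have e : B.Φ x - B.Φ y = ∫ t in x..y, B.E t := by
    rw [← intervalIntegral.integral_interval_sub_left (hi y hy) (hi x hx)]
    unfold Φ; ring
  rw [e, abs_sub_comm]
  refine intervalIntegral.norm_integral_le_of_norm_le_const fun t ht => hL t ?_
  have ht' := uIoc_subset_uIcc ht
  exact (uIcc_subset_Icc hx hy) ht'

/-- Near the entrance the background flow is uniformly supersonic, and so are small
perturbations of it. -/
theorem exists_supersonic_neighborhood : ∃ η β : ℝ, 0 < η ∧ 0 < β ∧ ∀ k u v φ : ℝ, |k| < η →
    |u - D.U₀| < η → |v| < η → |φ - B.Φ 0| < η →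
    D.A₁₁ k u v φ < -β ∧ β < D.soundSq k u v φ - v ^ 2 := by
  have hc := B.cSq_zero_pos
  have hs : B.cSq 0 < D.U₀ ^ 2 := by
    have := B.supersonic 0 ⟨le_rfl, D.len_pos.le⟩
    rw [B.init.2.1] at this
    exact this
  -- Half of the smaller of the two gaps `c̄² > 0` and `Ū² - c̄² > 0` at the entrance. The other
  -- half is left for perturbations.
  set β := min (B.cSq 0) (D.U₀ ^ 2 - B.cSq 0) / 2 with hβ
  have hmin : 0 < min (B.cSq 0) (D.U₀ ^ 2 - B.cSq 0) := lt_min hc (sub_pos.2 hs)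
  have hβ0 : 0 < β := half_pos hmin
  have hb1 : β < B.cSq 0 := (half_lt_self hmin).trans_le (min_le_left _ _)
  have hb2 : β < D.U₀ ^ 2 - B.cSq 0 := (half_lt_self hmin).trans_le (min_le_right _ _)
  let x₀ : ℝ × ℝ × ℝ × ℝ := (0, D.U₀, 0, B.Φ 0)
  have c1 : Continuous fun x : ℝ × ℝ × ℝ × ℝ => D.A₁₁ x.1 x.2.1 x.2.2.1 x.2.2.2 := by
    unfold NozzleData.A₁₁ NozzleData.soundSq; fun_prop
  have c2 : Continuous fun x : ℝ × ℝ × ℝ × ℝ =>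
      D.soundSq x.1 x.2.1 x.2.2.1 x.2.2.2 - x.2.2.1 ^ 2 := by
    unfold NozzleData.soundSq; fun_prop
  have n1 : ∀ᶠ x in nhds x₀, D.A₁₁ x.1 x.2.1 x.2.2.1 x.2.2.2 < -β :=
    c1.continuousAt.eventually (gt_mem_nhds (by
      simp only [NozzleData.A₁₁, x₀, soundSq_zero]; linarith))
  have n2 : ∀ᶠ x in nhds x₀, β < D.soundSq x.1 x.2.1 x.2.2.1 x.2.2.2 - x.2.2.1 ^ 2 :=
    c2.continuousAt.eventually (lt_mem_nhds (by
      simp only [x₀, soundSq_zero]; simpa using hb1))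
  obtain ⟨η, hη, h⟩ := Metric.eventually_nhds_iff.1 (n1.and n2)
  refine ⟨η, β, hη, hβ0, fun k u v φ h1 h2 h3 h4 => ?_⟩
  apply @h (k, u, v, φ)
  simp only [x₀, Prod.dist_eq, Real.dist_eq, sub_zero, max_lt_iff]
  exact ⟨h1, h2, h3, h4⟩

/-- Positivity of `c̄²` is known at the entrance, where `P₀ > 0`, and spreads by continuity to a
short interval. The length `b` becomes one of the restrictions on the size of `R`. -/
theorem exists_near_entrance {η : ℝ} (hη : 0 < η) : ∃ b, 0 < b ∧ b ≤ D.len ∧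
    ∀ r ∈ Icc 0 b, 0 < B.cSq r ∧ |B.U r - D.U₀| < η ∧ |B.Φ r - B.Φ 0| < η := by
  obtain ⟨L, hL, hΦ⟩ := B.exists_abs_Φ_sub_le
  have h0 : (0 : ℝ) ∈ Icc 0 D.len := ⟨le_rfl, D.len_pos.le⟩
  have cΦ : ContinuousOn B.Φ (Icc 0 D.len) := by
    have : LipschitzOnWith L.toNNReal B.Φ (Icc 0 D.len) :=
      LipschitzOnWith.of_dist_le_mul fun x hx y hy => by
        rw [Real.coe_toNNReal L hL, Real.dist_eq, Real.dist_eq]; exact hΦ x hx y hy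
    exact this.continuousOn
  have n1 : ∀ᶠ r in nhdsWithin 0 (Icc 0 D.len), 0 < B.cSq r :=
    (B.contDiffOn_cSq.continuousOn 0 h0).eventually (lt_mem_nhds B.cSq_zero_pos)
  have n2 : ∀ᶠ r in nhdsWithin 0 (Icc 0 D.len), |B.U r - D.U₀| < η := by
    have := (B.smooth_U.continuousOn 0 h0).eventually (Metric.ball_mem_nhds _ hη)
    simpa only [Metric.mem_ball, Real.dist_eq, B.init.2.1] using this
  have n3 : ∀ᶠ r in nhdsWithin 0 (Icc 0 D.len), |B.Φ r - B.Φ 0| < η := by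
    have := (cΦ 0 h0).eventually (Metric.ball_mem_nhds _ hη)
    simpa only [Metric.mem_ball, Real.dist_eq] using this
  obtain ⟨ε, hε, h⟩ := Metric.mem_nhdsWithin_iff.1 (n1.and (n2.and n3))
  refine ⟨min (ε / 2) D.len, lt_min (half_pos hε) D.len_pos, min_le_right _ _, fun r hr => ?_⟩
  apply h
  refine ⟨?_, hr.1, hr.2.trans (min_le_right _ _)⟩
  rw [Metric.mem_ball, Real.dist_eq, sub_zero, abs_of_nonneg hr.1]
  exact (hr.2.trans (min_le_left _ _)).trans_lt (half_lt_self hε)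

/-- The lower order coefficients are continuous and bounded by `M` on `[0, b]`. -/
structure LowerOrderBounds (b M : ℝ) : Prop where
  cont : ContinuousOn B.a₁ (Icc 0 b) ∧ ContinuousOn B.b₁ (Icc 0 b) ∧ ContinuousOn B.b₂ (Icc 0 b) ∧
    ContinuousOn B.c₁ (Icc 0 b) ∧ ContinuousOn B.c₂ (Icc 0 b) ∧
    ContinuousOn (fun r => 1 / D.rhat r) (Icc 0 b)
  bound : ∀ r ∈ Icc 0 b, |B.a₁ r| ≤ M ∧ |B.b₁ r| ≤ M ∧ |B.b₂ r| ≤ M ∧ |B.c₁ r| ≤ M ∧ |B.c₂ r| ≤ M ∧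
    |1 / D.rhat r| ≤ M

theorem exists_lowerOrderBounds {b : ℝ} (hb : b ≤ D.len) (hc : ∀ r ∈ Icc 0 b, 0 < B.cSq r) :
    ∃ M, B.LowerOrderBounds b M := by
  have hsub : Icc 0 b ⊆ Icc 0 D.len := Icc_subset_Icc_right hb
  have kU := B.smooth_U.continuousOn.mono hsub
  have kE := B.smooth_E.continuousOn.mono hsub
  have kρ := B.smooth_ρ.continuousOn.mono hsub
  have kc := B.contDiffOn_cSq.continuousOn.mono hsub
  have kr : ContinuousOn D.rhat (Icc 0 b) := by unfold NozzleData.rhat; fun_prop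
  have kd : ContinuousOn (D.diff B.U) (Icc 0 b) :=
    (B.smooth_U.continuousOn_derivWithin (uniqueDiffOn_Icc D.len_pos) (by simp)).mono hsub
  have hc0 : ∀ r ∈ Icc 0 b, B.cSq r ≠ 0 := fun r hr => (hc r hr).ne'
  have hr0 : ∀ r ∈ Icc 0 b, D.rhat r ≠ 0 := fun r hr => (D.rhat_pos (hsub hr)).ne'
  have k1 : ContinuousOn B.a₁ (Icc 0 b) := by
    unfold a₁
    exact (((continuousOn_const.mul (kU.pow 2)).sub kc).div (kr.mul kc)
      fun r hr => mul_ne_zero (hr0 r hr) (hc0 r hr)).sub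
      ((((continuousOn_const.mul kU).mul kd).add kE).div kc hc0)
  have k2 : ContinuousOn B.b₁ (Icc 0 b) := by
    unfold b₁
    exact ((continuousOn_const.mul kU).neg.div (kr.mul kc)
      fun r hr => mul_ne_zero (hr0 r hr) (hc0 r hr)).add
      ((continuousOn_const.mul kd).div kc hc0)
  have k3 : ContinuousOn B.b₂ (Icc 0 b) := kU.div kc hc0
  have k4 : ContinuousOn B.c₁ (Icc 0 b) := (kρ.mul kU).div kc hc0
  have k5 : ContinuousOn B.c₂ (Icc 0 b) := kρ.neg.div kc hc0
  have k6 : ContinuousOn (fun r => 1 / D.rhat r) (Icc 0 b) := continuousOn_const.div kr hr0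
  obtain ⟨m1, h1⟩ := exists_bound_of_continuousOn k1
  obtain ⟨m2, h2⟩ := exists_bound_of_continuousOn k2
  obtain ⟨m3, h3⟩ := exists_bound_of_continuousOn k3
  obtain ⟨m4, h4⟩ := exists_bound_of_continuousOn k4
  obtain ⟨m5, h5⟩ := exists_bound_of_continuousOn k5
  obtain ⟨m6, h6⟩ := exists_bound_of_continuousOn k6
  refine ⟨max m1 (max m2 (max m3 (max m4 (max m5 m6)))), ⟨k1, k2, k3, k4, k5, k6⟩, fun r hr => ?_⟩
  simp only [le_max_iff]
  exact ⟨.inl (h1 r hr), .inr (.inl (h2 r hr)), .inr (.inr (.inl (h3 r hr))),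
    .inr (.inr (.inr (.inl (h4 r hr)))), .inr (.inr (.inr (.inr (.inl (h5 r hr))))),
    .inr (.inr (.inr (.inr (.inr (h6 r hr)))))⟩

/-- Uniform regularity and hyperbolicity of the leading coefficients over `[0, b]`. -/
structure LeadingBounds (b η α M : ℝ) : Prop where
  bound : ∀ k u v φ : ℝ × ℝ → ℝ, BddLip univ η k → BddLip univ η u → BddLip univ η v →
    BddLip univ η φ → BddLip (strip b) M (B.a₁₁ k u v φ) ∧ BddLip (strip b) M (B.a₂₂ k u v φ) ∧
      BddLip (strip b) M (B.a₁₂ u v) ∧ BddLip (strip b) M (B.a₂ u v) ∧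
      ∀ p ∈ strip b, B.a₁₁ k u v φ p ≤ -α ∧ α ≤ B.a₂₂ k u v φ p

theorem exists_leadingBounds : ∃ b η α M : ℝ, 0 < b ∧ b ≤ D.len ∧ 0 < η ∧ 0 < α ∧ α ≤ 1 ∧
    α ≤ 1 / D.r₂ ^ 2 ∧ (∀ r ∈ Icc 0 b, 0 < B.cSq r) ∧ B.LeadingBounds b η α M := by
  obtain ⟨η, β, hη, hβ, hsup⟩ := B.exists_supersonic_neighborhood
  -- The margin `η` is shared equally: one half for the variation of the background over `[0, b]`,
  -- the other for the iterates.
  obtain ⟨b, hb, hbl, hnear⟩ := B.exists_near_entrance (half_pos hη)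
  have hsub : Icc 0 b ⊆ Icc 0 D.len := Icc_subset_Icc_right hbl
  have hr₂ := D.r₂_pos
  obtain ⟨mc, hmc⟩ := exists_bound_of_continuousOn (B.contDiffOn_cSq.continuousOn.mono hsub)
  have hmc0 : 0 < mc :=
    ((hnear 0 ⟨le_rfl, hb.le⟩).1.trans_le (le_abs_self _)).trans_le (hmc 0 ⟨le_rfl, hb.le⟩)
  obtain ⟨L, hL, hΦ⟩ := B.exists_abs_Φ_sub_le
  obtain ⟨mΦ, lΦ⟩ := exists_bddLip_of_lipschitz (b := b) hL
    fun x hx y hy => hΦ x (hsub hx) y (hsub hy)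
  obtain ⟨mU, lU⟩ := exists_bddLip_of_contDiffOn (B.smooth_U.mono hsub)
  obtain ⟨mr, lr⟩ := exists_bddLip_of_contDiffOn ((contDiffOn_inv_rhat (D := D)).mono hsub)
  obtain ⟨mi, li⟩ := exists_bddLip_of_contDiffOn (b := b) (f := fun r => 1 / B.cSq r)
    (contDiffOn_const.div (B.contDiffOn_cSq.mono hsub) fun r hr => (hnear r hr).1.ne')
  set η' := η / 2 with hη'
  have hη'0 : 0 < η' := half_pos hη
  set m := mΦ + mU + mr + mi + η' with hm
  have hz : ((0 : ℝ), (0 : ℝ)) ∈ strip b := ⟨⟨le_rfl, hb.le⟩, mem_univ _⟩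
  have nn : ∀ {M : ℝ} {f : ℝ × ℝ → ℝ}, BddLip (strip b) M f → 0 ≤ M := fun h =>
    (abs_nonneg _).trans (h.1 _ hz)
  have hΦ0 := nn lΦ
  have hU0 := nn lU
  have hr0 := nn lr
  have hi0 := nn li
  -- The constants are fixed before the iterates are introduced. Each leading coefficient is a
  -- polynomial in functions bounded and Lipschitz with constant `m`, with the divisions replaced by
  -- the smooth factors `1 / c̄²` and `1 / r̂`.
  obtain ⟨Ls, hLs⟩ := exists_bddLip_soundSq D.γ m
  obtain ⟨L1, hL1⟩ : ∃ L1, ∀ s u : ℝ × ℝ → ℝ, BddLip (strip b) Ls s → BddLip (strip b) m u →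
      BddLip (strip b) L1 (fun p => (s p - u p * u p) * (1 / B.cSq p.1)) :=
    ⟨_, fun s u hs hu => (hs.sub (hu.mul hu)).mul li⟩
  obtain ⟨L2, hL2⟩ : ∃ L2, ∀ s u : ℝ × ℝ → ℝ, BddLip (strip b) Ls s → BddLip (strip b) m u →
      BddLip (strip b) L2 (fun p => (s p - u p * u p) * (1 / B.cSq p.1)
        * ((1 / D.rhat p.1) * (1 / D.rhat p.1))) :=
    ⟨_, fun s u hs hu => ((hs.sub (hu.mul hu)).mul li).mul (lr.mul lr)⟩
  obtain ⟨L3, hL3⟩ : ∃ L3, ∀ u v : ℝ × ℝ → ℝ, BddLip (strip b) m u → BddLip (strip b) m v →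
      BddLip (strip b) L3 (fun p => -(u p * v p) * (1 / D.rhat p.1) * (1 / B.cSq p.1)) :=
    ⟨_, fun u v hu hv => ((hu.mul hv).neg.mul lr).mul li⟩
  obtain ⟨L4, hL4⟩ : ∃ L4, ∀ u v : ℝ × ℝ → ℝ, BddLip (strip b) m u → BddLip (strip b) m v →
      BddLip (strip b) L4 (fun p => -(u p * v p) * (1 / D.rhat p.1) * (1 / B.cSq p.1)
        * (1 / D.rhat p.1)) :=
    ⟨_, fun u v hu hv => (((hu.mul hv).neg.mul lr).mul li).mul lr⟩
  -- The last two entries bound `-a₁₁` and `a₂₂` from below, using `c̄² ≤ mc` and `r̂ ≤ r₂`. The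
  -- entry `1 / r₂²` bounds the coefficient `1 / r̂²` of the elliptic equation, and `1` simplifies
  -- the final absorption.
  set α := min 1 (min (1 / D.r₂ ^ 2) (min (β / mc) (β / (mc * D.r₂ ^ 2)))) with hα
  have α1 : α ≤ 1 := min_le_left _ _
  have α2 : α ≤ 1 / D.r₂ ^ 2 := (min_le_right _ _).trans (min_le_left _ _)
  have α3 : α ≤ β / mc := (min_le_right _ _).trans ((min_le_right _ _).trans (min_le_left _ _))
  have α4 : α ≤ β / (mc * D.r₂ ^ 2) :=
    (min_le_right _ _).trans ((min_le_right _ _).trans (min_le_right _ _))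
  refine ⟨b, η', α, max L1 (max L2 (max L3 L4)), hb, hbl, hη'0, by positivity, α1, α2,
    fun r hr => (hnear r hr).1, ⟨fun k u v φ hk hu hv hφ => ?_⟩⟩
  have sk : BddLip (strip b) m k := (hk.mono_set (subset_univ _)).mono (by linarith)
  have sv : BddLip (strip b) m v := (hv.mono_set (subset_univ _)).mono (by linarith)
  have su : BddLip (strip b) m (fun p => B.U p.1 + u p) :=
    (lU.add (hu.mono_set (subset_univ _))).mono (by linarith)
  have sφ : BddLip (strip b) m (fun p => B.Φ p.1 + φ p) :=
    (lΦ.add (hφ.mono_set (subset_univ _))).mono (by linarith)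
  have ss := hLs _ _ _ _ _ sk su sv sφ
  refine ⟨((hL1 _ _ ss su).congr fun p _ => ?_).mono (le_max_left _ _),
    ((hL2 _ _ ss sv).congr fun p _ => ?_).mono ((le_max_left _ _).trans (le_max_right _ _)),
    ((hL3 _ _ su sv).congr fun p _ => ?_).mono
      ((le_max_left _ _).trans ((le_max_right _ _).trans (le_max_right _ _))),
    ((hL4 _ _ su sv).congr fun p _ => ?_).mono
      ((le_max_right _ _).trans ((le_max_right _ _).trans (le_max_right _ _))),
    fun p hp => ?_⟩
  · simp only [a₁₁, NozzleData.A₁₁, NozzleData.soundSq]; ring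
  · simp only [a₂₂, NozzleData.A₂₂, NozzleData.soundSq]; ring
  · simp only [a₁₂, NozzleData.A₁₂]; ring
  · simp only [a₂, a₁₂, NozzleData.A₁₂]; ring
  obtain ⟨nc, nU, nΦ⟩ := hnear p.1 hp.1
  have hcle : B.cSq p.1 ≤ mc := (le_abs_self _).trans (hmc p.1 hp.1)
  have hrp := D.rhat_pos (hsub hp.1)
  have hrl := D.rhat_le (hsub hp.1)
  have close : ∀ {x y z : ℝ}, |x - z| < η' → |y| ≤ η' → |x + y - z| < η := by
    intro x y z h1 h2
    calc |x + y - z| = |(x - z) + y| := by ring_nf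
      _ ≤ |x - z| + |y| := abs_add_le _ _
      _ < η := by rw [hη'] at *; linarith
  obtain ⟨q1, q2⟩ := hsup (k p) (B.U p.1 + u p) (v p) (B.Φ p.1 + φ p)
    ((hk.1 p (mem_univ _)).trans_lt (half_lt_self hη)) (close nU (hu.1 p (mem_univ _)))
    ((hv.1 p (mem_univ _)).trans_lt (half_lt_self hη)) (close nΦ (hφ.1 p (mem_univ _)))
  constructor
  · rw [a₁₁, div_le_iff₀ nc]
    have : α * B.cSq p.1 ≤ β := by
      calc α * B.cSq p.1 ≤ β / mc * mc := by gcongr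
        _ = β := by field_simp
    linarith
  · have e : B.a₂₂ k u v φ p = (D.soundSq (k p) (B.U p.1 + u p) (v p) (B.Φ p.1 + φ p) - v p ^ 2)
        / (B.cSq p.1 * D.rhat p.1 ^ 2) := by
      rw [a₂₂, NozzleData.A₂₂]; field_simp
    rw [e]
    refine α4.trans ?_
    gcongr
    linarith

end BackgroundFlow

end EulerPoisson
end

/-! ### The a priori estimate for Lipschitz iterates, and the proposition. -/

noncomputable section
namespace EulerPoisson

variable {D : NozzleData} (B : BackgroundFlow D)

theorem continuousOn_opL₂ {b M R : ℝ} (hlow : B.LowerOrderBounds b M) (hRb : R ≤ b)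
    {φ Ψ : ℝ × ℝ → ℝ} (hφ : IsC2 R D.θ₀ φ) (hΨ : IsC2 R D.θ₀ Ψ) :
    ContinuousOn (opL₂ B R φ Ψ) (rect 0 R (-D.θ₀) D.θ₀) := by
  have fs : ∀ {f : ℝ → ℝ}, ContinuousOn f (Icc 0 b) →
      ContinuousOn (fun p : ℝ × ℝ => f p.1) (rect 0 R (-D.θ₀) D.θ₀) := fun hf =>
    hf.comp continuousOn_fst fun p hp => ⟨hp.1.1, hp.1.2.trans hRb⟩
  obtain ⟨-, -, -, k4, k5, k6⟩ := hlow.cont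
  have e : (fun r => 1 / D.rhat r ^ 2) = fun r => (1 / D.rhat r) ^ 2 := by ext r; rw [div_pow, one_pow]
  have k7 : ContinuousOn (fun r => 1 / D.rhat r ^ 2) (Icc 0 b) := by rw [e]; exact k6.pow 2
  exact ((((hΨ.cont_rr).add ((fs k7).mul hΨ.cont_θθ)).sub ((fs k6).mul hΨ.cont_r)).add
    ((fs k4).mul hφ.cont_r)).add ((fs k5).mul hΨ.cont)

theorem continuousOn_opL₁ {b η α M R : ℝ} (hlow : B.LowerOrderBounds b M)
    (hlead : B.LeadingBounds b η α M) (hM : 0 ≤ M) (hRb : R ≤ b) {k u v w φ Ψ : ℝ × ℝ → ℝ}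
    (hk : BddLip univ η k) (hu : BddLip univ η u) (hv : BddLip univ η v) (hw : BddLip univ η w)
    (hφ : IsC2 R D.θ₀ φ) (hΨ : IsC2 R D.θ₀ Ψ) :
    ContinuousOn (opL₁ B R k u v w φ Ψ) (rect 0 R (-D.θ₀) D.θ₀) := by
  have fs : ∀ {f : ℝ → ℝ}, ContinuousOn f (Icc 0 b) →
      ContinuousOn (fun p : ℝ × ℝ => f p.1) (rect 0 R (-D.θ₀) D.θ₀) := fun hf =>
    hf.comp continuousOn_fst fun p hp => ⟨hp.1.1, hp.1.2.trans hRb⟩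
  obtain ⟨k1, k2, k3, -⟩ := hlow.cont
  obtain ⟨l11, l22, l12, l2, -⟩ := hlead.bound k u v w hk hu hv hw
  have cl : ∀ {f : ℝ × ℝ → ℝ}, BddLip (strip b) M f → ContinuousOn f (rect 0 R (-D.θ₀) D.θ₀) :=
    fun h => ((h.mono_set (rect_subset_strip hRb)).lipschitzOnWith hM).continuousOn
  exact (((((((cl l11).mul hφ.cont_rr).add ((cl l22).mul hφ.cont_θθ)).add
    ((continuousOn_const.mul (cl l12)).mul hφ.cont_rθ)).add ((fs k1).mul hφ.cont_r)).add
    ((cl l2).mul hφ.cont_θ)).add ((fs k2).mul hΨ.cont)).add ((fs k3).mul hΨ.cont_r)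

/-- The a priori estimate for iterates that are Lipschitz functions on the whole plane. -/
theorem energy_add_energy_le {b η α M R : ℝ} (hlow : B.LowerOrderBounds b M)
    (hlead : B.LeadingBounds b η α M) (hbl : b ≤ D.len) (hα : 0 < α) (hα1 : α ≤ 1)
    (hαr : α ≤ 1 / D.r₂ ^ 2) (hM : 1 ≤ M) (hR : 0 < R) (hRb : R ≤ b) (hR2 : R ≤ 1 / 2)
    (hRM : 48 * M ^ 2 * R ^ 2 ≤ 1) (hRα : R * (2 * M + 3 * M) * 20 ≤ α)
    {k u v w φ Ψ : ℝ × ℝ → ℝ}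
    (hk : BddLip univ η k) (hu : BddLip univ η u) (hv : BddLip univ η v) (hw : BddLip univ η w)
    (hvw : ∀ s ∈ Icc 0 R, v (s, D.θ₀) = 0 ∧ v (s, -D.θ₀) = 0)
    (hφ : IsC2 R D.θ₀ φ) (hΨ : IsC2 R D.θ₀ Ψ)
    (hin : ∀ θ ∈ Ioo (-D.θ₀) D.θ₀, φ (0, θ) = 0 ∧ pr R Ψ (0, θ) = 0)
    (hex : ∀ θ ∈ Ioo (-D.θ₀) D.θ₀, Ψ (R, θ) = 0)
    (hwall : ∀ r ∈ Ioo 0 R, pθ D.θ₀ φ (r, D.θ₀) = 0 ∧ pθ D.θ₀ φ (r, -D.θ₀) = 0 ∧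
      pθ D.θ₀ Ψ (r, D.θ₀) = 0 ∧ pθ D.θ₀ Ψ (r, -D.θ₀) = 0) :
    energy R D.θ₀ φ + energy R D.θ₀ Ψ ≤ 48 * M / α ^ 2 *
      ((∫ t in (-D.θ₀)..D.θ₀, pr R φ (0, t) ^ 2)
        + (∫ p in rect 0 R (-D.θ₀) D.θ₀, opL₁ B R k u v w φ Ψ p ^ 2)
        + ∫ p in rect 0 R (-D.θ₀) D.θ₀, opL₂ B R φ Ψ p ^ 2) := by
  have hθ : 0 < D.θ₀ := D.θ₀_mem.1
  have hθ' : -D.θ₀ ≤ D.θ₀ := by linarith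
  have hM0 : 0 ≤ M := by linarith
  have hmem : ∀ p ∈ rect 0 R (-D.θ₀) D.θ₀, p.1 ∈ Icc 0 b := fun p hp =>
    ⟨hp.1.1, hp.1.2.trans hRb⟩
  have hsub : rect 0 R (-D.θ₀) D.θ₀ ⊆ strip b := rect_subset_strip hRb
  have cf1 := continuousOn_opL₁ B hlow hlead hM0 hRb hk hu hv hw hφ hΨ
  have cf2 := continuousOn_opL₂ B hlow hRb hφ hΨ
  obtain ⟨l11, l22, l12, l2, hsign⟩ := hlead.bound k u v w hk hu hv hw
  -- The condition `φ = 0` along the entrance is differentiated tangentially.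
  have hφθ : ∀ t ∈ Ioo (-D.θ₀) D.θ₀, pθ D.θ₀ φ (0, t) = 0 := by
    intro t ht
    have h0 : HasDerivWithinAt (fun t => φ (0, t)) 0 (Icc (-D.θ₀) D.θ₀) t := by
      have : HasDerivAt (fun t => φ (0, t)) 0 t := by
        refine (hasDerivAt_const t (0 : ℝ)).congr_of_eventuallyEq ?_
        filter_upwards [isOpen_Ioo.mem_nhds ht] with s hs using (hin s hs).1
      exact this.hasDerivWithinAt
    exact h0.derivWithin (uniqueDiffOn_Icc (by linarith) t (Ioo_subset_Icc_self ht))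
  have ke : ContinuousOn (fun r => 1 / D.rhat r ^ 2) (Icc 0 R) := by
    have e : (fun r => 1 / D.rhat r ^ 2) = fun r => (1 / D.rhat r) ^ 2 := by
      ext r; rw [div_pow, one_pow]
    rw [e]
    exact (hlow.cont.2.2.2.2.2.mono (Icc_subset_Icc_right hRb)).pow 2
  obtain ⟨poinΨ, ell⟩ := elliptic_energy hR hθ hφ hΨ hM hRM (e := fun r => 1 / D.rhat r ^ 2)
    (k := fun p => -(1 / D.rhat p.1)) (c₁ := fun p => B.c₁ p.1) (c₂ := fun p => B.c₂ p.1)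
    ke cf2 (fun p hp => by rw [abs_neg]; exact (hlow.bound _ (hmem p hp)).2.2.2.2.2)
    (fun p hp => (hlow.bound _ (hmem p hp)).2.2.2.1)
    (fun p hp => (hlow.bound _ (hmem p hp)).2.2.2.2.1) (fun p _ => by unfold opL₂; ring)
    (fun t ht => (hin t ht).2) hex (fun s hs => (hwall s hs).2.2)
  have hyp := hyperbolic_energy hR hθ hφ hΨ hM0 hM0 (a₁₁ := B.a₁₁ k u v w) (a₂₂ := B.a₂₂ k u v w)
    (a₁₂ := B.a₁₂ u v) (a₁ := fun p => B.a₁ p.1) (a₂ := B.a₂ u v) (b₁ := fun p => B.b₁ p.1)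
    (b₂ := fun p => B.b₂ p.1) ((l11.mono_set hsub).lipschitzOnWith hM0)
    ((l22.mono_set hsub).lipschitzOnWith hM0) ((l12.mono_set hsub).lipschitzOnWith hM0) cf1
    (l11.mono_set hsub).1 (fun p hp => (hlow.bound _ (hmem p hp)).1) (l2.mono_set hsub).1
    (fun p hp => (hlow.bound _ (hmem p hp)).2.1) (fun p hp => (hlow.bound _ (hmem p hp)).2.2.1) hM
    (fun p _ => rfl)
    (fun s hs => by
      have h := hvw s (Ioo_subset_Icc_self hs)
      constructor
      · rw [BackgroundFlow.a₁₂, NozzleData.A₁₂, h.1]; simp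
      · rw [BackgroundFlow.a₁₂, NozzleData.A₁₂, h.2]; simp)
    hφθ (fun s hs => ⟨(hwall s hs).1, (hwall s hs).2.1⟩)
  -- The weight is centred at `c = R` because `φ` vanishes at the entrance. For `Ψ`, which vanishes
  -- at the exit, the centre is `0`.
  have poinφ := integral_sq_le_sq_mul_integral_deriv_sq (c := R) (d := -D.θ₀) (e := D.θ₀) hR.le hθ'
    (fun s hs => by rw [abs_sub_comm, abs_of_nonneg (by linarith [hs.2])]; linarith [hs.1])
    hφ.deriv_r hφ.cont hφ.cont_r (fun t ht => by rw [(hin t ht).1]; ring)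
  have kr := hφ.cont_r
  have kθ := hφ.cont_θ
  have c11 := ((l11.mono_set hsub).lipschitzOnWith hM0).continuousOn
  have c22 := ((l22.mono_set hsub).lipschitzOnWith hM0).continuousOn
  have low1 : α / 2 * ((∫ p in rect 0 R (-D.θ₀) D.θ₀, pr R φ p ^ 2)
      + ∫ p in rect 0 R (-D.θ₀) D.θ₀, pθ D.θ₀ φ p ^ 2)
      ≤ ∫ p in rect 0 R (-D.θ₀) D.θ₀, (-B.a₁₁ k u v w p / 2 * pr R φ p ^ 2
        + B.a₂₂ k u v w p / 2 * pθ D.θ₀ φ p ^ 2) := by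
    rw [← integral_rect_add (by fun_prop) (by fun_prop), ← integral_const_mul]
    refine integral_rect_mono (by fun_prop) (by fun_prop) fun p hp => ?_
    obtain ⟨s1, s2⟩ := hsign p (hsub hp)
    rw [mul_add]
    gcongr
    linarith
  have low2 : α * (∫ p in rect 0 R (-D.θ₀) D.θ₀, pθ D.θ₀ Ψ p ^ 2)
      ≤ ∫ p in rect 0 R (-D.θ₀) D.θ₀, 1 / D.rhat p.1 ^ 2 * pθ D.θ₀ Ψ p ^ 2 := by
    rw [← integral_const_mul]
    have kψ := hΨ.cont_θ
    refine integral_rect_mono (by fun_prop)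
      ((ke.comp continuousOn_fst fun p hp => hp.1).mul (hΨ.cont_θ.pow 2)) fun p hp => ?_
    have hp' : p.1 ∈ Icc 0 D.len := ⟨(hmem p hp).1, (hmem p hp).2.trans hbl⟩
    have := D.rhat_pos hp'
    have := D.rhat_le hp'
    gcongr
    exact hαr.trans (by gcongr)
  have sq0 : ∀ f : ℝ × ℝ → ℝ, 0 ≤ ∫ p in rect 0 R (-D.θ₀) D.θ₀, f p ^ 2 := fun f =>
    integral_rect_nonneg fun p => sq_nonneg _
  have hg0 : 0 ≤ ∫ t in (-D.θ₀)..D.θ₀, pr R φ (0, t) ^ 2 :=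
    intervalIntegral.integral_nonneg hθ' fun t _ => sq_nonneg _
  have := combine_energies hα hα1 hM hR hR2 hRα (sq0 _) (sq0 _) (sq0 _) (sq0 (pθ D.θ₀ Ψ)) hg0
    (sq0 _) (sq0 (opL₂ B R φ Ψ)) (sq0 _) poinφ poinΨ
    ((add_le_add_right low2 _).trans ell) (low1.trans hyp)
  simpa only [energy] using this

/-- Lipschitz representatives of the iterates, small in `W^{1,∞}`. -/
theorem exists_bddLip_representative {R δ δ₀ η : ℝ} (hR : 0 < R) (hRl : R ≤ D.len)
    (hη : 2 * embConst D.len D.θ₀ * δ₀ ≤ η) (hδ : δ ≤ δ₀ * Real.sqrt R) {k : ℕ} (hk : 3 ≤ k)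
    {f : ℝ × ℝ → ℝ} (hf : sobolevNorm k (domain R D.θ₀) f < ENNReal.ofReal δ) :
    ∃ F : ℝ × ℝ → ℝ, (∃ K, LipschitzWith K F) ∧ BddLip univ η F ∧
      ∀ᵐ p, p ∈ domain R D.θ₀ → f p = F p := by
  obtain ⟨F, h1, h2, h3⟩ := exists_lipschitz_of_sobolevNorm_lt D.θ₀_mem.1 hR hRl hk hf
  have hs : 0 < Real.sqrt R := Real.sqrt_pos.2 hR
  have he : 0 ≤ embConst D.len D.θ₀ := Real.sqrt_nonneg _
  have hle : 2 * (embConst D.len D.θ₀ * δ / Real.sqrt R) ≤ η := by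
    refine le_trans ?_ hη
    rw [mul_assoc]
    gcongr
    rw [div_le_iff₀ hs, mul_assoc]
    gcongr
  have h0 : 0 ≤ 2 * (embConst D.len D.θ₀ * δ / Real.sqrt R) := (abs_nonneg _).trans (h2 0)
  refine ⟨F, ⟨_, h1⟩, BddLip.mono ⟨fun p _ => h2 p, fun p _ q _ => ?_⟩ hle, h3⟩
  have := h1.dist_le_mul p q
  rwa [Real.coe_toNNReal _ h0, Real.dist_eq] at this

end EulerPoisson
end

theorem proposition3p1 (D : EulerPoisson.NozzleData) (B : EulerPoisson.BackgroundFlow D)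
    (ε₀ : ℝ) (hε₀ : 0 < ε₀) (hε₀' : ε₀ < D.len / 10) :
    ∃ Rbar δ₀ C : ℝ, 0 < Rbar ∧ Rbar ≤ D.len - ε₀ ∧ 0 < δ₀ ∧ 0 < C ∧
      ∀ R : ℝ, 0 < R → R < Rbar →
      ∀ δμ δν : ℝ, max δμ δν ≤ δ₀ * Real.sqrt R →
      ∀ Ss Ks : ℝ × ℝ → ℝ, EulerPoisson.IterSetMu R D.θ₀ δμ Ss Ks →
      ∀ Us Vs Φs : ℝ × ℝ → ℝ, EulerPoisson.IterSetNu R D.θ₀ δν Us Vs Φs →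
      ∀ (F₁ F₂ : ℝ × ℝ → ℝ) (g : ℝ → ℝ) (φ Ψ : ℝ × ℝ → ℝ),
        ContDiffOn ℝ 2 φ (EulerPoisson.closedDomain R D.θ₀) →
        ContDiffOn ℝ 2 Ψ (EulerPoisson.closedDomain R D.θ₀) →
        EulerPoisson.SolvesLinearized B R Ks Us Vs Φs F₁ F₂ g φ Ψ →
        EulerPoisson.sobolevNorm 1 (EulerPoisson.domain R D.θ₀) φ
            + EulerPoisson.sobolevNorm 1 (EulerPoisson.domain R D.θ₀) Ψ
          ≤ ENNReal.ofReal C *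
            (eLpNorm F₁ 2 (volume.restrict (EulerPoisson.domain R D.θ₀))
              + eLpNorm F₂ 2 (volume.restrict (EulerPoisson.domain R D.θ₀))
              + eLpNorm g 2 (volume.restrict (Icc (-D.θ₀) D.θ₀))) := by
  open EulerPoisson in
  obtain ⟨b, η, α, M₁, hb, hbl, hη, hα, hα1, hαr, hc, hlead⟩ := B.exists_leadingBounds
  obtain ⟨M₂, hlow⟩ := B.exists_lowerOrderBounds hbl hc
  set M := max 1 (max M₁ M₂) with hM
  have hM1 : 1 ≤ M := le_max_left _ _
  have hMM₁ : M₁ ≤ M := (le_max_left _ _).trans (le_max_right _ _)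
  have hMM₂ : M₂ ≤ M := (le_max_right _ _).trans (le_max_right _ _)
  replace hlead : B.LeadingBounds b η α M := ⟨fun k u v w hk hu hv hw => by
    obtain ⟨h1, h2, h3, h4, h5⟩ := hlead.bound k u v w hk hu hv hw
    exact ⟨h1.mono hMM₁, h2.mono hMM₁, h3.mono hMM₁, h4.mono hMM₁, h5⟩⟩
  replace hlow : B.LowerOrderBounds b M := ⟨hlow.cont, fun r hr => by
    obtain ⟨h1, h2, h3, h4, h5, h6⟩ := hlow.bound r hr
    exact ⟨h1.trans hMM₂, h2.trans hMM₂, h3.trans hMM₂, h4.trans hMM₂, h5.trans hMM₂,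
      h6.trans hMM₂⟩⟩
  have hM0 : 0 < M := by linarith
  have hθ : 0 < D.θ₀ := D.θ₀_mem.1
  have hθ' : -D.θ₀ ≤ D.θ₀ := by linarith
  have he : 0 ≤ embConst D.len D.θ₀ := Real.sqrt_nonneg _
  -- The bound `100 M R ≤ α` is the absorption condition `20 R (2M + 3M) ≤ α`, and it also implies
  -- `R ≤ 1/2` and `48 M² R² ≤ 1`. The `+ 1` in `δ₀` keeps the denominator positive. The last
  -- witness comes from taking square roots in the energy bound.
  refine ⟨min (min b (D.len - ε₀)) (α / (100 * M)), η / (2 * embConst D.len D.θ₀ + 1),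
    Real.sqrt (2 * (48 * M / α ^ 2)), ?_, ?_, by positivity, by positivity, ?_⟩
  · have := D.len_pos
    exact lt_min (lt_min hb (by linarith)) (by positivity)
  · exact (min_le_left _ _).trans (min_le_right _ _)
  intro R hR hRbar δμ δν hδ Ss Ks hμ Us Vs Φs hν F₁ F₂ g φ Ψ hφ hΨ hsol
  have hRb : R ≤ b := hRbar.le.trans ((min_le_left _ _).trans (min_le_left _ _))
  have hRl : R ≤ D.len := hRb.trans hbl
  have hRM : R * (100 * M) ≤ α := by
    rw [← le_div_iff₀ (by positivity)]
    exact hRbar.le.trans (min_le_right _ _)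
  have hηδ : 2 * embConst D.len D.θ₀ * (η / (2 * embConst D.len D.θ₀ + 1)) ≤ η := by
    rw [mul_div_assoc', div_le_iff₀ (by positivity)]
    nlinarith
  have rep : ∀ {δ : ℝ} {k : ℕ} {f : ℝ × ℝ → ℝ},
      δ ≤ η / (2 * embConst D.len D.θ₀ + 1) * Real.sqrt R → 3 ≤ k →
      sobolevNorm k (domain R D.θ₀) f < ENNReal.ofReal δ → ∃ F : ℝ × ℝ → ℝ,
        (∃ K, LipschitzWith K F) ∧ BddLip univ η F ∧
          ∀ᵐ p, p ∈ domain R D.θ₀ → f p = F p := fun hδ hk hf =>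
    exists_bddLip_representative hR hRl hηδ hδ hk hf
  have hδμ := (le_max_left δμ δν).trans hδ
  have hδν := (le_max_right δμ δν).trans hδ
  obtain ⟨k, -, hk, ek⟩ := rep hδμ (by norm_num) (le_add_self.trans_lt hμ.1)
  obtain ⟨u, -, hu, eu⟩ := rep hδν le_rfl ((le_self_add.trans le_self_add).trans_lt hν.1)
  obtain ⟨v, ⟨K, hvK⟩, hv, ev⟩ := rep hδν le_rfl ((le_add_self.trans le_self_add).trans_lt hν.1)
  obtain ⟨w, -, hw, ew⟩ := rep hδν (by norm_num) (le_add_self.trans_lt hν.1)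
  have hvw : ∀ s ∈ Icc 0 R, v (s, D.θ₀) = 0 ∧ v (s, -D.θ₀) = 0 := fun s hs =>
    eq_zero_on_walls hR hθ hvK ev hν.2.2.1 hs
  have cφ := isC2_of_contDiffOn hR hθ hφ
  have cΨ := isC2_of_contDiffOn hR hθ hΨ
  have main := energy_add_energy_le B hlow hlead hbl hα hα1 hαr hM1 hR hRb (by nlinarith)
    (by nlinarith [mul_pos hR hM0]) (by nlinarith) hk hu hv hw hvw cφ cΨ
    (fun θ hθ => (hsol.entrance θ hθ).2) hsol.exit hsol.walls
  have hm : MeasurableSet (domain R D.θ₀) := (isOpen_domain R D.θ₀).measurableSet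
  -- The Lipschitz representatives agree with the iterates almost everywhere. Hence `F₁` agrees
  -- almost everywhere with a continuous function, and its norm is a classical integral; no
  -- regularity of `F₁` has to be assumed.
  have eF₁ : eLpNorm F₁ 2 (volume.restrict (domain R D.θ₀))
      = ENNReal.ofReal (Real.sqrt
        (∫ p in rect 0 R (-D.θ₀) D.θ₀, opL₁ B R k u v w φ Ψ p ^ 2)) := by
    rw [← eLpNorm_domain_eq (continuousOn_opL₁ B hlow hlead hM0.le hRb hk hu hv hw cφ cΨ)]
    apply eLpNorm_congr_ae
    filter_upwards [hsol.eq₁, (ae_restrict_iff' hm).2 ek, (ae_restrict_iff' hm).2 eu,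
      (ae_restrict_iff' hm).2 ev, (ae_restrict_iff' hm).2 ew] with p h0 h1 h2 h3 h4
    rw [← h0]
    simp only [opL₁, BackgroundFlow.a₁₁, BackgroundFlow.a₂₂, BackgroundFlow.a₁₂,
      BackgroundFlow.a₂, h1, h2, h3, h4]
  have eF₂ : eLpNorm F₂ 2 (volume.restrict (domain R D.θ₀))
      = ENNReal.ofReal (Real.sqrt (∫ p in rect 0 R (-D.θ₀) D.θ₀, opL₂ B R φ Ψ p ^ 2)) := by
    rw [← eLpNorm_domain_eq (continuousOn_opL₂ B hlow hRb cφ cΨ)]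
    apply eLpNorm_congr_ae
    filter_upwards [hsol.eq₂] with p h0 using h0.symm
  have eg : eLpNorm g 2 (volume.restrict (Icc (-D.θ₀) D.θ₀))
      = ENNReal.ofReal (Real.sqrt (∫ t in (-D.θ₀)..D.θ₀, pr R φ (0, t) ^ 2)) := by
    rw [← eLpNorm_Icc_eq hθ (continuousOn_slice_right cφ.cont_r (left_mem_Icc.2 hR.le))]
    apply eLpNorm_congr_ae
    rw [← Measure.restrict_congr_set (Ioo_ae_eq_Icc (a := -D.θ₀) (b := D.θ₀))]
    filter_upwards [ae_restrict_mem measurableSet_Ioo] with t ht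
    exact (hsol.entrance t ht).1.symm
  rw [eF₁, eF₂, eg, ← ENNReal.ofReal_add (Real.sqrt_nonneg _) (Real.sqrt_nonneg _),
    ← ENNReal.ofReal_add (add_nonneg (Real.sqrt_nonneg _) (Real.sqrt_nonneg _))
      (Real.sqrt_nonneg _), ← ENNReal.ofReal_mul (Real.sqrt_nonneg _)]
  refine (add_le_add (sobolevNorm_one_le hR hθ cφ) (sobolevNorm_one_le hR hθ cΨ)).trans ?_
  rw [← ENNReal.ofReal_add (Real.sqrt_nonneg _) (Real.sqrt_nonneg _)]
  apply ENNReal.ofReal_le_ofReal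
  exact sqrt_add_sqrt_le energy_nonneg energy_nonneg (by positivity) (by linarith)
    (integral_rect_nonneg fun p => sq_nonneg _) (integral_rect_nonneg fun p => sq_nonneg _)
    (intervalIntegral.integral_nonneg hθ' fun t _ => sq_nonneg _)
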